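/- Let $d\ge1$, $\mathcal M(v)=(2\pi)^{-d/2}e^{-|v|^2/2}$ and $d\gamma=\mathcal M(v)^{-1}\,dv$ on $\mathbb R^d$. Let $\mathsf L$ be either the Fokker--Planck operator $\mathsf L_1f=\Delta_vf+\nabla_v\cdot(v\,f)$ or the linear BGK operator $\mathsf L_2f=\rho_f\,\mathcal M-f$, $\rho_f=\int_{\mathbb R^d}f\,dv$. *Mode-by-mode quantities.* For $\xi\in\mathbb R^d$ and complex-valued $F\in L^2(d\gamma)$, with scalar product $\langle\cdot,\cdot\rangle$ and norm $\|\cdot\|$ of $L^2(d\gamma)$, let $$\Pi F=\mathcal M\int F\,dv,\quad \mathsf TF=i\,(v\cdot\xi)\,F,\quad \mathsf AF=-\frac{i\,\xi}{1+|\xi|^2}\cdot\int w\,F(w)\,dw\;\mathcal M,$$ and, for $\delta>0$, $\mathsf H_1[F]=\frac12\|F\|^2+\delta\,\mathrm{Re}\langle\mathsf AF,F\rangle$ and $$\mathsf D[F]=-\langle\mathsf LF,F\rangle+\delta\langle\mathsf{AT}\Pi F,F\rangle-\delta\,\mathrm{Re}\langle\mathsf{TA}F,F\rangle+\delta\,\mathrm{Re}\langle\mathsf{AT}(\mathrm{Id}-\Pi)F,F\rangle-\delta\,\mathrm{Re}\langle\mathsf{AL}F,F\rangle.$$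 *Admissible pairs.* Let $\delta:(0,\infty)\to(0,2)$ and $\lambda:(0,\infty)\to(0,\infty)$ be continuous, with $\lambda$ non-decreasing, such that for every $\xi\in\mathbb R^d\setminus\{0\}$, with $s=|\xi|$, $\delta=\delta(s)$, $\lambda=\lambda(s)$, one has $$\mathsf D[F]\ge\lambda\,\mathsf H_1[F]\quad\text{for all }F\text{ in the domains of }\mathsf L\text{ and }\mathsf T\text{ in }L^2(d\gamma),$$ $$\tfrac12\Big(1-\tfrac{\delta s}{1+s^2}\Big)\|F\|^2\le\mathsf H_1[F]\le\tfrac12\Big(1+\tfrac{\delta s}{1+s^2}\Big)\|F\|^2\quad\text{for all }F\in L^2(d\gamma).$$ Let $C(s)=\dfrac{2+\delta(s)}{2-\delta(s)}$, $\omega_d=|\mathbb S^{d-1}|/d$, and for $M,Q\ge0$, $t\ge0$ let $$\Psi_{M,Q}(t)=\inf_{R>0}\left(\int_0^RC(s)\,e^{-\lambda(s)t}\,s^{d-1}\,ds\;\omega_d\,d\,M^2+\sup_{s\ge R}C(s)\,e^{-\lambda(R)t}\,Q^2\right)\in[0,+\infty].$$ **Theorem.** Let $f_0\in L^2(\mathbb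 R^d\times\mathbb R^d,dx\,d\gamma)\cap L^2(\mathbb R^d,d\gamma;L^1(\mathbb R^d,dx))$ be nonnegative and let $f\in C([0,\infty);L^2(dx\,d\gamma))$ solve $\partial_tf+v\cdot\nabla_xf=\mathsf Lf$ in the sense of distributions, with $f(0)=f_0$. Then for every admissible pair $(\delta,\lambda)$ and every $t\ge0$, $$\|f(t)\|_{L^2(dx\,d\gamma)}^2\le(2\pi)^{-d}\,\Psi_{M,Q}(t),$$ where $M=\|f_0\|_{L^2(d\gamma;L^1(dx))}$ and $Q=(2\pi)^{d/2}\,\|f_0\|_{L^2(dx\,d\gamma)}$, that is, $Q=\|\hat f_0\|_{L^2(d\xi\,d\gamma)}$ with $\hat f_0(\xi,v)=\int e^{-ix\cdot\xi}f_0(x,v)\,dx$. -/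

import Mathlib

open MeasureTheory Set
open scoped ENNReal ContDiff

noncomputable section

namespace Kinetic

/-- The Euclidean space `ℝ^d`. -/
abbrev E (d : ℕ) : Type := EuclideanSpace ℝ (Fin d)

/-- The normalized Gaussian `𝓜(v) = (2π)^{-d/2} exp(-|v|²/2)`. -/
def maxwellian {d : ℕ} (v : E d) : ℝ :=
  Real.exp (-(‖v‖ ^ 2 / 2)) / (2 * Real.pi) ^ ((d : ℝ) / 2)

/-- The measure `dγ = γ(v) dv` on velocities, with `γ = 1 / 𝓜`. -/
def gammaMeasure (d : ℕ) : Measure (E d) :=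
  volume.withDensity fun v => ENNReal.ofReal (1 / maxwellian v)

/-- The measure `dx dγ` on the phase space of the `(x, v)`. -/
def phaseMeasure (d : ℕ) : Measure (E d × E d) :=
  (volume : Measure (E d)).prod (gammaMeasure d)

/-- The two collision operators: Fokker-Planck, `L₁ f = Δ_v f + ∇_v · (v f)`,
and linear BGK, `L₂ f = ρ_f 𝓜 - f`. -/
inductive Collision
  | fokkerPlanck
  | bgk

/-! ### The kinetic equation in the whole space -/

/-- The adjoint of the Fokker-Planck operator on a smooth function: `Δ φ - v · ∇ φ`. -/
def fokkerPlanckAdjoint {d : ℕ} (φ : E d → ℝ) (v : E d) : ℝ :=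
  Laplacian.laplacian φ v - fderiv ℝ φ v v

/-- The spatial density `ρ_f(x) = ∫ f(x, v) dv`. -/
def spatialDensity {d : ℕ} (f : E d × E d → ℝ) (x : E d) : ℝ := ∫ v, f (x, v)

/-- The distribution `L f` tested against `φ`: the pairing `∬ (L f) φ dx dv`, where the derivatives
of the Fokker-Planck operator are carried by the test function. -/
def collisionPairing {d : ℕ} (L : Collision) (f φ : E d × E d → ℝ) : ℝ :=
  match L with
  | .fokkerPlanck => ∫ z : E d × E d, f z * fokkerPlanckAdjoint (fun w => φ (z.1, w)) z.2
  | .bgk => ∫ z : E d × E d, (spatialDensity f z.1 * maxwellian z.2 - f z) * φ z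

/-- The distribution `- v · ∇_x f` tested against `φ`, that is, `∬ f v · ∇_x φ dx dv`. -/
def transportPairing {d : ℕ} (f φ : E d × E d → ℝ) : ℝ :=
  ∫ z : E d × E d, f z * fderiv ℝ (fun y => φ (y, z.2)) z.1 z.2

/-- `f ∈ C([0, ∞); L²(dx dγ))` solves `∂ₜ f + v · ∇ₓ f = L f` with initial datum `f₀`, in the sense
of distributions in `(x, v)`, the equation being integrated in time. -/
structure IsSolution {d : ℕ} (L : Collision) (f₀ : E d × E d → ℝ)
    (f : ℝ → Lp ℝ 2 (phaseMeasure d)) : Prop where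
  continuousOn : ContinuousOn f (Ici 0)
  initial : f 0 =ᵐ[phaseMeasure d] f₀
  equation : ∀ φ : E d × E d → ℝ, ContDiff ℝ ∞ φ → HasCompactSupport φ → ∀ t : ℝ, 0 ≤ t →
    ∫ z, f t z * φ z = (∫ z, f₀ z * φ z) +
      ∫ s in (0 : ℝ)..t, (transportPairing (f s) φ + collisionPairing L (f s) φ)

/-! ### The problem for a given Fourier mode `ξ`, in `ℋ = L²(dγ)` (complex valued) -/

/-- The scalar product of `L²(dγ)`. -/
def ip {d : ℕ} (F G : E d → ℂ) : ℂ := ∫ v, F v * (starRingEnd ℂ) (G v) ∂(gammaMeasure d)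

/-- The squared norm `‖F‖² = ∫ |F|² dγ`. -/
def normSq {d : ℕ} (F : E d → ℂ) : ℝ := ∫ v, ‖F v‖ ^ 2 ∂(gammaMeasure d)

/-- The projection `Π F = 𝓜 ∫ F dv`. -/
def proj {d : ℕ} (F : E d → ℂ) (v : E d) : ℂ := (maxwellian v : ℂ) * ∫ w, F w

/-- The transport operator `T F = i (v · ξ) F`. -/
def transport {d : ℕ} (ξ : E d) (F : E d → ℂ) (v : E d) : ℂ :=
  Complex.I * ((inner ℝ v ξ : ℝ) : ℂ) * F v

/-- The operator `A F = - (i ξ / (1 + |ξ|²)) · (∫ w F(w) dw) 𝓜`. -/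
def opA {d : ℕ} (ξ : E d) (F : E d → ℂ) (v : E d) : ℂ :=
  -(Complex.I / ((1 + ‖ξ‖ ^ 2 : ℝ) : ℂ)) * (∫ w, ((inner ℝ ξ w : ℝ) : ℂ) * F w) *
    (maxwellian v : ℂ)

/-- `G = L F`, for functions of the velocity; the derivatives of the Fokker-Planck operator are
taken in the sense of distributions. -/
def IsCollision {d : ℕ} (L : Collision) (F G : E d → ℂ) : Prop :=
  match L with
  | .fokkerPlanck => ∀ φ : E d → ℝ, ContDiff ℝ ∞ φ → HasCompactSupport φ →
      ∫ v, G v * (φ v : ℂ) = ∫ v, F v * (fokkerPlanckAdjoint φ v : ℂ)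
  | .bgk => G =ᵐ[volume] fun v => proj F v - F v

/-- The Lyapunov functional `H₁[F] = ‖F‖² / 2 + δ Re ⟨A F, F⟩`. -/
def entropy {d : ℕ} (ξ : E d) (δ : ℝ) (F : E d → ℂ) : ℝ :=
  1 / 2 * normSq F + δ * (ip (opA ξ F) F).re

/-- The entropy production `D[F]`, where `G` stands for `L F`:
`- ⟨L F, F⟩ + δ ⟨A T Π F, F⟩ - δ Re ⟨T A F, F⟩ + δ Re ⟨A T (Id - Π) F, F⟩ - δ Re ⟨A L F, F⟩`. -/
def entropyProduction {d : ℕ} (ξ : E d) (δ : ℝ) (F G : E d → ℂ) : ℝ :=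
  -(ip G F).re + δ * (ip (opA ξ (transport ξ (proj F))) F).re
    - δ * (ip (transport ξ (opA ξ F)) F).re
    + δ * (ip (opA ξ (transport ξ (fun v => F v - proj F v))) F).re
    - δ * (ip (opA ξ G) F).re

/-- The entropy - entropy production inequality `D[F] ≥ lam H₁[F]` for the mode `ξ`,
for all `F` in the domain of `L` and of `T` in `L²(dγ)`. -/
def EntropyProductionInequality {d : ℕ} (L : Collision) (ξ : E d) (δ lam : ℝ) : Prop :=
  ∀ F G : E d → ℂ, MemLp F 2 (gammaMeasure d) → MemLp (transport ξ F) 2 (gammaMeasure d) →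
    MemLp G 2 (gammaMeasure d) → IsCollision L F G →
    lam * entropy ξ δ F ≤ entropyProduction ξ δ F G

/-- The equivalence, for the mode `ξ`, of `H₁[F]` with `‖F‖²`, with constants
`(1 ± δ |ξ| / (1 + |ξ|²)) / 2`. -/
def EntropyNormEquivalence {d : ℕ} (ξ : E d) (δ : ℝ) : Prop :=
  ∀ F : E d → ℂ, MemLp F 2 (gammaMeasure d) →
    1 / 2 * (1 - δ * ‖ξ‖ / (1 + ‖ξ‖ ^ 2)) * normSq F ≤ entropy ξ δ F ∧
      entropy ξ δ F ≤ 1 / 2 * (1 + δ * ‖ξ‖ / (1 + ‖ξ‖ ^ 2)) * normSq F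

/-! ### The bound -/

/-- `ω_d = |𝕊^{d-1}| / d`. -/
def omega (d : ℕ) : ℝ≥0∞ := (volume : Measure (E d)).toSphere univ / d

/-- The function
`Ψ_{M,Q}(t) = inf_{R > 0} ( ∫_0^R C(s) exp(-lam(s) t) s^{d-1} ds ω_d d M²
  + sup_{s ≥ R} C(s) exp(-lam(R) t) Q² )`, with values in `[0, ∞]`. -/
def Psi (d : ℕ) (C lam : ℝ → ℝ) (M Q : ℝ≥0∞) (t : ℝ) : ℝ≥0∞ :=
  ⨅ (R : ℝ) (_ : 0 < R),
    ((∫⁻ s in Ioc 0 R, ENNReal.ofReal (C s * Real.exp (-(lam s * t)) * s ^ (d - 1)))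
        * omega d * d * M ^ 2
      + (⨆ (s : ℝ) (_ : R ≤ s), ENNReal.ofReal (C s))
        * ENNReal.ofReal (Real.exp (-(lam R * t))) * Q ^ 2)

/-- The norm of `L²(dγ; L¹(dx))`. -/
def mixedNorm {d : ℕ} (f : E d × E d → ℝ) : ℝ≥0∞ :=
  eLpNorm (fun v : E d => eLpNorm (fun x : E d => f (x, v)) 1 volume) 2 (gammaMeasure d)

end Kinetic

end

open MeasureTheory Set
open scoped ENNReal ContDiff

noncomputable section

namespace Kinetic

/-! ### The Gaussian weight -/

section Gaussian

variable {d : ℕ}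

/-! Fourier transform in `x` decouples the frequencies, and at each frequency the hypothesis is a
Lyapunov inequality with rate `lam`. The formal argument is short: Grönwall at frequency `ξ`,
together with the equivalence of `entropy` and `normSq`, bounds the energy at `ξ` by `C(s)
exp(-lam(s) t)` times its initial value. For `s ≤ R` the initial energy is at most `M²`, since the
transform in `x` is bounded by the `L¹(dx)` norm for each `v`. For `s > R` the monotonicity of `lam`
and Plancherel give the other term.

The difficulty is regularity. The solution is only continuous in time with values in `L²(dx dγ)` and
the equation holds in the sense of distributions, so nothing puts the transform of `f t` in the
domains of `L` and `T`, where the inequality is assumed. The remedy is to expand in Hermite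
functions `h_k 𝓜` of the velocity, which form a complete orthogonal system
(`isHilbertSum_hermiteEmb`, `hasSum_norm_coeff_sq`). In this basis both collision operators are
diagonal, and multiplication by `ξ · v` only couples neighbouring indices. The equation becomes a
tridiagonal system for the coefficients at almost every frequency (`IsWeakDerivative.mode`). The
frequency variable `ζ` of the Fourier transform used here corresponds to `ξ = 2π ζ`.

A finite Hermite sum lies in every domain, so the assumed inequality applies to the truncation to
the box of indices at most `N` (`entropyProduction_hermState`, `modeEntropyDeriv_le`). The truncated
sum does not solve the equation: skew-symmetry of transport fails through the faces of the box, with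
an error of size `√(N+1)` times the energy of the modes near the faces. These face energies are
summable in `N` (`sum_faceEnergy_le`) while `∑ 1/√N` diverges, so the error is arbitrarily small for
suitable large `N` (`exists_sqrt_mul_le`).

Time derivatives are made rigorous by restricting to bounded sets of frequencies. There the symbol
of transport is bounded, the localized modes are images of `f t` by bounded operators, and the
integrated equation makes them continuously differentiable (`IsSolution.isWeakDerivative`,
`IsWeakDerivative.cut`). Grönwall is applied to the entropy integrated over such a set
(`IsAdmissible.lintegral_decay`). Varying the set yields the estimate at almost every frequency
(`modeDensity_decay`), and `modeDensity_le_mixedNorm` and `lintegral_le_of_splitting` conclude. -/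

lemma maxwellian_pos (v : E d) : 0 < maxwellian v := by
  unfold maxwellian; positivity

lemma continuous_maxwellian : Continuous (maxwellian : E d → ℝ) := by
  unfold maxwellian; fun_prop

/-- The one-dimensional Gaussian density. -/
def gauss (x : ℝ) : ℝ := Real.exp (-(x ^ 2 / 2)) / √(2 * Real.pi)

lemma maxwellian_eq_prod (v : E d) : maxwellian v = ∏ j, gauss (v j) := by
  unfold maxwellian gauss
  rw [Finset.prod_div_distrib, ← Real.exp_sum, EuclideanSpace.norm_sq_eq]
  congr 1
  · simp [Finset.sum_neg_distrib, Finset.sum_div]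
  · simp only [Finset.prod_const, Finset.card_univ, Fintype.card_fin]
    rw [Real.sqrt_eq_rpow, ← Real.rpow_natCast, ← Real.rpow_mul (by positivity)]
    congr 1; ring

section density
variable {X : Type*} [MeasurableSpace X] {μ : Measure X} {V : Type*} [NormedAddCommGroup V]
  [NormedSpace ℝ V] {w : X → ℝ}

lemma integrable_withDensity_ofReal_iff (hw : Measurable w) (hpos : ∀ x, 0 < w x) (F : X → V) :
    Integrable F (μ.withDensity fun x => ENNReal.ofReal (w x)) ↔
      Integrable (fun x => w x • F x) μ := by
  rw [integrable_withDensity_iff_integrable_smul' (by fun_prop) (by simp)]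
  simp [ENNReal.toReal_ofReal, (hpos _).le]

lemma integral_withDensity_ofReal (hw : Measurable w) (hpos : ∀ x, 0 < w x) (F : X → V) :
    ∫ x, F x ∂(μ.withDensity fun x => ENNReal.ofReal (w x)) = ∫ x, w x • F x ∂μ := by
  rw [integral_withDensity_eq_integral_toReal_smul (by fun_prop) (by simp)]
  simp [ENNReal.toReal_ofReal, (hpos _).le]

/-- A positive density creates no new null sets, so almost-everywhere statements pass freely between
Lebesgue measure and the weighted measures. -/
lemma absolutelyContinuous_withDensity_ofReal (hw : Measurable w) (hpos : ∀ x, 0 < w x) :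
    μ ≪ μ.withDensity fun x => ENNReal.ofReal (w x) :=
  withDensity_absolutelyContinuous' (by fun_prop) (by simp [hpos])

end density

lemma measurable_inv_maxwellian : Measurable fun v : E d => 1 / maxwellian v :=
  measurable_const.div continuous_maxwellian.measurable

lemma inv_maxwellian_pos (v : E d) : 0 < 1 / maxwellian v := one_div_pos.2 (maxwellian_pos v)

lemma phaseMeasure_eq : phaseMeasure d =
    (volume : Measure (E d × E d)).withDensity fun z => ENNReal.ofReal (1 / maxwellian z.2) := by
  unfold phaseMeasure gammaMeasure
  rw [prod_withDensity_right (by have := @measurable_inv_maxwellian d; fun_prop)]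
  rfl

lemma measurable_inv_maxwellian_snd : Measurable fun z : E d × E d => 1 / maxwellian z.2 :=
  measurable_inv_maxwellian.comp measurable_snd

lemma volume_ac_gammaMeasure : (volume : Measure (E d)) ≪ gammaMeasure d :=
  absolutelyContinuous_withDensity_ofReal measurable_inv_maxwellian inv_maxwellian_pos

lemma gammaMeasure_ac_volume : gammaMeasure d ≪ volume := withDensity_absolutelyContinuous _ _

lemma volume_ac_phaseMeasure : (volume : Measure (E d × E d)) ≪ phaseMeasure d := by
  rw [phaseMeasure_eq]
  exact absolutelyContinuous_withDensity_ofReal measurable_inv_maxwellian_snd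
    fun z => inv_maxwellian_pos z.2

lemma phaseMeasure_ac_volume : phaseMeasure d ≪ volume := by
  rw [phaseMeasure_eq]; exact withDensity_absolutelyContinuous _ _

instance : SFinite (gammaMeasure d) := by unfold gammaMeasure; infer_instance

section
variable {V : Type*} [NormedAddCommGroup V] [NormedSpace ℝ V]

lemma integrable_gamma_iff (F : E d → V) :
    Integrable F (gammaMeasure d) ↔ Integrable (fun v => (1 / maxwellian v) • F v) :=
  integrable_withDensity_ofReal_iff measurable_inv_maxwellian inv_maxwellian_pos F

lemma integral_gamma (F : E d → V) :
    ∫ v, F v ∂(gammaMeasure d) = ∫ v, (1 / maxwellian v) • F v :=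
  integral_withDensity_ofReal measurable_inv_maxwellian inv_maxwellian_pos F

lemma integrable_phase_iff (F : E d × E d → V) :
    Integrable F (phaseMeasure d) ↔ Integrable (fun z => (1 / maxwellian z.2) • F z) := by
  rw [phaseMeasure_eq]
  exact integrable_withDensity_ofReal_iff measurable_inv_maxwellian_snd
    (fun z => inv_maxwellian_pos z.2) F

lemma integral_phase (F : E d × E d → V) :
    ∫ z, F z ∂(phaseMeasure d) = ∫ z, (1 / maxwellian z.2) • F z := by
  rw [phaseMeasure_eq]
  exact integral_withDensity_ofReal measurable_inv_maxwellian_snd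
    (fun z => inv_maxwellian_pos z.2) F

/-- The factor `𝓜` cancels the weight `1/𝓜` of `dγ`. This is how scalar products with `g 𝓜` become
unweighted integrals against `g`. -/
lemma integrable_gamma_maxwellian_smul_iff (F : E d → V) :
    Integrable (fun v => maxwellian v • F v) (gammaMeasure d) ↔ Integrable F := by
  rw [integrable_gamma_iff]
  simp [smul_smul, (maxwellian_pos _).ne']

lemma integral_gamma_maxwellian_smul (F : E d → V) :
    ∫ v, maxwellian v • F v ∂(gammaMeasure d) = ∫ v, F v := by
  rw [integral_gamma]
  simp [smul_smul, (maxwellian_pos _).ne']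

lemma integrable_phase_maxwellian_smul_iff (F : E d × E d → V) :
    Integrable (fun z => maxwellian z.2 • F z) (phaseMeasure d) ↔ Integrable F := by
  rw [integrable_phase_iff]
  simp [smul_smul, (maxwellian_pos _).ne']

lemma integral_phase_maxwellian_smul (F : E d × E d → V) :
    ∫ z, maxwellian z.2 • F z ∂(phaseMeasure d) = ∫ z, F z := by
  rw [integral_phase]
  simp [smul_smul, (maxwellian_pos _).ne']

end

end Gaussian

/-! ### Functions of exponential growth -/

/-- Growth at most exponential. -/
def ExpGrowth {V W : Type*} [Norm V] [Norm W] (g : V → W) : Prop :=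
  ∃ C c : ℝ, 0 ≤ C ∧ 0 ≤ c ∧ ∀ v, ‖g v‖ ≤ C * Real.exp (c * ‖v‖)

namespace ExpGrowth

section
variable {V W : Type*} [SeminormedAddCommGroup V] [SeminormedAddCommGroup W]

lemma mono {W' : Type*} [Norm W'] {g : V → W} {h : V → W'} (hg : ExpGrowth g)
    (hh : ∀ v, ‖h v‖ ≤ ‖g v‖) : ExpGrowth h := by
  obtain ⟨C, c, hC, hc, H⟩ := hg
  exact ⟨C, c, hC, hc, fun v => (hh v).trans (H v)⟩

lemma const (a : W) : ExpGrowth (fun _ : V => a) :=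
  ⟨‖a‖, 0, by positivity, le_rfl, by simp⟩

lemma id : ExpGrowth (fun v : V => v) :=
  ⟨1, 1, by positivity, by positivity, fun v => by
    have := Real.add_one_le_exp ‖v‖
    simp; linarith⟩

lemma add {g h : V → W} (hg : ExpGrowth g) (hh : ExpGrowth h) : ExpGrowth (fun v => g v + h v) := by
  obtain ⟨C, c, hC, hc, H⟩ := hg
  obtain ⟨C', c', hC', hc', H'⟩ := hh
  refine ⟨C + C', c + c', by positivity, by positivity, fun v => (norm_add_le _ _).trans ?_⟩
  have h1 : Real.exp (c * ‖v‖) ≤ Real.exp ((c + c') * ‖v‖) := by gcongr; linarith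
  have h2 : Real.exp (c' * ‖v‖) ≤ Real.exp ((c + c') * ‖v‖) := by gcongr; linarith
  calc _ ≤ C * Real.exp (c * ‖v‖) + C' * Real.exp (c' * ‖v‖) := add_le_add (H v) (H' v)
    _ ≤ C * Real.exp ((c + c') * ‖v‖) + C' * Real.exp ((c + c') * ‖v‖) := by gcongr
    _ = _ := by ring

lemma sum {ι : Type*} (s : Finset ι) {g : ι → V → W} (hg : ∀ i ∈ s, ExpGrowth (g i)) :
    ExpGrowth (fun v => ∑ i ∈ s, g i v) := by
  classical
  induction s using Finset.induction_on with
  | empty => simpa using const (0 : W)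
  | insert a s ha ih =>
    simp only [Finset.sum_insert ha]
    exact (hg a (by simp)).add (ih fun i hi => hg i (by simp [hi]))

lemma comp_le {V' : Type*} [SeminormedAddCommGroup V'] {g : V → W} (hg : ExpGrowth g) {l : V' → V}
    (hl : ∀ v, ‖l v‖ ≤ ‖v‖) : ExpGrowth (fun v => g (l v)) := by
  obtain ⟨C, c, hC, hc, H⟩ := hg
  refine ⟨C, c, hC, hc, fun v => (H _).trans ?_⟩
  have := hl v
  gcongr

lemma norm {g : V → W} (hg : ExpGrowth g) : ExpGrowth (fun v => ‖g v‖) := hg.mono (by simp)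

lemma exp_norm (a : ℝ) : ExpGrowth (fun v : V => Real.exp (a * ‖v‖)) :=
  ⟨1, |a|, by positivity, by positivity, fun v => by
    simp only [Real.norm_eq_abs, Real.abs_exp, one_mul]; gcongr; exact le_abs_self a⟩

end

variable {V W : Type*} [SeminormedAddCommGroup V] [NormedField W]

lemma mul {g h : V → W} (hg : ExpGrowth g) (hh : ExpGrowth h) : ExpGrowth (fun v => g v * h v) := by
  obtain ⟨C, c, hC, hc, H⟩ := hg
  obtain ⟨C', c', hC', hc', H'⟩ := hh
  refine ⟨C * C', c + c', by positivity, by positivity, fun v => ?_⟩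
  rw [norm_mul, add_mul, Real.exp_add]
  calc _ ≤ (C * Real.exp (c * ‖v‖)) * (C' * Real.exp (c' * ‖v‖)) := by gcongr <;> simp_all
    _ = _ := by ring

lemma pow {g : V → W} (hg : ExpGrowth g) (n : ℕ) : ExpGrowth (fun v => g v ^ n) := by
  induction n with
  | zero => simpa using const (1 : W)
  | succ n ih => simpa only [pow_succ] using ih.mul hg

lemma prod {ι : Type*} (s : Finset ι) {g : ι → V → W} (hg : ∀ i ∈ s, ExpGrowth (g i)) :
    ExpGrowth (fun v => ∏ i ∈ s, g i v) := by
  classical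
  induction s using Finset.induction_on with
  | empty => simpa using const (1 : W)
  | insert a s ha ih =>
    simp only [Finset.prod_insert ha]
    exact (hg a (by simp)).mul (ih fun i hi => hg i (by simp [hi]))

end ExpGrowth

lemma expGrowth_polynomial (p : Polynomial ℝ) : ExpGrowth (fun x : ℝ => p.eval x) := by
  induction p using Polynomial.induction_on' with
  | add p q hp hq => simpa using hp.add hq
  | monomial n a => simpa using (ExpGrowth.const a).mul (ExpGrowth.id.pow n)

section
variable {d : ℕ}

lemma expGrowth_coord (j : Fin d) : ExpGrowth (fun v : E d => v j) :=
  ExpGrowth.id.mono fun v => PiLp.norm_apply_le v j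

lemma integrable_exp_norm_mul_exp_neg_sq {V : Type*} [NormedAddCommGroup V]
    [InnerProductSpace ℝ V] [FiniteDimensional ℝ V] [MeasurableSpace V] [BorelSpace V] (c : ℝ) :
    Integrable fun v : V => Real.exp (c * ‖v‖) * Real.exp (-(‖v‖ ^ 2 / 2)) := by
  -- Half of the Gaussian absorbs the exponential: `c r - r²/2 ≤ c² - r²/4`, the difference being
  -- `(c - r/2)²`.
  have h := (GaussianFourier.integrable_cexp_neg_mul_sq_norm_add (V := V) (b := (1 / 4 : ℝ))
    (by rw [Complex.ofReal_re]; norm_num) 0 0).norm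
  refine (h.const_mul (Real.exp (c ^ 2))).mono' ?_ ?_
  · exact Continuous.aestronglyMeasurable (by fun_prop)
  · refine Filter.Eventually.of_forall fun v => ?_
    rw [Real.norm_of_nonneg (by positivity), Complex.norm_exp, ← Real.exp_add, ← Real.exp_add]
    refine Real.exp_le_exp.2 ?_
    have : ((-((1 / 4 : ℝ) : ℂ) * (‖v‖ : ℂ) ^ 2 + 0 * ((inner ℝ (0 : V) v : ℝ) : ℂ))).re
        = - (1 / 4) * ‖v‖ ^ 2 := by
      rw [zero_mul, add_zero, ← Complex.ofReal_neg, ← Complex.ofReal_pow, ← Complex.ofReal_mul,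
        Complex.ofReal_re]
    rw [this]
    nlinarith [sq_nonneg (c - ‖v‖ / 2)]

lemma integrable_exp_norm_mul_maxwellian (c : ℝ) :
    Integrable fun v : E d => Real.exp (c * ‖v‖) * maxwellian v := by
  simpa only [maxwellian, mul_div_assoc] using
    (integrable_exp_norm_mul_exp_neg_sq (V := E d) c).div_const ((2 * Real.pi) ^ ((d : ℝ) / 2))

lemma ExpGrowth.integrable_mul_gauss {g : ℝ → ℝ} (hg : ExpGrowth g) (hm : AEStronglyMeasurable g) :
    Integrable fun x => g x * gauss x := by
  obtain ⟨C, c, hC, hc, H⟩ := hg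
  have hcont : Continuous gauss := by unfold gauss; fun_prop
  refine (((integrable_exp_norm_mul_exp_neg_sq (V := ℝ) c).div_const
    (√(2 * Real.pi))).const_mul C).mono' (hm.mul hcont.aestronglyMeasurable) ?_
  refine Filter.Eventually.of_forall fun x => ?_
  have hx : 0 ≤ gauss x := by unfold gauss; positivity
  have e : Real.exp (c * ‖x‖) * Real.exp (-(‖x‖ ^ 2 / 2)) / √(2 * Real.pi)
      = Real.exp (c * ‖x‖) * gauss x := by simp [gauss, mul_div_assoc]
  rw [norm_mul, e, Real.norm_of_nonneg hx, ← mul_assoc]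
  exact mul_le_mul_of_nonneg_right (H x) hx

lemma ExpGrowth.integrable_mul_maxwellian {W : Type*} [NormedAddCommGroup W] [NormedSpace ℝ W]
    {g : E d → W} (hg : ExpGrowth g)
    (hm : AEStronglyMeasurable g) : Integrable fun v => maxwellian v • g v := by
  obtain ⟨C, c, hC, hc, H⟩ := hg
  refine ((integrable_exp_norm_mul_maxwellian (d := d) c).const_mul C).mono' ?_ ?_
  · exact continuous_maxwellian.aestronglyMeasurable.smul hm
  · refine Filter.Eventually.of_forall fun v => ?_
    rw [norm_smul, Real.norm_of_nonneg (maxwellian_pos v).le]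
    nlinarith [H v, maxwellian_pos v]

/-- A function of exponential growth, times the Gaussian, belongs to `L²(dγ)`. -/
lemma ExpGrowth.memLp_maxwellian_smul {W : Type*} [NormedAddCommGroup W] [NormedSpace ℝ W]
    {g : E d → W} (hg : ExpGrowth g)
    (hm : AEStronglyMeasurable g) :
    MemLp (fun v => maxwellian v • g v) 2 (gammaMeasure d) := by
  have hm' : AEStronglyMeasurable (fun v => maxwellian v • g v) (gammaMeasure d) :=
    (continuous_maxwellian.aestronglyMeasurable.smul hm).mono_ac gammaMeasure_ac_volume
  rw [← memLp_norm_iff hm', memLp_two_iff_integrable_sq hm'.norm, integrable_gamma_iff]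
  refine ((hg.norm.pow 2).integrable_mul_maxwellian (by fun_prop)).congr ?_
  refine Filter.Eventually.of_forall fun v => ?_
  have := (maxwellian_pos v).ne'
  simp only [norm_smul, Real.norm_of_nonneg (maxwellian_pos v).le, smul_eq_mul]
  field_simp

end

/-! ### Normalized Hermite polynomials on the line -/

open Polynomial in
-- Induction on the recurrence `H_{n+1} = X H_n - H_n'`, differentiated once.
lemma derivative_hermite_succ (n : ℕ) :
    derivative (hermite (n + 1)) = (n + 1 : ℤ[X]) * hermite n := by
  induction n with
  | zero => simp [hermite_succ]
  | succ n ih =>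
    rw [hermite_succ (n + 1), derivative_sub, derivative_mul, ih, derivative_mul, hermite_succ n]
    simp
    ring

/-- The Hermite polynomials, normalized in `L²` of the Gaussian density. -/
def herm (n : ℕ) (x : ℝ) : ℝ :=
  ((Polynomial.hermite n).map (Int.castRingHom ℝ)).eval x / √(n.factorial : ℝ)

lemma contDiff_herm (n : ℕ) : ContDiff ℝ ∞ (herm n) := by
  unfold herm; exact (Polynomial.contDiff_aeval (𝕜 := ℝ) _ _).div_const _

lemma expGrowth_herm (n : ℕ) : ExpGrowth (herm n) := by
  have := (expGrowth_polynomial ((Polynomial.hermite n).map (Int.castRingHom ℝ))).mul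
    (.const (1 / √(n.factorial : ℝ)))
  simp only [mul_one_div] at this
  exact this

@[simp] lemma herm_zero (x : ℝ) : herm 0 x = 1 := by simp [herm]

@[simp] lemma herm_one (x : ℝ) : herm 1 x = x := by simp [herm]

lemma sqrt_factorial_succ (n : ℕ) :
    √((n + 1).factorial : ℝ) = √((n : ℝ) + 1) * √(n.factorial : ℝ) := by
  rw [Nat.factorial_succ, Nat.cast_mul, Real.sqrt_mul (by positivity)]; push_cast; rfl

lemma deriv_herm (n : ℕ) : deriv (herm n) = fun x => √(n : ℝ) * herm (n - 1) x := by
  ext x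
  unfold herm
  rw [deriv_div_const, Polynomial.deriv]
  cases n with
  | zero => simp
  | succ n =>
    have h1 : √(n.factorial : ℝ) ≠ 0 := by positivity
    have h2 : √((n : ℝ) + 1) ≠ 0 := by positivity
    have h3 : √((n : ℝ) + 1) * √((n : ℝ) + 1) = n + 1 := Real.mul_self_sqrt (by positivity)
    rw [Polynomial.derivative_map, derivative_hermite_succ, sqrt_factorial_succ]
    simp only [Polynomial.map_mul, Polynomial.map_add, Polynomial.map_natCast, Polynomial.map_one,
      Polynomial.eval_mul, Polynomial.eval_add, Polynomial.eval_natCast, Polynomial.eval_one,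
      Nat.add_sub_cancel, Nat.cast_add, Nat.cast_one]
    field_simp
    rw [sq, h3, mul_comm]

lemma hasDerivAt_herm (n : ℕ) (x : ℝ) : HasDerivAt (herm n) (√(n : ℝ) * herm (n - 1) x) x := by
  have := ((contDiff_herm n).differentiable (by simp)).differentiableAt (x := x) |>.hasDerivAt
  rwa [deriv_herm] at this

/-- Rewrites `H_{n+1} = X H_n - H_n'` after normalization. At `n = 0` the truncated index `n - 1` is
harmless, because its coefficient is `√0`. -/
lemma mul_herm (n : ℕ) (x : ℝ) :
    x * herm n x = √((n : ℝ) + 1) * herm (n + 1) x + √(n : ℝ) * herm (n - 1) x := by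
  have h1 : √(n.factorial : ℝ) ≠ 0 := by positivity
  have h2 : √((n : ℝ) + 1) ≠ 0 := by positivity
  have := congrFun (deriv_herm n) x
  rw [← this]
  unfold herm
  rw [deriv_div_const, Polynomial.deriv, Polynomial.hermite_succ, sqrt_factorial_succ]
  simp
  field_simp
  ring

lemma herm_ode (n : ℕ) (x : ℝ) :
    deriv (deriv (herm n)) x - x * deriv (herm n) x = -(n : ℝ) * herm n x := by
  rw [deriv_herm]
  simp only [deriv_const_mul_field', deriv_herm]
  cases n with
  | zero => simp
  | succ n =>
    have := mul_herm n x
    have h3 : √((n : ℝ) + 1) * √((n : ℝ) + 1) = n + 1 := Real.mul_self_sqrt (by positivity)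
    simp only [Nat.add_sub_cancel, Nat.cast_add, Nat.cast_one] at *
    linear_combination (-√((n : ℝ) + 1)) * this - herm (n + 1) x * h3

lemma hasDerivAt_gauss (x : ℝ) : HasDerivAt gauss (-x * gauss x) x := by
  have h : HasDerivAt (fun x : ℝ => -(x ^ 2 / 2)) (-x) x := by
    have := ((hasDerivAt_pow 2 x).div_const 2).neg
    convert! this using 1; simp
  have := h.exp.div_const (√(2 * Real.pi))
  convert! this using 1
  unfold gauss; ring

lemma integral_gauss : ∫ x, gauss x = 1 := by
  unfold gauss
  rw [integral_div]
  have := integral_gaussian (1 / 2)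
  have e : (fun x : ℝ => Real.exp (-(x ^ 2 / 2))) = fun x => Real.exp (-(1 / 2) * x ^ 2) := by
    ext x; ring_nf
  rw [e, this, show Real.pi / (1 / 2) = 2 * Real.pi by ring, div_self (by positivity)]

lemma integrable_herm_mul_herm_mul_gauss (m n : ℕ) :
    Integrable fun x => herm m x * herm n x * gauss x :=
  ((expGrowth_herm m).mul (expGrowth_herm n)).integrable_mul_gauss
    ((contDiff_herm m).continuous.mul (contDiff_herm n).continuous).aestronglyMeasurable

/-- Integration by parts: the derivative of `h_m` times the Gaussian is `-√(m+1) h_{m+1}` times the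
Gaussian. Lowering both indices at once reduces orthonormality to an induction. -/
lemma integral_herm_succ (m n : ℕ) :
    √((m : ℝ) + 1) * ∫ x, herm (m + 1) x * herm n x * gauss x
      = √(n : ℝ) * ∫ x, herm m x * herm (n - 1) x * gauss x := by
  have hd : ∀ x, HasDerivAt (fun x => herm m x * gauss x)
      (-(√((m : ℝ) + 1) * (herm (m + 1) x * gauss x))) x := fun x => by
    have := (hasDerivAt_herm m x).mul (hasDerivAt_gauss x)
    convert! this using 1
    linear_combination gauss x * mul_herm m x
  have := integral_mul_deriv_eq_deriv_mul_of_integrable (u := herm n)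
    (v := fun x => herm m x * gauss x) (fun x _ => hasDerivAt_herm n x) (fun x _ => hd x) ?_ ?_ ?_
  · rw [← integral_const_mul, ← integral_const_mul]
    calc _ = - ∫ x, herm n x * (-(√((m : ℝ) + 1) * (herm (m + 1) x * gauss x))) := by
          rw [← integral_neg]; congr 1; ext x; ring
      _ = _ := by rw [this, neg_neg]; congr 1; ext x; ring
  · convert! (integrable_herm_mul_herm_mul_gauss (m + 1) n).const_mul (-√((m : ℝ) + 1)) using 1
    ext x; simp; ring
  · convert! (integrable_herm_mul_herm_mul_gauss m (n - 1)).const_mul (√(n : ℝ)) using 1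
    ext x; simp; ring
  · convert! integrable_herm_mul_herm_mul_gauss m n using 1
    ext x; simp; ring

lemma integral_herm_mul_herm (m n : ℕ) :
    ∫ x, herm m x * herm n x * gauss x = if m = n then 1 else 0 := by
  induction m generalizing n with
  | zero =>
    cases n with
    | zero => simp [integral_gauss]
    | succ n =>
      have := integral_herm_succ n 0
      simp only [Nat.cast_zero, Real.sqrt_zero, zero_mul, mul_eq_zero] at this
      rw [if_neg (by omega)]
      have h2 : √((n : ℝ) + 1) ≠ 0 := by positivity
      rw [← this.resolve_left h2]
      congr 1; ext x; ring
  | succ m ih =>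
    have h2 : √((m : ℝ) + 1) ≠ 0 := by positivity
    have := integral_herm_succ m n
    cases n with
    | zero => simpa [h2] using this
    | succ n =>
      rw [Nat.add_sub_cancel, ih] at this
      by_cases h : m = n
      · subst h
        simpa [h2] using this
      · simpa [h2, h] using this

/-! ### Tensor products of functions of one variable -/

section tensor
variable {d : ℕ}

/-- The function `v ↦ ∏ uⱼ(vⱼ)`. -/
def tensor (u : Fin d → ℝ → ℝ) (v : E d) : ℝ := ∏ j, u j (v j)

lemma contDiff_tensor {u : Fin d → ℝ → ℝ} (hu : ∀ j, ContDiff ℝ ∞ (u j)) :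
    ContDiff ℝ ∞ (tensor u) := by
  unfold tensor
  refine contDiff_prod fun j _ => (hu j).comp ?_
  fun_prop

lemma continuous_tensor {u : Fin d → ℝ → ℝ} (hu : ∀ j, Continuous (u j)) :
    Continuous (tensor u) := by
  unfold tensor; fun_prop

lemma expGrowth_tensor {u : Fin d → ℝ → ℝ} (hu : ∀ j, ExpGrowth (u j)) :
    ExpGrowth (tensor u) :=
  ExpGrowth.prod _ fun j _ => (hu j).comp_le (l := fun v : E d => v j)
    fun v => PiLp.norm_apply_le v j

lemma tensor_update (u : Fin d → ℝ → ℝ) (j : Fin d) (w : ℝ → ℝ) (v : E d) :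
    tensor (Function.update u j w) v = w (v j) * ∏ i ∈ Finset.univ.erase j, u i (v i) := by
  unfold tensor
  rw [← Finset.mul_prod_erase _ _ (Finset.mem_univ j), Function.update_self]
  congr 1
  refine Finset.prod_congr rfl fun i hi => ?_
  rw [Function.update_of_ne (Finset.ne_of_mem_erase hi)]

lemma tensor_eq_mul (u : Fin d → ℝ → ℝ) (j : Fin d) (v : E d) :
    tensor u v = u j (v j) * ∏ i ∈ Finset.univ.erase j, u i (v i) := by
  unfold tensor
  rw [← Finset.mul_prod_erase _ _ (Finset.mem_univ j)]

/-- The partial derivative in the direction of the coordinate `j`. -/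
def partialDeriv {W : Type*} [NormedAddCommGroup W] [NormedSpace ℝ W] (j : Fin d) (φ : E d → W)
    (v : E d) : W := fderiv ℝ φ v (EuclideanSpace.single j 1)

lemma partialDeriv_tensor {u : Fin d → ℝ → ℝ} (hu : ∀ j, Differentiable ℝ (u j)) (j : Fin d) :
    partialDeriv j (tensor u) = tensor (Function.update u j (deriv (u j))) := by
  ext v
  have h : HasFDerivAt (tensor u) (∑ i, (∏ l ∈ Finset.univ.erase i, u l (v l)) •
      (deriv (u i) (v i) • (EuclideanSpace.proj i : E d →L[ℝ] ℝ))) v := by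
    unfold tensor
    refine HasFDerivAt.finsetProd fun i _ => ?_
    exact ((hu i).differentiableAt.hasDerivAt).comp_hasFDerivAt v
      (EuclideanSpace.proj i : E d →L[ℝ] ℝ).hasFDerivAt
  unfold partialDeriv
  rw [h.fderiv, tensor_update]
  simp [Finset.sum_ite_eq, mul_comm, eq_comm]

lemma contDiff_partialDeriv {W : Type*} [NormedAddCommGroup W] [NormedSpace ℝ W] {φ : E d → W}
    (hφ : ContDiff ℝ ∞ φ) (j : Fin d) : ContDiff ℝ ∞ (partialDeriv j φ) := by
  unfold partialDeriv
  exact (hφ.fderiv_right (m := ∞) (by simp)).clm_apply contDiff_const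

lemma tsupport_partialDeriv_subset {W : Type*} [NormedAddCommGroup W] [NormedSpace ℝ W]
    (j : Fin d) (φ : E d → W) : tsupport (partialDeriv j φ) ⊆ tsupport φ :=
  tsupport_fderiv_apply_subset ℝ _

lemma hasCompactSupport_partialDeriv {W : Type*} [NormedAddCommGroup W] [NormedSpace ℝ W]
    {φ : E d → W} (hφ : HasCompactSupport φ) (j : Fin d) :
    HasCompactSupport (partialDeriv j φ) :=
  hφ.fderiv_apply ℝ _

lemma fderiv_apply_eq_sum {W : Type*} [NormedAddCommGroup W] [NormedSpace ℝ W] (φ : E d → W)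
    (x v : E d) : fderiv ℝ φ x v = ∑ j, v j • partialDeriv j φ x := by
  conv_lhs => rw [← (EuclideanSpace.basisFun (Fin d) ℝ).sum_repr v]
  simp [partialDeriv]

lemma fokkerPlanckAdjoint_eq_sum {φ : E d → ℝ} (hφ : ContDiff ℝ ∞ φ) (v : E d) :
    fokkerPlanckAdjoint φ v
      = ∑ j, (partialDeriv j (partialDeriv j φ) v - v j * partialDeriv j φ v) := by
  unfold fokkerPlanckAdjoint
  rw [InnerProductSpace.laplacian_eq_iteratedFDeriv_orthonormalBasis _
    (EuclideanSpace.basisFun (Fin d) ℝ), fderiv_apply_eq_sum, Finset.sum_sub_distrib]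
  congr 1
  refine Finset.sum_congr rfl fun j _ => ?_
  rw [iteratedFDeriv_two_apply]
  unfold partialDeriv
  rw [fderiv_clm_apply]
  · simp
  · exact ((hφ.fderiv_right (m := ∞) (by simp)).differentiable (by simp)).differentiableAt
  · fun_prop

/-- The operator is a sum of one-variable operators, each touching a single factor of the product;
spectral properties are inherited from the line. -/
lemma fokkerPlanckAdjoint_tensor {u : Fin d → ℝ → ℝ} (hu : ∀ j, ContDiff ℝ ∞ (u j)) (v : E d) :
    fokkerPlanckAdjoint (tensor u) v = ∑ j, tensor (Function.update u j
      fun x => deriv (deriv (u j)) x - x * deriv (u j) x) v := by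
  rw [fokkerPlanckAdjoint_eq_sum (contDiff_tensor hu)]
  refine Finset.sum_congr rfl fun j _ => ?_
  have h1 : ∀ j, Differentiable ℝ (u j) := fun j => (hu j).differentiable (by simp)
  rw [partialDeriv_tensor h1, partialDeriv_tensor]
  · simp only [Function.update_self, Function.update_idem, tensor_update]
    ring
  · intro i
    by_cases hi : i = j
    · subst hi
      rw [Function.update_self]
      exact ((contDiff_infty_iff_deriv.1 (hu i)).2).differentiable (by simp)
    · rw [Function.update_of_ne hi]; exact h1 i

lemma integral_tensor (u : Fin d → ℝ → ℝ) : ∫ v, tensor u v = ∏ j, ∫ x, u j x := by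
  rw [← integral_fintype_prod_volume_eq_prod]
  exact (PiLp.volume_preserving_ofLp (Fin d)).integral_comp
    (MeasurableEquiv.toLp 2 (Fin d → ℝ)).symm.measurableEmbedding (fun x => ∏ j, u j (x j))

end tensor

/-! ### Hermite functions of several variables -/

section hermite
variable {d : ℕ}

/-- The normalized Hermite polynomial with multi-index `k`. -/
def hermiteFun (k : Fin d → ℕ) : E d → ℝ := tensor fun j => herm (k j)

/-- The multi-index `k + eⱼ`. -/
def up (k : Fin d → ℕ) (j : Fin d) : Fin d → ℕ := Function.update k j (k j + 1)

/-- The multi-index `k - eⱼ` (truncated). -/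
def down (k : Fin d → ℕ) (j : Fin d) : Fin d → ℕ := Function.update k j (k j - 1)

lemma hermiteFun_update (k : Fin d → ℕ) (j : Fin d) (m : ℕ) :
    hermiteFun (Function.update k j m)
      = tensor (Function.update (fun j => herm (k j)) j (herm m)) := by
  unfold hermiteFun
  congr 1
  ext i x
  by_cases h : i = j
  · subst h; simp
  · simp [Function.update_of_ne h]

lemma contDiff_hermiteFun (k : Fin d → ℕ) : ContDiff ℝ ∞ (hermiteFun k) :=
  contDiff_tensor fun _ => contDiff_herm _

lemma continuous_hermiteFun (k : Fin d → ℕ) : Continuous (hermiteFun k) :=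
  (contDiff_hermiteFun k).continuous

lemma expGrowth_hermiteFun (k : Fin d → ℕ) : ExpGrowth (hermiteFun k) :=
  expGrowth_tensor fun _ => expGrowth_herm _

@[simp] lemma hermiteFun_zero (v : E d) : hermiteFun 0 v = 1 := by simp [hermiteFun, tensor]

lemma hermiteFun_up_zero (j : Fin d) (v : E d) : hermiteFun (up 0 j) v = v j := by
  simp [up, hermiteFun_update, tensor_update]

/-- This is the tridiagonal structure of transport. The truncation in `down` costs nothing since it
is weighted by `√0` when `k j = 0`. -/
lemma coord_mul_hermiteFun (k : Fin d → ℕ) (j : Fin d) (v : E d) :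
    v j * hermiteFun k v = √((k j : ℝ) + 1) * hermiteFun (up k j) v
      + √(k j : ℝ) * hermiteFun (down k j) v := by
  rw [up, down, hermiteFun_update, hermiteFun_update, tensor_update, tensor_update, hermiteFun,
    tensor_eq_mul _ j]
  linear_combination (∏ i ∈ Finset.univ.erase j, herm (k i) (v i)) * mul_herm (k j) (v j)

lemma fokkerPlanckAdjoint_hermiteFun (k : Fin d → ℕ) (v : E d) :
    fokkerPlanckAdjoint (hermiteFun k) v = -((∑ j, k j : ℕ) : ℝ) * hermiteFun k v := by
  rw [hermiteFun, fokkerPlanckAdjoint_tensor fun j => contDiff_herm _]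
  push_cast
  rw [← Finset.sum_neg_distrib, Finset.sum_mul]
  refine Finset.sum_congr rfl fun j _ => ?_
  rw [tensor_update, tensor_eq_mul _ j, herm_ode]
  ring

lemma integral_hermiteFun_mul_hermiteFun (k l : Fin d → ℕ) :
    ∫ v, hermiteFun k v * hermiteFun l v * maxwellian v = if k = l then 1 else 0 := by
  have : ∀ v : E d, hermiteFun k v * hermiteFun l v * maxwellian v
      = tensor (fun j x => herm (k j) x * herm (l j) x * gauss x) v := fun v => by
    simp [hermiteFun, tensor, maxwellian_eq_prod, Finset.prod_mul_distrib]
  simp_rw [this, integral_tensor, integral_herm_mul_herm, funext_iff]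
  rw [Finset.prod_ite_zero]; simp

lemma partialDeriv_maxwellian (j : Fin d) (v : E d) :
    partialDeriv j (maxwellian : E d → ℝ) v = -v j * maxwellian v := by
  have h : (maxwellian : E d → ℝ) = tensor fun _ => gauss := by
    ext v; exact maxwellian_eq_prod v
  have hd : deriv gauss = fun x => -x * gauss x := by ext x; exact (hasDerivAt_gauss x).deriv
  rw [h, partialDeriv_tensor fun _ x => (hasDerivAt_gauss x).differentiableAt, tensor_update, hd,
    tensor_eq_mul _ j]
  ring

lemma contDiff_maxwellian : ContDiff ℝ ∞ (maxwellian : E d → ℝ) := by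
  unfold maxwellian
  exact ((contDiff_norm_sq ℝ).div_const _).neg.exp.div_const _

lemma partialDeriv_mul {f g : E d → ℝ} (hf : Differentiable ℝ f) (hg : Differentiable ℝ g)
    (j : Fin d) (v : E d) :
    partialDeriv j (fun v => f v * g v) v = partialDeriv j f v * g v + f v * partialDeriv j g v := by
  unfold partialDeriv
  rw [fderiv_fun_mul hf.differentiableAt hg.differentiableAt]
  simp; ring

/-- The term `-v_j h` is the derivative falling on `𝓜`; compact support of `φ` removes boundary
terms, so `h` may grow arbitrarily. -/
lemma integral_mul_maxwellian_mul_partialDeriv {h φ : E d → ℝ} (hh : ContDiff ℝ ∞ h)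
    (hφ : ContDiff ℝ ∞ φ) (hs : HasCompactSupport φ) (j : Fin d) :
    ∫ v, h v * maxwellian v * partialDeriv j φ v
      = -∫ v, (partialDeriv j h v - v j * h v) * maxwellian v * φ v := by
  have hM : ContDiff ℝ ∞ (maxwellian : E d → ℝ) := contDiff_maxwellian
  have hd : ∀ v, fderiv ℝ (fun v => h v * maxwellian v) v (EuclideanSpace.single j 1)
      = (partialDeriv j h v - v j * h v) * maxwellian v := fun v => by
    have := partialDeriv_mul (hh.differentiable (by simp)) (hM.differentiable (by simp)) j v
    rw [partialDeriv_maxwellian] at this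
    unfold partialDeriv at *
    rw [this]; ring
  have hc := (contDiff_partialDeriv hh j).continuous
  have := integral_mul_fderiv_eq_neg_fderiv_mul_of_integrable (μ := volume)
    (f := fun v => h v * maxwellian v) (g := φ) (v := EuclideanSpace.single j (1 : ℝ)) ?_ ?_ ?_ ?_ ?_
  · simp_rw [hd] at this
    exact this
  · simp_rw [hd]
    refine Continuous.integrable_of_hasCompactSupport ?_ hs.mul_left
    exact ((hc.sub ((by fun_prop : Continuous fun v : E d => v j).mul hh.continuous)).mul
      hM.continuous).mul hφ.continuous
  · refine Continuous.integrable_of_hasCompactSupport ?_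
      (hasCompactSupport_partialDeriv hs j).mul_left
    exact (hh.continuous.mul hM.continuous).mul (contDiff_partialDeriv hφ j).continuous
  · refine Continuous.integrable_of_hasCompactSupport ?_ hs.mul_left
    exact (hh.continuous.mul hM.continuous).mul hφ.continuous
  · exact fun x _ => ((hh.mul hM).differentiable (by simp)).differentiableAt
  · exact fun x _ => (hφ.differentiable (by simp)).differentiableAt

/-- The Fokker-Planck operator is symmetric in `L²(dγ)`. -/
lemma integral_mul_maxwellian_mul_fokkerPlanckAdjoint {h φ : E d → ℝ} (hh : ContDiff ℝ ∞ h)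
    (hφ : ContDiff ℝ ∞ φ) (hs : HasCompactSupport φ) :
    ∫ v, h v * maxwellian v * fokkerPlanckAdjoint φ v
      = ∫ v, fokkerPlanckAdjoint h v * maxwellian v * φ v := by
  have hM : Continuous (maxwellian : E d → ℝ) := continuous_maxwellian
  simp_rw [fokkerPlanckAdjoint_eq_sum hh, fokkerPlanckAdjoint_eq_sum hφ, Finset.mul_sum,
    Finset.sum_mul]
  have hcj : ∀ j, Continuous fun v : E d => v j := fun j => by fun_prop
  rw [integral_finsetSum, integral_finsetSum]
  · refine Finset.sum_congr rfl fun j _ => ?_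
    have hφ1 := contDiff_partialDeriv hφ j
    have hh1 := contDiff_partialDeriv hh j
    have hs1 := hasCompactSupport_partialDeriv hs j
    -- Two integrations by parts. The first leaves `∫ v_j h 𝓜 ∂_j φ`, which cancels the drift of the
    -- adjoint on the left; the second turns `-∫ ∂_j h 𝓜 ∂_j φ` into the operator acting on `h`.
    have h1 := integral_mul_maxwellian_mul_partialDeriv hh hφ1 hs1 j
    have h2 := integral_mul_maxwellian_mul_partialDeriv hh1 hφ hs j
    have e1 : ∀ v : E d, (partialDeriv j h v - v j * h v) * maxwellian v * partialDeriv j φ v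
        = partialDeriv j h v * maxwellian v * partialDeriv j φ v
          - v j * h v * maxwellian v * partialDeriv j φ v := fun v => by ring
    have e2 : ∀ v : E d, h v * maxwellian v * (partialDeriv j (partialDeriv j φ) v
        - v j * partialDeriv j φ v) = h v * maxwellian v * partialDeriv j (partialDeriv j φ) v
          - v j * h v * maxwellian v * partialDeriv j φ v := fun v => by ring
    simp_rw [e1] at h1
    simp_rw [e2]
    have i1 : Integrable fun v => partialDeriv j h v * maxwellian v * partialDeriv j φ v :=
      ((hh1.continuous.mul hM).mul hφ1.continuous).integrable_of_hasCompactSupport hs1.mul_left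
    have i2 : Integrable fun v : E d => v j * h v * maxwellian v * partialDeriv j φ v :=
      ((((hcj j).mul hh.continuous).mul hM).mul hφ1.continuous).integrable_of_hasCompactSupport
        hs1.mul_left
    have i3 : Integrable fun v => h v * maxwellian v * partialDeriv j (partialDeriv j φ) v :=
      ((hh.continuous.mul hM).mul
        (contDiff_partialDeriv hφ1 j).continuous).integrable_of_hasCompactSupport
        (hasCompactSupport_partialDeriv hs1 j).mul_left
    rw [integral_sub i1 i2] at h1
    rw [integral_sub i3 i2, h1, h2]
    ring
  · intro j _
    have hh1 := contDiff_partialDeriv hh j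
    refine Continuous.integrable_of_hasCompactSupport ?_ hs.mul_left
    exact (((contDiff_partialDeriv hh1 j).continuous.sub ((hcj j).mul hh1.continuous)).mul hM).mul
      hφ.continuous
  · intro j _
    have hφ1 := contDiff_partialDeriv hφ j
    have hs1 := hasCompactSupport_partialDeriv hs j
    refine Continuous.integrable_of_hasCompactSupport ?_
      (((hasCompactSupport_partialDeriv hs1 j).sub hs1.mul_left).mul_left)
    exact (hh.continuous.mul hM).mul
      ((contDiff_partialDeriv hφ1 j).continuous.sub ((hcj j).mul hφ1.continuous))

end hermite

/-! ### Hermite coefficients -/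

section coefficients
variable {d : ℕ}

lemma memLp_two_mul_prod {X Y : Type*} [MeasurableSpace X] [MeasurableSpace Y] {μ : Measure X}
    {ν : Measure Y} [SFinite μ] [SFinite ν] {f : X → ℝ} {g : Y → ℝ} (hf : MemLp f 2 μ)
    (hg : MemLp g 2 ν) : MemLp (fun z : X × Y => f z.1 * g z.2) 2 (μ.prod ν) := by
  have hm : AEStronglyMeasurable (fun z : X × Y => f z.1 * g z.2) (μ.prod ν) :=
    hf.1.comp_fst.mul hg.1.comp_snd
  rw [memLp_two_iff_integrable_sq hm]
  simpa only [mul_pow] using hf.integrable_sq.mul_prod hg.integrable_sq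

/-- A function of `x` times a function of exponential growth times the Gaussian. -/
lemma memLp_phase_mul {ψ g : E d → ℝ} (hψ : MemLp ψ 2) (hg : ExpGrowth g) (hm : Continuous g) :
    MemLp (fun z : E d × E d => ψ z.1 * (maxwellian z.2 * g z.2)) 2 (phaseMeasure d) :=
  memLp_two_mul_prod hψ (hg.memLp_maxwellian_smul hm.aestronglyMeasurable)

/-- Cauchy-Schwarz: `g 𝓜` is in `L²(dγ)` for every `g` of exponential growth. Polynomials and
exponentials in `v` are therefore legitimate weights against any `F` in `L²(dx dγ)`. -/
lemma integrable_mul_of_growth {F : E d × E d → ℝ} (hF : MemLp F 2 (phaseMeasure d)) {ψ g : E d → ℝ}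
    (hψ : MemLp ψ 2) (hg : ExpGrowth g) (hm : Continuous g) :
    Integrable fun z : E d × E d => F z * (ψ z.1 * g z.2) := by
  rw [← integrable_phase_maxwellian_smul_iff]
  refine (hF.integrable_mul (memLp_phase_mul hψ hg hm)).congr (Filter.Eventually.of_forall fun z => ?_)
  simp only [Pi.mul_apply, smul_eq_mul]; ring

/-- The function `ψ(x) h_k(v) 𝓜(v)`, as an element of `L²(dx dγ)`. -/
def hermiteLp (k : Fin d → ℕ) (ψ : Lp ℝ 2 (volume : Measure (E d))) : Lp ℝ 2 (phaseMeasure d) :=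
  (memLp_phase_mul (Lp.memLp ψ) (expGrowth_hermiteFun k) (continuous_hermiteFun k)).toLp

lemma hermiteLp_ae (k : Fin d → ℕ) (ψ : Lp ℝ 2 (volume : Measure (E d))) :
    hermiteLp k ψ =ᵐ[phaseMeasure d] fun z => ψ z.1 * (maxwellian z.2 * hermiteFun k z.2) :=
  MemLp.coeFn_toLp _

lemma inner_hermiteLp (k l : Fin d → ℕ) (ψ φ : Lp ℝ 2 (volume : Measure (E d))) :
    inner ℝ (hermiteLp k ψ) (hermiteLp l φ) = inner ℝ ψ φ * if k = l then 1 else 0 := by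
  rw [L2.inner_def, L2.inner_def]
  have h1 : ∀ᵐ z ∂(phaseMeasure d), inner ℝ (hermiteLp k ψ z) (hermiteLp l φ z)
      = (inner ℝ (ψ z.1) (φ z.1)) * (maxwellian z.2 • (hermiteFun k z.2 * hermiteFun l z.2
          * maxwellian z.2)) := by
    filter_upwards [hermiteLp_ae k ψ, hermiteLp_ae l φ] with z h1 h2
    rw [h1, h2]; simp only [RCLike.inner_apply, conj_trivial, smul_eq_mul]; ring
  rw [integral_congr_ae h1, phaseMeasure,
    integral_prod_mul (μ := volume) (ν := gammaMeasure d) (fun x => inner ℝ (ψ x) (φ x))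
      (fun v => maxwellian v • (hermiteFun k v * hermiteFun l v * maxwellian v)),
    integral_gamma_maxwellian_smul, integral_hermiteFun_mul_hermiteFun]

/-- The map `ψ ↦ ψ(x) h_k(v) 𝓜(v)`. -/
def hermiteLin (k : Fin d → ℕ) :
    Lp ℝ 2 (volume : Measure (E d)) →ₗ[ℝ] Lp ℝ 2 (phaseMeasure d) where
  toFun ψ := hermiteLp k ψ
  map_add' ψ φ := by
    refine Lp.ext ?_
    have : ∀ᵐ z ∂(phaseMeasure d), (ψ + φ) z.1 = ψ z.1 + φ z.1 :=
      Measure.quasiMeasurePreserving_fst.ae (Lp.coeFn_add ψ φ)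
    filter_upwards [this, hermiteLp_ae k (ψ + φ), hermiteLp_ae k ψ, hermiteLp_ae k φ,
      Lp.coeFn_add (hermiteLp k ψ) (hermiteLp k φ)] with z hz h1 h2 h3 h4
    rw [h4, Pi.add_apply, h1, h2, h3, hz]; ring
  map_smul' c ψ := by
    refine Lp.ext ?_
    have : ∀ᵐ z ∂(phaseMeasure d), (c • ψ) z.1 = c • ψ z.1 :=
      Measure.quasiMeasurePreserving_fst.ae (Lp.coeFn_smul c ψ)
    filter_upwards [this, hermiteLp_ae k (c • ψ), hermiteLp_ae k ψ,
      Lp.coeFn_smul c (hermiteLp k ψ)] with z hz h1 h2 h4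
    rw [RingHom.id_apply, h4, Pi.smul_apply, h1, h2, hz]; simp only [smul_eq_mul]; ring

/-- The isometry `ψ ↦ ψ(x) h_k(v) 𝓜(v)`. -/
def hermiteEmb (k : Fin d → ℕ) :
    Lp ℝ 2 (volume : Measure (E d)) →ₗᵢ[ℝ] Lp ℝ 2 (phaseMeasure d) where
  toLinearMap := hermiteLin k
  norm_map' ψ := by
    have h : inner ℝ (hermiteLp k ψ) (hermiteLp k ψ) = inner ℝ ψ ψ := by
      simpa using inner_hermiteLp k k ψ ψ
    rw [real_inner_self_eq_norm_sq, real_inner_self_eq_norm_sq] at h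
    exact (sq_eq_sq₀ (norm_nonneg _) (norm_nonneg _)).1 h

lemma hermiteEmb_ae (k : Fin d → ℕ) {ψ : E d → ℝ} (hψ : MemLp ψ 2) :
    hermiteEmb k hψ.toLp =ᵐ[phaseMeasure d]
      fun z => ψ z.1 * (maxwellian z.2 * hermiteFun k z.2) := by
  have h1 : ∀ᵐ z ∂(phaseMeasure d), hψ.toLp ψ z.1 = ψ z.1 :=
      Measure.quasiMeasurePreserving_fst.ae hψ.coeFn_toLp
  filter_upwards [h1, hermiteLp_ae k hψ.toLp] with z hz1 hz2
  rw [← hz1]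
  exact hz2

lemma inner_hermiteEmb (k : Fin d → ℕ) {ψ : E d → ℝ} (hψ : MemLp ψ 2)
    (F : Lp ℝ 2 (phaseMeasure d)) :
    inner ℝ F (hermiteEmb k hψ.toLp) = ∫ z : E d × E d, F z * (ψ z.1 * hermiteFun k z.2) := by
  rw [L2.inner_def, ← integral_phase_maxwellian_smul]
  refine integral_congr_ae ?_
  filter_upwards [hermiteEmb_ae k hψ] with z hz
  rw [hz]; simp only [RCLike.inner_apply, conj_trivial, smul_eq_mul]; ring

/-- The coefficient `x ↦ ∫ F(x, v) h_k(v) dv`. -/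
def coeff (k : Fin d → ℕ) : Lp ℝ 2 (phaseMeasure d) →L[ℝ] Lp ℝ 2 (volume : Measure (E d)) :=
  ContinuousLinearMap.adjoint (hermiteEmb k).toContinuousLinearMap

lemma inner_coeff (k : Fin d → ℕ) (F : Lp ℝ 2 (phaseMeasure d))
    (ψ : Lp ℝ 2 (volume : Measure (E d))) : inner ℝ (coeff k F) ψ = inner ℝ F (hermiteEmb k ψ) := by
  rw [coeff, ContinuousLinearMap.adjoint_inner_left]; rfl

lemma integral_coeff_mul (k : Fin d → ℕ) (F : Lp ℝ 2 (phaseMeasure d)) {ψ : E d → ℝ}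
    (hψ : MemLp ψ 2) :
    ∫ x, coeff k F x * ψ x = ∫ z : E d × E d, F z * (ψ z.1 * hermiteFun k z.2) := by
  rw [← inner_hermiteEmb k hψ, ← inner_coeff, L2.inner_def]
  refine integral_congr_ae ?_
  filter_upwards [hψ.coeFn_toLp] with x hx
  rw [hx]; simp only [RCLike.inner_apply, conj_trivial]; ring

lemma orthogonalFamily_hermiteEmb :
    OrthogonalFamily ℝ (fun _ : Fin d → ℕ => Lp ℝ 2 (volume : Measure (E d))) hermiteEmb := by
  intro k l hkl ψ φ
  have := inner_hermiteLp k l ψ φ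
  rw [if_neg hkl, mul_zero] at this
  exact this

open FourierTransform in
/-- An integrable function with vanishing Fourier transform vanishes. -/
lemma ae_eq_zero_of_fourier_eq_zero {Φ : E d → ℂ} (hΦ : Integrable Φ) (h : ∀ η, 𝓕 Φ η = 0) :
    Φ =ᵐ[volume] 0 := by
  refine ae_eq_zero_of_integral_contDiff_smul_eq_zero hΦ.locallyIntegrable fun g hg hs => ?_
  have hgc : ContDiff ℝ ∞ (fun x => (g x : ℂ)) := Complex.ofRealCLM.contDiff.comp hg
  have hsc : HasCompactSupport (fun x => (g x : ℂ)) := hs.comp_left (g := Complex.ofReal) (by simp)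
  -- The test function is written as the transform of a Schwartz function, so that the transform can
  -- be moved onto `Φ`.
  set G : SchwartzMap (E d) ℂ := 𝓕⁻ (hsc.toSchwartzMap hgc) with hG
  have hFG : 𝓕 (G : E d → ℂ) = fun x => (g x : ℂ) := by
    rw [← SchwartzMap.fourier_coe, hG, FourierTransform.fourier_fourierInv_eq]; rfl
  have key := VectorFourier.integral_fourierIntegral_smul_eq_flip (μ := (volume : Measure (E d)))
    (ν := (volume : Measure (E d))) (L := innerₗ (E d)) (f := Φ) (g := (G : E d → ℂ))
    Real.continuous_fourierChar (by exact continuous_inner) hΦ G.integrable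
  rw [flip_innerₗ] at key
  have e1 : VectorFourier.fourierIntegral Real.fourierChar volume (innerₗ (E d)) Φ = 𝓕 Φ := rfl
  have e2 : VectorFourier.fourierIntegral Real.fourierChar volume (innerₗ (E d)) (G : E d → ℂ)
    = 𝓕 (G : E d → ℂ) := rfl
  rw [e1, e2, hFG] at key
  simp only [h, zero_smul, integral_zero] at key
  rw [key]
  congr 1; ext x; simp [mul_comm]

/-! ### Completeness of the Hermite functions in `L²(dx dγ)` -/

section completeness
variable {F : E d × E d → ℝ} (hF : MemLp F 2 (phaseMeasure d))
include hF

/-- Each factor `v · η` is absorbed by the recurrence into Hermite functions of neighbouring index,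
hence the induction on `n` must carry all `k` together. -/
lemma integral_mul_inner_pow_mul_hermiteFun {ψ : E d → ℝ} (hψ : MemLp ψ 2)
    (h : ∀ k, ∫ z : E d × E d, F z * (ψ z.1 * hermiteFun k z.2) = 0) (η : E d) (n : ℕ) :
    ∀ k, ∫ z : E d × E d, F z * (ψ z.1 * ((inner ℝ z.2 η) ^ n * hermiteFun k z.2)) = 0 := by
  have hgi : ExpGrowth fun v : E d => (inner ℝ v η : ℝ) :=
    (ExpGrowth.id.norm.mul (.const ‖η‖)).mono fun v => by simpa using norm_inner_le_norm (𝕜 := ℝ) v η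
  have hint : ∀ n k, Integrable fun z : E d × E d =>
      F z * (ψ z.1 * ((inner ℝ z.2 η) ^ n * hermiteFun k z.2)) := fun n k =>
    integrable_mul_of_growth hF hψ ((hgi.pow n).mul (expGrowth_hermiteFun k))
      (((by fun_prop : Continuous fun v : E d => (inner ℝ v η : ℝ) ^ n)).mul
        (continuous_hermiteFun k))
  induction n with
  | zero => simpa using h
  | succ n ih =>
    intro k
    have : ∀ z : E d × E d, F z * (ψ z.1 * ((inner ℝ z.2 η) ^ (n + 1) * hermiteFun k z.2))
        = ∑ j, ((η j * √((k j : ℝ) + 1)) *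
            (F z * (ψ z.1 * ((inner ℝ z.2 η) ^ n * hermiteFun (up k j) z.2)))
          + (η j * √(k j : ℝ)) *
            (F z * (ψ z.1 * ((inner ℝ z.2 η) ^ n * hermiteFun (down k j) z.2)))) := fun z => by
      have e : (inner ℝ z.2 η : ℝ) * hermiteFun k z.2 = ∑ j, η j * (z.2 j * hermiteFun k z.2) := by
        rw [PiLp.inner_apply, Finset.sum_mul]
        refine Finset.sum_congr rfl fun j _ => ?_
        simp; ring
      rw [pow_succ, mul_assoc, e, Finset.mul_sum, Finset.mul_sum, Finset.mul_sum]
      refine Finset.sum_congr rfl fun j _ => ?_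
      rw [coord_mul_hermiteFun]; ring
    simp_rw [this]
    rw [integral_finsetSum]
    · refine Finset.sum_eq_zero fun j _ => ?_
      rw [integral_add ((hint _ _).const_mul _) ((hint _ _).const_mul _), integral_const_mul,
        integral_const_mul, ih, ih]
      simp
    · exact fun j _ => ((hint _ _).const_mul _).add ((hint _ _).const_mul _)

/-- All moments along `η` vanish, and the exponential series may be integrated term by term because
`F ψ exp(‖η‖ ‖v‖)` is integrable. -/
lemma integral_mul_fourierChar_eq_zero {ψ : E d → ℝ} (hψ : MemLp ψ 2)
    (h : ∀ k, ∫ z : E d × E d, F z * (ψ z.1 * hermiteFun k z.2) = 0) (η : E d) :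
    ∫ z : E d × E d, (Complex.exp (((inner ℝ z.2 η : ℝ) : ℂ) * Complex.I)) *
      ((F z * ψ z.1 : ℝ) : ℂ) = 0 := by
  have h0 : ∀ n : ℕ, ∫ z : E d × E d, F z * (ψ z.1 * (inner ℝ z.2 η) ^ n) = 0 := fun n => by
    simpa using integral_mul_inner_pow_mul_hermiteFun hF hψ h η n 0
  have hint1 := integrable_mul_of_growth hF hψ (ExpGrowth.const (V := E d) (1 : ℝ)) continuous_const
  have hFψ : AEStronglyMeasurable (fun z : E d × E d => F z * ψ z.1) := by
    simpa using hint1.aestronglyMeasurable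
  have key := hasSum_integral_of_dominated_convergence (μ := (volume : Measure (E d × E d)))
    (F := fun (n : ℕ) z => ((((inner ℝ z.2 η : ℝ) : ℂ) * Complex.I) ^ n / (n.factorial : ℂ)) *
      ((F z * ψ z.1 : ℝ) : ℂ))
    (f := fun z => (Complex.exp (((inner ℝ z.2 η : ℝ) : ℂ) * Complex.I)) *
      ((F z * ψ z.1 : ℝ) : ℂ))
    (fun n z => (‖η‖ * ‖z.2‖) ^ n / n.factorial * |F z * ψ z.1|) ?_ ?_ ?_ ?_ ?_
  · refine key.unique ?_
    convert! hasSum_zero with n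
    have : ∀ z : E d × E d, ((((inner ℝ z.2 η : ℝ) : ℂ) * Complex.I) ^ n / (n.factorial : ℂ)) *
      ((F z * ψ z.1 : ℝ) : ℂ) = (Complex.I ^ n / (n.factorial : ℂ)) *
        ((F z * (ψ z.1 * (inner ℝ z.2 η) ^ n) : ℝ) : ℂ) := fun z => by
      push_cast; ring
    simp_rw [this]
    rw [integral_const_mul, integral_complex_ofReal, h0]
    simp
  · intro n
    refine AEStronglyMeasurable.mul (Continuous.aestronglyMeasurable (by fun_prop)) ?_
    exact Complex.continuous_ofReal.comp_aestronglyMeasurable hFψ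
  · refine fun n => Filter.Eventually.of_forall fun z => ?_
    rw [norm_mul, norm_div, norm_pow, norm_mul, Complex.norm_I, mul_one, Complex.norm_real,
      Complex.norm_real, Complex.norm_natCast, Real.norm_eq_abs (F z * _), mul_comm ‖η‖]
    gcongr
    exact norm_inner_le_norm _ _
  · exact Filter.Eventually.of_forall fun z => (Real.summable_pow_div_factorial _).mul_right _
  · have e : ∀ z : E d × E d, ∑' n : ℕ, (‖η‖ * ‖z.2‖) ^ n / n.factorial * |F z * ψ z.1|
        = ‖F z * (ψ z.1 * Real.exp (‖η‖ * ‖z.2‖))‖ := fun z => by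
      rw [tsum_mul_right, ← congrFun NormedSpace.exp_eq_tsum_div (‖η‖ * ‖z.2‖),
        ← Real.exp_eq_exp_ℝ, ← mul_assoc, norm_mul, Real.norm_of_nonneg (Real.exp_pos _).le,
        Real.norm_eq_abs, mul_comm]
    simp_rw [e]
    exact (integrable_mul_of_growth hF hψ (.exp_norm ‖η‖) (by fun_prop)).norm
  · refine Filter.Eventually.of_forall fun z => ?_
    refine HasSum.mul_right _ ?_
    rw [Complex.exp_eq_exp_ℂ]
    exact NormedSpace.expSeries_div_hasSum_exp _

/-- The function `v ↦ ∫ F(x, v) ψ(x) dx` is integrable and its Fourier transform vanishes. -/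
lemma integral_mul_ae_eq_zero {ψ : E d → ℝ} (hψ : MemLp ψ 2)
    (h : ∀ k, ∫ z : E d × E d, F z * (ψ z.1 * hermiteFun k z.2) = 0) :
    ∀ᵐ v : E d, ∫ x, F (x, v) * ψ x = 0 := by
  have hint : Integrable fun z : E d × E d => F z * ψ z.1 := by
    simpa using integrable_mul_of_growth hF hψ (ExpGrowth.const (V := E d) (1 : ℝ)) continuous_const
  have hΦ : Integrable fun v : E d => ∫ x, F (x, v) * ψ x := hint.integral_prod_right
  have hz := ae_eq_zero_of_fourier_eq_zero (Φ := fun v => ((∫ x, F (x, v) * ψ x : ℝ) : ℂ))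
    hΦ.ofReal fun η => by
      -- The factor `-2π` is the normalization of the Fourier character.
      have := integral_mul_fourierChar_eq_zero hF hψ h (-(2 * Real.pi) • η)
      rw [Measure.volume_eq_prod, integral_prod_symm] at this
      · rw [Real.fourier_eq', ← this]
        refine integral_congr_ae (Filter.Eventually.of_forall fun v => ?_)
        simp only
        rw [integral_const_mul, integral_complex_ofReal, inner_smul_right]
        simp only [smul_eq_mul, neg_mul]
      · refine (hint.ofReal (𝕜 := ℂ)).bdd_mul (c := 1) (Continuous.aestronglyMeasurable (by fun_prop))
          (Filter.Eventually.of_forall fun z => ?_)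
        rw [Complex.norm_exp_ofReal_mul_I]
  filter_upwards [hz] with v hv
  simpa using hv

lemma ae_eq_zero_of_hermite
    (h : ∀ ψ : E d → ℝ, MemLp ψ 2 → ∀ k, ∫ z : E d × E d, F z * (ψ z.1 * hermiteFun k z.2) = 0) :
    F =ᵐ[phaseMeasure d] 0 := by
  have : SecondCountableTopology (Lp ℝ 2 (volume : Measure (E d))) :=
    have : Fact ((2 : ℝ≥0∞) ≠ ⊤) := ⟨by simp⟩
    inferInstance
  -- The exceptional null set of velocities depends on `ψ`. A countable dense family gives one null
  -- set outside which the section `F(·, v)` is orthogonal to everything.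
  let s := TopologicalSpace.denseSeq (Lp ℝ 2 (volume : Measure (E d)))
  have h1 : ∀ᵐ v : E d, ∀ n, ∫ x, F (x, v) * s n x = 0 :=
    ae_all_iff.2 fun n => integral_mul_ae_eq_zero hF (Lp.memLp (s n)) (h _ (Lp.memLp (s n)))
  have hi : Integrable (fun z => F z ^ 2) ((volume : Measure (E d)).prod (gammaMeasure d)) :=
    hF.integrable_sq
  have h2 : ∀ᵐ v ∂(gammaMeasure d), AEStronglyMeasurable (fun x => F (x, v)) volume := by
    have hm : AEStronglyMeasurable F ((volume : Measure (E d)).prod (gammaMeasure d)) := hF.1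
    exact hm.prodMk_right
  have h3 : ∀ᵐ v ∂(gammaMeasure d), ∫ x, F (x, v) ^ 2 = 0 := by
    filter_upwards [gammaMeasure_ac_volume.ae_le h1, h2, hi.prod_left_ae] with v hv hm hsq
    have hv2 : MemLp (fun x => F (x, v)) 2 := (memLp_two_iff_integrable_sq hm).2 hsq
    have hz : hv2.toLp = 0 := by
      refine (TopologicalSpace.denseRange_denseSeq
        (Lp ℝ 2 (volume : Measure (E d)))).eq_zero_of_inner_left ℝ fun n => ?_
      rw [L2.inner_def, ← hv n]
      refine integral_congr_ae ?_
      filter_upwards [hv2.coeFn_toLp] with x hx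
      rw [hx]; simp [mul_comm, s]
    rw [Lp.eq_zero_iff_ae_eq_zero] at hz
    rw [integral_eq_zero_of_ae]
    filter_upwards [hz, hv2.coeFn_toLp] with x h1 h2
    rw [← h2, h1]; simp
  have h4 : ∫ z, F z ^ 2 ∂(phaseMeasure d) = 0 := by
    rw [phaseMeasure, integral_prod_symm _ hi, integral_eq_zero_of_ae h3]
  rw [integral_eq_zero_iff_of_nonneg (fun z => sq_nonneg _) hF.integrable_sq] at h4
  filter_upwards [h4] with z hz
  simpa using hz

end completeness

lemma isHilbertSum_hermiteEmb :
    IsHilbertSum ℝ (fun _ : Fin d → ℕ => Lp ℝ 2 (volume : Measure (E d))) hermiteEmb := by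
  refine IsHilbertSum.mk (𝕜 := ℝ) (V := hermiteEmb) orthogonalFamily_hermiteEmb ?_
  rw [top_le_iff, Submodule.topologicalClosure_eq_top_iff, Submodule.eq_bot_iff]
  intro F hF
  rw [Submodule.mem_orthogonal'] at hF
  have h := ae_eq_zero_of_hermite (Lp.memLp F) fun ψ hψ k => by
    rw [← inner_hermiteEmb k hψ]
    exact hF _ (Submodule.mem_iSup_of_mem k ⟨_, rfl⟩)
  exact (Lp.eq_zero_iff_ae_eq_zero).2 h

/-- Parseval's identity for the expansion in Hermite functions. -/
lemma hasSum_norm_coeff_sq (F : Lp ℝ 2 (phaseMeasure d)) :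
    HasSum (fun k : Fin d → ℕ => ‖coeff k F‖ ^ 2) (‖F‖ ^ 2) := by
  classical
  have hV := isHilbertSum_hermiteEmb (d := d)
  -- The coordinates of the abstract Hilbert sum are identified with `coeff` by duality, since
  -- `coeff k` is the adjoint of the embedding.
  have e : ∀ k, hV.linearIsometryEquiv F k = coeff k F := fun k => by
    refine ext_inner_right ℝ fun ψ => ?_
    have h1 := hV.linearIsometryEquiv_symm_apply_single (i := k) ψ
    rw [inner_coeff, ← h1, ← hV.linearIsometryEquiv.inner_map_map F,
      LinearIsometryEquiv.apply_symm_apply]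
    exact (lp.inner_single_right (𝕜 := ℝ)
      (G := fun _ : Fin d → ℕ => Lp ℝ 2 (volume : Measure (E d))) k ψ _).symm
  have := lp.hasSum_norm (p := 2) (by simp) (hV.linearIsometryEquiv F)
  rw [hV.linearIsometryEquiv.norm_map] at this
  simpa [e] using this

end coefficients

/-! ### The functionals of a finite Hermite sum -/

section modes
variable {d : ℕ}

/-- The sequence `z` restricted to the finite set `K` of multi-indices. -/
def trunc (K : Finset (Fin d → ℕ)) (z : (Fin d → ℕ) → ℂ) (k : Fin d → ℕ) : ℂ :=
  if k ∈ K then z k else 0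

/-- The first moment `∫ (ξ · v) F dv` in terms of the Hermite coefficients of `F`. -/
def flux (ξ : E d) (w : (Fin d → ℕ) → ℂ) : ℂ := ∑ j, (ξ j : ℂ) * w (up 0 j)

/-- The Hermite coefficients of `(ξ · v) F` in terms of those of `F`. -/
def ladder (ξ : E d) (w : (Fin d → ℕ) → ℂ) (k : Fin d → ℕ) : ℂ :=
  ∑ j, (ξ j : ℂ) * ((√((k j : ℝ) + 1) : ℂ) * w (up k j) + (√(k j : ℝ) : ℂ) * w (down k j))

/-- The eigenvalue of `-L` at the Hermite function of multi-index `k`. -/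
def rate (L : Collision) (k : Fin d → ℕ) : ℝ :=
  match L with
  | .fokkerPlanck => ((∑ j, k j : ℕ) : ℝ)
  | .bgk => if k = 0 then 0 else 1

/-- The Hermite polynomial sum `∑ z_k h_k`. -/
def hermSum (K : Finset (Fin d → ℕ)) (z : (Fin d → ℕ) → ℂ) (v : E d) : ℂ :=
  ∑ k ∈ K, z k * (hermiteFun k v : ℂ)

/-- The function `∑ z_k h_k 𝓜`. -/
def hermState (K : Finset (Fin d → ℕ)) (z : (Fin d → ℕ) → ℂ) (v : E d) : ℂ :=
  maxwellian v • hermSum K z v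

variable (K : Finset (Fin d → ℕ)) (z : (Fin d → ℕ) → ℂ)

lemma expGrowth_hermSum : ExpGrowth (hermSum K z) :=
  ExpGrowth.sum _ fun k _ => (ExpGrowth.const _).mul ((expGrowth_hermiteFun k).mono (by simp))

lemma continuous_hermSum : Continuous (hermSum K z) := by
  have : ∀ k : Fin d → ℕ, Continuous (hermiteFun k) := continuous_hermiteFun
  unfold hermSum; fun_prop

lemma memLp_hermState : MemLp (hermState K z) 2 (gammaMeasure d) :=
  (expGrowth_hermSum K z).memLp_maxwellian_smul (continuous_hermSum K z).aestronglyMeasurable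

lemma expGrowth_inner (ξ : E d) : ExpGrowth fun v : E d => ((inner ℝ ξ v : ℝ) : ℂ) :=
  (ExpGrowth.id.norm.mul (.const ‖ξ‖)).mono fun v => by
    have := norm_inner_le_norm (𝕜 := ℝ) ξ v
    rw [mul_comm] at this
    simpa using this

lemma continuous_inner_ofReal (ξ : E d) : Continuous fun v : E d => ((inner ℝ ξ v : ℝ) : ℂ) := by
  fun_prop

lemma integrable_mul_hermState {q : E d → ℂ} (hq : ExpGrowth q) (hc : Continuous q) :
    Integrable fun v => q v * hermState K z v := by
  have := (hq.mul (expGrowth_hermSum K z)).integrable_mul_maxwellian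
    (hc.mul (continuous_hermSum K z)).aestronglyMeasurable
  refine this.congr (Filter.Eventually.of_forall fun v => ?_)
  simp only [hermState, Complex.real_smul]; ring

lemma integral_hermiteFun_mul_hermState (l : Fin d → ℕ) :
    ∫ v, (hermiteFun l v : ℂ) * hermState K z v = trunc K z l := by
  have e : ∀ v : E d, (hermiteFun l v : ℂ) * hermState K z v
      = ∑ k ∈ K, z k * ((hermiteFun l v * hermiteFun k v * maxwellian v : ℝ) : ℂ) := fun v => by
    simp only [hermState, hermSum, Complex.real_smul, Finset.mul_sum]
    refine Finset.sum_congr rfl fun k _ => ?_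
    push_cast; ring
  have hi : ∀ k, Integrable fun v : E d => hermiteFun l v * hermiteFun k v * maxwellian v :=
    fun k => by
      refine (((expGrowth_hermiteFun l).mul (expGrowth_hermiteFun k)).integrable_mul_maxwellian
        ((continuous_hermiteFun l).mul (continuous_hermiteFun k)).aestronglyMeasurable).congr ?_
      exact Filter.Eventually.of_forall fun v => by simp only [smul_eq_mul]; ring
  rw [integral_congr_ae (Filter.Eventually.of_forall e),
    integral_finsetSum _ fun k _ => ((hi k).ofReal).const_mul _]
  have : ∀ k ∈ K, ∫ v : E d, z k * ((hermiteFun l v * hermiteFun k v * maxwellian v : ℝ) : ℂ)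
      = if l = k then z k else 0 := fun k _ => by
    rw [integral_const_mul, integral_complex_ofReal, integral_hermiteFun_mul_hermiteFun]
    split_ifs <;> simp
  rw [Finset.sum_congr rfl this, Finset.sum_ite_eq]
  rfl

lemma integral_hermState : ∫ v, hermState K z v = trunc K z 0 := by
  simpa using integral_hermiteFun_mul_hermState K z 0

lemma integral_inner_mul_hermiteFun_mul_hermState (ξ : E d) (l : Fin d → ℕ) :
    ∫ v, ((inner ℝ ξ v : ℝ) : ℂ) * ((hermiteFun l v : ℂ) * hermState K z v)
      = ladder ξ (trunc K z) l := by
  have hi : ∀ k, Integrable fun v : E d => (hermiteFun k v : ℂ) * hermState K z v := fun k =>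
    integrable_mul_hermState K z ((expGrowth_hermiteFun k).mono (by simp))
      (Complex.continuous_ofReal.comp (continuous_hermiteFun k))
  have e : ∀ v : E d, ((inner ℝ ξ v : ℝ) : ℂ) * ((hermiteFun l v : ℂ) * hermState K z v)
      = ∑ j, (ξ j : ℂ) * ((√((l j : ℝ) + 1) : ℂ) * ((hermiteFun (up l j) v : ℂ) * hermState K z v)
        + (√(l j : ℝ) : ℂ) * ((hermiteFun (down l j) v : ℂ) * hermState K z v)) := fun v => by
    rw [PiLp.inner_apply, Complex.ofReal_sum, Finset.sum_mul]
    refine Finset.sum_congr rfl fun j _ => ?_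
    have := congrArg (fun x : ℝ => (x : ℂ)) (coord_mul_hermiteFun l j v)
    simp only [Complex.ofReal_mul, Complex.ofReal_add] at this
    simp only [RCLike.inner_apply, conj_trivial, Complex.ofReal_mul]
    linear_combination (ξ j : ℂ) * hermState K z v * this
  simp_rw [e]
  rw [integral_finsetSum]
  · refine Finset.sum_congr rfl fun j _ => ?_
    rw [integral_const_mul, integral_add ((hi _).const_mul _) ((hi _).const_mul _),
      integral_const_mul, integral_const_mul, integral_hermiteFun_mul_hermState,
      integral_hermiteFun_mul_hermState]
  · exact fun j _ => (((hi _).const_mul _).add ((hi _).const_mul _)).const_mul _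

lemma inner_eq_sum_hermiteFun (ξ v : E d) :
    ((inner ℝ ξ v : ℝ) : ℂ) = ∑ j, (ξ j : ℂ) * (hermiteFun (up 0 j) v : ℂ) := by
  rw [PiLp.inner_apply, Complex.ofReal_sum]
  refine Finset.sum_congr rfl fun j _ => ?_
  rw [hermiteFun_up_zero]; simp [mul_comm]

lemma integral_inner_mul_hermState (ξ : E d) :
    ∫ v, ((inner ℝ ξ v : ℝ) : ℂ) * hermState K z v = flux ξ (trunc K z) := by
  have hi : ∀ k, Integrable fun v : E d => (hermiteFun k v : ℂ) * hermState K z v := fun k =>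
    integrable_mul_hermState K z ((expGrowth_hermiteFun k).mono (by simp))
      (Complex.continuous_ofReal.comp (continuous_hermiteFun k))
  simp_rw [inner_eq_sum_hermiteFun, Finset.sum_mul, mul_assoc]
  rw [integral_finsetSum _ fun j _ => (hi _).const_mul _]
  simp_rw [integral_const_mul, integral_hermiteFun_mul_hermState]
  rfl

/-- One factor `ξ · v` is written with the Hermite functions of degree one, the other is absorbed by
the recurrence. -/
lemma integral_inner_mul_inner_mul_hermState (ξ : E d) :
    ∫ v, ((inner ℝ ξ v : ℝ) : ℂ) * (((inner ℝ ξ v : ℝ) : ℂ) * hermState K z v)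
      = flux ξ (ladder ξ (trunc K z)) := by
  have hi : ∀ k, Integrable fun v : E d => ((inner ℝ ξ v : ℝ) : ℂ) *
      ((hermiteFun k v : ℂ) * hermState K z v) := fun k => by
    have := integrable_mul_hermState K z
      (q := fun v => ((inner ℝ ξ v : ℝ) : ℂ) * (hermiteFun k v : ℂ))
      ((expGrowth_inner ξ).mul ((expGrowth_hermiteFun k).mono (by simp)))
      ((continuous_inner_ofReal ξ).mul (Complex.continuous_ofReal.comp (continuous_hermiteFun k)))
    simpa only [mul_assoc] using this
  have e : ∀ v : E d, ((inner ℝ ξ v : ℝ) : ℂ) * (((inner ℝ ξ v : ℝ) : ℂ) * hermState K z v)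
      = ∑ j, (ξ j : ℂ) * (((inner ℝ ξ v : ℝ) : ℂ) *
        ((hermiteFun (up 0 j) v : ℂ) * hermState K z v)) := fun v => by
    conv_lhs => rw [inner_eq_sum_hermiteFun ξ v, Finset.sum_mul]
    rw [← inner_eq_sum_hermiteFun ξ v]
    exact Finset.sum_congr rfl fun j _ => by ring
  simp_rw [e]
  rw [integral_finsetSum _ fun j _ => (hi _).const_mul _]
  simp_rw [integral_const_mul, integral_inner_mul_hermiteFun_mul_hermState]
  rfl

lemma ip_maxwellian_mul (q : E d → ℂ) (F : E d → ℂ) :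
    ip (fun v => (maxwellian v : ℂ) * q v) F = ∫ v, q v * (starRingEnd ℂ) (F v) := by
  unfold ip
  rw [← integral_gamma_maxwellian_smul]
  congr 1; ext v; simp only [Complex.real_smul]; ring

lemma ip_hermState (y : (Fin d → ℕ) → ℂ) :
    ip (hermState K y) (hermState K z) = ∑ k ∈ K, y k * (starRingEnd ℂ) (z k) := by
  have hi : ∀ k, Integrable fun v : E d =>
      (starRingEnd ℂ) ((hermiteFun k v : ℂ) * hermState K z v) := fun k =>
    (LinearIsometryEquiv.integrable_comp_iff Complex.conjLIE).2
      (integrable_mul_hermState K z ((expGrowth_hermiteFun k).mono (by simp))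
      (Complex.continuous_ofReal.comp (continuous_hermiteFun k)))
  have e : hermState K y = fun v => (maxwellian v : ℂ) * hermSum K y v := by
    ext v; simp [hermState]
  rw [e, ip_maxwellian_mul]
  have e2 : ∀ v : E d, hermSum K y v * (starRingEnd ℂ) (hermState K z v)
      = ∑ k ∈ K, y k * (starRingEnd ℂ) ((hermiteFun k v : ℂ) * hermState K z v) := fun v => by
    rw [hermSum, Finset.sum_mul]
    refine Finset.sum_congr rfl fun k _ => ?_
    rw [map_mul, Complex.conj_ofReal]; ring
  simp_rw [e2]
  rw [integral_finsetSum _ fun k _ => (hi k).const_mul _]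
  refine Finset.sum_congr rfl fun k hk => ?_
  rw [integral_const_mul, integral_conj, integral_hermiteFun_mul_hermState, trunc, if_pos hk]

lemma normSq_hermState : normSq (hermState K z) = ∑ k ∈ K, ‖z k‖ ^ 2 := by
  have h := ip_hermState K z z
  simp_rw [Complex.mul_conj'] at h
  have e : ip (hermState K z) (hermState K z) = ((normSq (hermState K z) : ℝ) : ℂ) := by
    unfold ip normSq
    rw [← integral_complex_ofReal]
    congr 1; ext v; rw [Complex.mul_conj']; push_cast; rfl
  rw [e] at h
  exact_mod_cast h

/-- The range of `A` is the line spanned by `𝓜`, so the second argument enters only through its mode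
of index `0`. -/
lemma ip_opA (ξ : E d) (U : E d → ℂ) :
    ip (opA ξ U) (hermState K z) = -(Complex.I / ((1 + ‖ξ‖ ^ 2 : ℝ) : ℂ)) *
      (∫ w, ((inner ℝ ξ w : ℝ) : ℂ) * U w) * (starRingEnd ℂ) (trunc K z 0) := by
  have e : opA ξ U = fun v => (maxwellian v : ℂ) * (-(Complex.I / ((1 + ‖ξ‖ ^ 2 : ℝ) : ℂ)) *
      (∫ w, ((inner ℝ ξ w : ℝ) : ℂ) * U w)) := by
    ext v; unfold opA; ring
  rw [e, ip_maxwellian_mul, integral_const_mul, integral_conj, integral_hermState]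

lemma entropy_hermState (ξ : E d) (δ : ℝ) :
    entropy ξ δ (hermState K z) = 1 / 2 * ∑ k ∈ K, ‖z k‖ ^ 2 +
      δ / (1 + ‖ξ‖ ^ 2) *
        (-Complex.I * flux ξ (trunc K z) * (starRingEnd ℂ) (trunc K z 0)).re := by
  unfold entropy
  rw [normSq_hermState, ip_opA, integral_inner_mul_hermState, div_mul_eq_mul_div δ, mul_div_assoc δ]
  congr 2
  rw [← Complex.div_ofReal_re]
  congr 1; ring

/-- The flux only sees indices of total degree one, where both collision operators have eigenvalue
`-1`. This lets the two cases be treated together. -/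
lemma flux_trunc_rate (L : Collision) (ξ : E d) :
    flux ξ (trunc K fun k => -(rate L k : ℂ) * z k) = -flux ξ (trunc K z) := by
  unfold flux
  rw [← Finset.sum_neg_distrib]
  refine Finset.sum_congr rfl fun j _ => ?_
  have : rate L (up (0 : Fin d → ℕ) j) = 1 := by
    cases L with
    | fokkerPlanck =>
      simp [rate, up, Finset.sum_update_of_mem]
    | bgk =>
      have : up (0 : Fin d → ℕ) j ≠ 0 := fun h => by simpa [up] using congrFun h j
      simp [rate, this]
  unfold trunc
  split_ifs <;> simp [this]

lemma transport_eq (ξ : E d) (F : E d → ℂ) (v : E d) :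
    transport ξ F v = Complex.I * ((inner ℝ ξ v : ℝ) : ℂ) * F v := by
  rw [transport, real_inner_comm]

/-- Every term of `D` becomes a finite expression in the modes: `-⟨L F, F⟩` is diagonal, `T A` gives
the squared flux, `A L` a multiple of `A`, and the terms with `A T` a second moment. -/
lemma entropyProduction_hermState (L : Collision) (ξ : E d) (δ : ℝ) :
    entropyProduction ξ δ (hermState K z) (hermState K fun k => -(rate L k : ℂ) * z k)
      = ∑ k ∈ K, rate L k * ‖z k‖ ^ 2 + δ / (1 + ‖ξ‖ ^ 2) *
        ((flux ξ (ladder ξ (trunc K z)) * (starRingEnd ℂ) (trunc K z 0)).re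
          - ‖flux ξ (trunc K z)‖ ^ 2
          - (Complex.I * flux ξ (trunc K z) * (starRingEnd ℂ) (trunc K z 0)).re) := by
  have hs : (1 + ‖ξ‖ ^ 2 : ℝ) ≠ 0 := by positivity
  have hprojv : ∀ v, proj (hermState K z) v = trunc K z 0 * hermState {0} (fun _ => 1) v :=
    fun v => by
      rw [proj, integral_hermState]
      simp [hermState, hermSum]; ring
  have hTA : ip (transport ξ (opA ξ (hermState K z))) (hermState K z)
      = ((‖flux ξ (trunc K z)‖ ^ 2 / (1 + ‖ξ‖ ^ 2) : ℝ) : ℂ) := by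
    have e : transport ξ (opA ξ (hermState K z)) = fun v => (maxwellian v : ℂ) *
        (((1 / (1 + ‖ξ‖ ^ 2) : ℝ) : ℂ) * flux ξ (trunc K z) * ((inner ℝ ξ v : ℝ) : ℂ)) := by
      ext v
      rw [transport_eq, opA, integral_inner_mul_hermState]
      push_cast
      linear_combination (-((inner ℝ ξ v : ℝ) : ℂ) * flux ξ (trunc K z) * (maxwellian v : ℂ)
        / (1 + (‖ξ‖ : ℂ) ^ 2)) * Complex.I_mul_I
    rw [e, ip_maxwellian_mul]
    simp_rw [mul_assoc]
    rw [integral_const_mul, integral_const_mul]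
    have e2 : ∀ v : E d, ((inner ℝ ξ v : ℝ) : ℂ) * (starRingEnd ℂ) (hermState K z v)
        = (starRingEnd ℂ) (((inner ℝ ξ v : ℝ) : ℂ) * hermState K z v) := fun v => by
      rw [map_mul, Complex.conj_ofReal]
    simp_rw [e2]
    rw [integral_conj, integral_inner_mul_hermState, Complex.mul_conj']
    push_cast; ring
  have hi2 : ∀ (K' : Finset (Fin d → ℕ)) (y : (Fin d → ℕ) → ℂ), Integrable fun v =>
      ((inner ℝ ξ v : ℝ) : ℂ) * (((inner ℝ ξ v : ℝ) : ℂ) * hermState K' y v) := fun K' y => by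
    simpa only [mul_assoc] using integrable_mul_hermState K' y
      ((expGrowth_inner ξ).mul (expGrowth_inner ξ))
      ((continuous_inner_ofReal ξ).mul (continuous_inner_ofReal ξ))
  -- The terms with `A T Π` and `A T (Id - Π)` carry the same factor `δ`, so only their sum, which
  -- is `A T`, has to be computed.
  have hsum : (∫ w, ((inner ℝ ξ w : ℝ) : ℂ) * transport ξ (proj (hermState K z)) w)
      + (∫ w, ((inner ℝ ξ w : ℝ) : ℂ) *
        transport ξ (fun v => hermState K z v - proj (hermState K z) v) w)
      = Complex.I * flux ξ (ladder ξ (trunc K z)) := by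
    rw [← integral_inner_mul_inner_mul_hermState, ← integral_const_mul, ← integral_add]
    · refine integral_congr_ae (Filter.Eventually.of_forall fun v => ?_)
      simp only [transport_eq]; ring
    · refine ((hi2 {0} fun _ => 1).const_mul (Complex.I * trunc K z 0)).congr
        (Filter.Eventually.of_forall fun v => ?_)
      simp only [transport_eq, hprojv]; ring
    · refine (((hi2 K z).const_mul Complex.I).sub
        ((hi2 {0} fun _ => 1).const_mul (Complex.I * trunc K z 0))).congr
        (Filter.Eventually.of_forall fun v => ?_)
      simp only [Pi.sub_apply, transport_eq, hprojv]; ring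
  have hcomb : (ip (opA ξ (transport ξ (proj (hermState K z)))) (hermState K z)).re
      + (ip (opA ξ (transport ξ (fun v => hermState K z v - proj (hermState K z) v)))
        (hermState K z)).re
      = (flux ξ (ladder ξ (trunc K z)) * (starRingEnd ℂ) (trunc K z 0)).re / (1 + ‖ξ‖ ^ 2) := by
    rw [ip_opA, ip_opA, ← Complex.add_re, ← add_mul, ← mul_add, hsum, ← Complex.div_ofReal_re]
    congr 1
    linear_combination (-flux ξ (ladder ξ (trunc K z)) * (starRingEnd ℂ) (trunc K z 0)
      / ((1 + ‖ξ‖ ^ 2 : ℝ) : ℂ)) * Complex.I_mul_I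
  have hAL : (ip (opA ξ (hermState K fun k => -(rate L k : ℂ) * z k)) (hermState K z)).re
      = (Complex.I * flux ξ (trunc K z) * (starRingEnd ℂ) (trunc K z 0)).re / (1 + ‖ξ‖ ^ 2) := by
    rw [ip_opA, integral_inner_mul_hermState, flux_trunc_rate, ← Complex.div_ofReal_re]
    congr 1; ring
  have hL : -(ip (hermState K fun k => -(rate L k : ℂ) * z k) (hermState K z)).re
      = ∑ k ∈ K, rate L k * ‖z k‖ ^ 2 := by
    rw [ip_hermState, Complex.re_sum, ← Finset.sum_neg_distrib]
    refine Finset.sum_congr rfl fun k _ => ?_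
    rw [mul_assoc, Complex.mul_conj', ← Complex.ofReal_pow, ← Complex.ofReal_neg,
      ← Complex.ofReal_mul, Complex.ofReal_re]
    ring
  unfold entropyProduction
  rw [hL, hTA, hAL, Complex.ofReal_re]
  linear_combination δ * hcomb

lemma memLp_transport_hermState (ξ : E d) :
    MemLp (transport ξ (hermState K z)) 2 (gammaMeasure d) := by
  have := (((ExpGrowth.const (V := E d) Complex.I).mul (expGrowth_inner ξ)).mul
    (expGrowth_hermSum K z)).memLp_maxwellian_smul
    ((continuous_const.mul (continuous_inner_ofReal ξ)).mul
      (continuous_hermSum K z)).aestronglyMeasurable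
  refine this.congr_norm ?_ ?_
  · have : transport ξ (hermState K z) = fun v =>
        Complex.I * ((inner ℝ ξ v : ℝ) : ℂ) * (maxwellian v • hermSum K z v) := by
      ext v; rw [transport_eq, hermState]
    rw [this]
    exact ((continuous_const.mul (continuous_inner_ofReal ξ)).mul
      (continuous_maxwellian.smul (continuous_hermSum K z))).aestronglyMeasurable
  · refine Filter.Eventually.of_forall fun v => ?_
    rw [transport_eq, hermState, mul_smul_comm]

/-- Hermite functions are eigenfunctions: by symmetry in `L²(dγ)` for Fokker-Planck, and because `Π`
keeps exactly the index `0` for BGK. -/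
lemma isCollision_hermState (L : Collision) :
    IsCollision L (hermState K z) (hermState K fun k => -(rate L k : ℂ) * z k) := by
  cases L with
  | fokkerPlanck =>
    intro φ hφ hs
    have hM : Continuous (maxwellian : E d → ℝ) := continuous_maxwellian
    have key : ∀ k : Fin d → ℕ, ∫ v, hermiteFun k v * maxwellian v * fokkerPlanckAdjoint φ v
        = -rate .fokkerPlanck k * ∫ v, hermiteFun k v * maxwellian v * φ v := fun k => by
      rw [integral_mul_maxwellian_mul_fokkerPlanckAdjoint (contDiff_hermiteFun k) hφ hs,
        ← integral_const_mul]
      simp_rw [fokkerPlanckAdjoint_hermiteFun, rate, mul_assoc]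
    have hLφc : Continuous (fokkerPlanckAdjoint φ) := by
      rw [funext (fokkerPlanckAdjoint_eq_sum hφ)]
      refine continuous_finsetSum _ fun j _ => ?_
      have h1 := contDiff_partialDeriv hφ j
      exact (contDiff_partialDeriv h1 j).continuous.sub
        ((by fun_prop : Continuous fun v : E d => v j).mul h1.continuous)
    have hLφs : HasCompactSupport (fokkerPlanckAdjoint φ) := by
      refine HasCompactSupport.intro hs.isCompact fun v hv => ?_
      have h1 : ∀ j, v ∉ tsupport (partialDeriv j φ) := fun j h =>
        hv (tsupport_partialDeriv_subset j φ h)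
      have h2 : ∀ j, v ∉ tsupport (partialDeriv j (partialDeriv j φ)) := fun j h =>
        h1 j (tsupport_partialDeriv_subset j _ h)
      rw [fokkerPlanckAdjoint_eq_sum hφ]
      simp [fun j => image_eq_zero_of_notMem_tsupport (h1 j),
        fun j => image_eq_zero_of_notMem_tsupport (h2 j)]
    have e : ∀ (y : (Fin d → ℕ) → ℂ) (g : E d → ℝ) (v : E d), hermState K y v * (g v : ℂ)
        = ∑ k ∈ K, y k * ((hermiteFun k v * maxwellian v * g v : ℝ) : ℂ) := fun y g v => by
      simp only [hermState, hermSum, Complex.real_smul, Finset.mul_sum, Finset.sum_mul]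
      refine Finset.sum_congr rfl fun k _ => ?_
      push_cast; ring
    have hi : ∀ (g : E d → ℝ), Continuous g → HasCompactSupport g → ∀ k : Fin d → ℕ,
        Integrable fun v : E d => ((hermiteFun k v * maxwellian v * g v : ℝ) : ℂ) :=
      fun g hg hgs k => (((continuous_hermiteFun k).mul hM).mul
        hg).integrable_of_hasCompactSupport hgs.mul_left |>.ofReal
    simp_rw [e]
    rw [integral_finsetSum _ fun k _ => (hi φ hφ.continuous hs k).const_mul _,
      integral_finsetSum _ fun k _ => (hi _ hLφc hLφs k).const_mul _]
    refine Finset.sum_congr rfl fun k _ => ?_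
    rw [integral_const_mul, integral_const_mul, integral_complex_ofReal, integral_complex_ofReal,
      key]
    push_cast; ring
  | bgk =>
    refine Filter.Eventually.of_forall fun v => ?_
    simp only [proj]
    rw [integral_hermState, trunc]
    simp only [hermState, hermSum, Complex.real_smul]
    rw [← mul_sub]
    congr 1
    have : ∀ k : Fin d → ℕ, -((rate .bgk k : ℝ) : ℂ) * z k * (hermiteFun k v : ℂ)
        = (if k = 0 then z k else 0) - z k * (hermiteFun k v : ℂ) := fun k => by
      by_cases hk : k = 0
      · subst hk; simp [rate]
      · simp [rate, hk]
    simp_rw [this, Finset.sum_sub_distrib, Finset.sum_ite_eq']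

end modes

/-! ### The weak equation tested against Hermite functions -/

section weak
variable {d : ℕ}

/-- The adjoint of the collision operator, on functions of the velocity. -/
def collisionAdjoint (L : Collision) (g : E d → ℝ) (v : E d) : ℝ :=
  match L with
  | .fokkerPlanck => fokkerPlanckAdjoint g v
  | .bgk => (∫ w, maxwellian w * g w) - g v

lemma collisionAdjoint_hermiteFun (L : Collision) (k : Fin d → ℕ) (v : E d) :
    collisionAdjoint L (hermiteFun k) v = -rate L k * hermiteFun k v := by
  cases L with
  | fokkerPlanck => simp only [collisionAdjoint, rate, fokkerPlanckAdjoint_hermiteFun]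
  | bgk =>
    have h := integral_hermiteFun_mul_hermiteFun k 0
    simp only [hermiteFun_zero, mul_one] at h
    simp only [collisionAdjoint, rate, mul_comm (maxwellian _), h]
    by_cases hk : k = 0
    · subst hk; simp
    · simp [hk]

lemma partialDeriv_const_mul {φ : E d → ℝ} (hφ : Differentiable ℝ φ) (c : ℝ) (j : Fin d) :
    partialDeriv j (fun w => c * φ w) = fun w => c * partialDeriv j φ w := by
  ext v
  unfold partialDeriv
  rw [fderiv_const_mul hφ.differentiableAt]; rfl

lemma fokkerPlanckAdjoint_const_mul {g : E d → ℝ} (hg : ContDiff ℝ ∞ g) (c : ℝ) (v : E d) :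
    fokkerPlanckAdjoint (fun w => c * g w) v = c * fokkerPlanckAdjoint g v := by
  rw [fokkerPlanckAdjoint_eq_sum (contDiff_const.mul hg), fokkerPlanckAdjoint_eq_sum hg,
    Finset.mul_sum]
  refine Finset.sum_congr rfl fun j _ => ?_
  rw [partialDeriv_const_mul (hg.differentiable (by simp)),
    partialDeriv_const_mul ((contDiff_partialDeriv hg j).differentiable (by simp))]
  ring

lemma continuous_fokkerPlanckAdjoint {φ : E d → ℝ} (hφ : ContDiff ℝ ∞ φ) :
    Continuous (fokkerPlanckAdjoint φ) := by
  rw [funext (fokkerPlanckAdjoint_eq_sum hφ)]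
  refine continuous_finsetSum _ fun j _ => ?_
  have h1 := contDiff_partialDeriv hφ j
  exact (contDiff_partialDeriv h1 j).continuous.sub
    ((by fun_prop : Continuous fun v : E d => v j).mul h1.continuous)

lemma continuous_collisionAdjoint (L : Collision) {g : E d → ℝ} (hg : ContDiff ℝ ∞ g) :
    Continuous (collisionAdjoint L g) := by
  cases L with
  | fokkerPlanck => exact continuous_fokkerPlanckAdjoint hg
  | bgk => exact continuous_const.sub hg.continuous

lemma expGrowth_of_hasCompactSupport {g : E d → ℝ} (hg : Continuous g) (hs : HasCompactSupport g) :
    ExpGrowth g := by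
  obtain ⟨C, hC⟩ := hs.exists_bound_of_continuous hg
  exact (ExpGrowth.const C).mono fun v => (hC v).trans (le_abs_self C)

lemma transportPairing_mul (F : E d × E d → ℝ) {ψ : E d → ℝ} (hψ : ContDiff ℝ ∞ ψ) (g : E d → ℝ) :
    transportPairing F (fun z => ψ z.1 * g z.2)
      = ∫ z : E d × E d, ∑ j, F z * (partialDeriv j ψ z.1 * (z.2 j * g z.2)) := by
  unfold transportPairing
  congr 1; ext z
  simp only
  rw [fderiv_mul_const (hψ.differentiable (by simp)).differentiableAt, smul_apply,
    fderiv_apply_eq_sum, smul_eq_mul, Finset.mul_sum, Finset.mul_sum]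
  refine Finset.sum_congr rfl fun j _ => ?_
  simp only [smul_eq_mul]; ring

/-- For BGK this is Fubini: the velocity integral defining the density is traded for the mean of `g`
against `𝓜`. -/
lemma collisionPairing_mul (L : Collision) {F : E d × E d → ℝ} (hF : MemLp F 2 (phaseMeasure d))
    {ψ : E d → ℝ} (hψ : MemLp ψ 2) {g : E d → ℝ} (hg : ContDiff ℝ ∞ g) (hs : HasCompactSupport g) :
    collisionPairing L F (fun z => ψ z.1 * g z.2)
      = ∫ z : E d × E d, F z * (ψ z.1 * collisionAdjoint L g z.2) := by
  cases L with
  | fokkerPlanck =>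
    simp only [collisionPairing, collisionAdjoint, fokkerPlanckAdjoint_const_mul hg]
  | bgk =>
    have h1 : Integrable fun z : E d × E d => F z * ψ z.1 := by
      simpa using
        integrable_mul_of_growth hF hψ (ExpGrowth.const (V := E d) (1 : ℝ)) continuous_const
    have h2 : Integrable fun x => spatialDensity F x * ψ x := by
      have := h1.integral_prod_left
      simpa only [spatialDensity, integral_mul_const] using this
    have hMg : Integrable fun v => maxwellian v * g v :=
      (expGrowth_of_hasCompactSupport hg.continuous hs).integrable_mul_maxwellian
        hg.continuous.aestronglyMeasurable
    have h3 : Integrable fun z : E d × E d =>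
        (spatialDensity F z.1 * ψ z.1) * (maxwellian z.2 * g z.2) := h2.mul_prod hMg
    have h4 := integrable_mul_of_growth hF hψ
      (expGrowth_of_hasCompactSupport hg.continuous hs) hg.continuous
    have e1 : ∀ z : E d × E d, (spatialDensity F z.1 * maxwellian z.2 - F z) * (ψ z.1 * g z.2)
        = (spatialDensity F z.1 * ψ z.1) * (maxwellian z.2 * g z.2) - F z * (ψ z.1 * g z.2) :=
      fun z => by ring
    have e2 : ∀ z : E d × E d, F z * (ψ z.1 * ((∫ w, maxwellian w * g w) - g z.2))
        = (F z * ψ z.1) * (∫ w, maxwellian w * g w) - F z * (ψ z.1 * g z.2) := fun z => by ring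
    simp only [collisionPairing, collisionAdjoint]
    simp_rw [e1, e2]
    rw [integral_sub h3 h4, integral_sub (h1.mul_const _) h4, integral_mul_const]
    congr 1
    rw [Measure.volume_eq_prod, integral_prod_mul (fun x => spatialDensity F x * ψ x)
      (fun v => maxwellian v * g v), integral_prod _ h1]
    simp only [spatialDensity, integral_mul_const]

/-- `∬ P φ = ∬ (L F - v · ∇ₓ F) φ` for all test functions `φ`. -/
def IsWeakDerivative (L : Collision) (P F : E d × E d → ℝ) : Prop :=
  ∀ φ : E d × E d → ℝ, ContDiff ℝ ∞ φ → HasCompactSupport φ →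
    ∫ z, P z * φ z = transportPairing F φ + collisionPairing L F φ

lemma memLp_of_contDiff {ψ : E d → ℝ} (hψ : ContDiff ℝ ∞ ψ) (hs : HasCompactSupport ψ) :
    MemLp ψ 2 := hψ.continuous.memLp_of_hasCompactSupport hs

lemma IsWeakDerivative.integral_tensor {L : Collision} {P F : E d × E d → ℝ}
    (h : IsWeakDerivative L P F) (hF : MemLp F 2 (phaseMeasure d)) {ψ : E d → ℝ}
    (hψ : ContDiff ℝ ∞ ψ) (hψs : HasCompactSupport ψ) {g : E d → ℝ} (hg : ContDiff ℝ ∞ g)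
    (hs : HasCompactSupport g) :
    ∫ z : E d × E d, P z * (ψ z.1 * g z.2)
      = ∑ j, (∫ z : E d × E d, F z * (partialDeriv j ψ z.1 * (z.2 j * g z.2)))
        + ∫ z : E d × E d, F z * (ψ z.1 * collisionAdjoint L g z.2) := by
  have hsupp : HasCompactSupport fun z : E d × E d => ψ z.1 * g z.2 := by
    refine HasCompactSupport.intro (hψs.isCompact.prod hs.isCompact) fun z hz => ?_
    by_cases h1 : z.1 ∈ tsupport ψ
    · have h2 : z.2 ∉ tsupport g := fun h2 => hz ⟨h1, h2⟩
      rw [image_eq_zero_of_notMem_tsupport h2, mul_zero]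
    · rw [image_eq_zero_of_notMem_tsupport h1, zero_mul]
  have hsm : ContDiff ℝ ∞ fun z : E d × E d => ψ z.1 * g z.2 :=
    (hψ.comp contDiff_fst).mul (hg.comp contDiff_snd)
  rw [h _ hsm hsupp, transportPairing_mul F hψ,
    collisionPairing_mul L hF (memLp_of_contDiff hψ hψs) hg hs, integral_finsetSum]
  intro j _
  exact integrable_mul_of_growth hF
    (memLp_of_contDiff (contDiff_partialDeriv hψ j) (hasCompactSupport_partialDeriv hψs j))
    ((expGrowth_coord j).mul (expGrowth_of_hasCompactSupport hg.continuous hs))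
    ((by fun_prop : Continuous fun v : E d => v j).mul hg.continuous)

/-! ### Cut-off in the velocity variable -/

lemma exists_cutoff (V : Type*) [NormedAddCommGroup V] [InnerProductSpace ℝ V]
    [FiniteDimensional ℝ V] :
    ∃ χ : V → ℝ, ContDiff ℝ ∞ χ ∧ HasCompactSupport χ ∧ (∀ x, ‖x‖ ≤ 1 → χ x = 1) ∧
      ∀ x, |χ x| ≤ 1 := by
  let b : ContDiffBump (0 : V) := ⟨1, 2, by norm_num, by norm_num⟩
  refine ⟨b, b.contDiff, b.hasCompactSupport, fun x hx => b.one_of_mem_closedBall ?_, fun x => ?_⟩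
  · simpa [b] using hx
  · rw [abs_of_nonneg b.nonneg]; exact b.le_one

/-- The Hermite operator on the line. -/
def hermiteOp (u : ℝ → ℝ) (x : ℝ) : ℝ := deriv (deriv u) x - x * deriv u x

/-- The functions are `χ(x/(m+1)) h_n(x)`. The bound `B` does not depend on `m` and has exponential
growth, which is what dominated convergence against `F` in `L²(dx dγ)` requires. -/
lemma exists_cutoff_herm (n : ℕ) : ∃ (u : ℕ → ℝ → ℝ) (B : ℝ → ℝ), (∀ m, ContDiff ℝ ∞ (u m)) ∧
    (∀ m, HasCompactSupport (u m)) ∧ ExpGrowth B ∧ Continuous B ∧ (∀ m x, |u m x| ≤ B x) ∧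
    (∀ m x, |hermiteOp (u m) x| ≤ B x) ∧
    (∀ x, ∀ᶠ m in Filter.atTop, u m x = herm n x ∧ hermiteOp (u m) x = hermiteOp (herm n) x) := by
  obtain ⟨χ, hχ, hχs, hχ1, hχb⟩ := exists_cutoff ℝ
  have hχ' : ContDiff ℝ ∞ (deriv χ) := (contDiff_infty_iff_deriv.1 hχ).2
  have hχ'' : ContDiff ℝ ∞ (deriv (deriv χ)) := (contDiff_infty_iff_deriv.1 hχ').2
  have hH := contDiff_herm n
  have hH' : ContDiff ℝ ∞ (deriv (herm n)) := (contDiff_infty_iff_deriv.1 hH).2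
  obtain ⟨C1, hC1⟩ := (hχs.deriv).exists_bound_of_continuous hχ'.continuous
  obtain ⟨C2, hC2⟩ := (hχs.deriv.deriv).exists_bound_of_continuous hχ''.continuous
  have hC1' : 0 ≤ C1 := (norm_nonneg _).trans (hC1 0)
  have hC2' : 0 ≤ C2 := (norm_nonneg _).trans (hC2 0)
  -- Since `ε m ≤ 1`, the derivatives of the dilated cut-off are bounded by those of `χ`, uniformly
  -- in `m`.
  let ε : ℕ → ℝ := fun m => 1 / ((m : ℝ) + 1)
  have hε0 : ∀ m, 0 < ε m := fun m => by positivity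
  have hε1 : ∀ m, ε m ≤ 1 := fun m => by
    simp only [ε]; rw [div_le_one (by positivity)]; linarith [(Nat.cast_nonneg m : (0 : ℝ) ≤ m)]
  have hd1 : ∀ m x, HasDerivAt (fun x => χ (ε m * x)) (ε m * deriv χ (ε m * x)) x := fun m x => by
    have h1 : HasDerivAt χ (deriv χ (ε m * x)) (ε m * x) :=
      (hχ.differentiable (by simp)).differentiableAt.hasDerivAt
    have h2 : HasDerivAt (fun x => ε m * x) (ε m) x := by
      simpa using (hasDerivAt_id x).const_mul (ε m)
    have := h1.comp x h2
    rwa [mul_comm] at this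
  have hd2 : ∀ m x, HasDerivAt (fun x => ε m * deriv χ (ε m * x))
      (ε m * (ε m * deriv (deriv χ) (ε m * x))) x := fun m x => by
    have h1 : HasDerivAt (deriv χ) (deriv (deriv χ) (ε m * x)) (ε m * x) :=
      (hχ'.differentiable (by simp)).differentiableAt.hasDerivAt
    have h2 : HasDerivAt (fun x => ε m * x) (ε m) x := by
      simpa using (hasDerivAt_id x).const_mul (ε m)
    have := (h1.comp x h2).const_mul (ε m)
    rwa [mul_comm (deriv (deriv χ) _)] at this
  have hdH : ∀ x, HasDerivAt (herm n) (deriv (herm n) x) x := fun x =>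
    (hH.differentiable (by simp)).differentiableAt.hasDerivAt
  have hdH' : ∀ x, HasDerivAt (deriv (herm n)) (deriv (deriv (herm n)) x) x := fun x =>
    (hH'.differentiable (by simp)).differentiableAt.hasDerivAt
  have hdu : ∀ m, deriv (fun x => χ (ε m * x) * herm n x) = fun x =>
      ε m * deriv χ (ε m * x) * herm n x + χ (ε m * x) * deriv (herm n) x := fun m => by
    ext x; exact ((hd1 m x).mul (hdH x)).deriv
  have hop : ∀ m x, hermiteOp (fun x => χ (ε m * x) * herm n x) x =
      χ (ε m * x) * (-(n : ℝ) * herm n x) + 2 * (ε m * deriv χ (ε m * x)) * deriv (herm n) x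
        + (ε m * (ε m * deriv (deriv χ) (ε m * x)) - x * (ε m * deriv χ (ε m * x))) * herm n x :=
    fun m x => by
      have h2 : deriv (fun x => ε m * deriv χ (ε m * x) * herm n x
          + χ (ε m * x) * deriv (herm n) x) x = _ :=
        (((hd2 m x).mul (hdH x)).add ((hd1 m x).mul (hdH' x))).deriv
      rw [hermiteOp, hdu, h2, ← herm_ode]
      ring
  refine ⟨fun m x => χ (ε m * x) * herm n x, fun x => |herm n x| +
    (n * |herm n x| + 2 * C1 * |deriv (herm n) x| + (C2 + C1 * |x|) * |herm n x|),
    fun m => (hχ.comp (contDiff_const.mul contDiff_id)).mul hH, fun m => ?_, ?_, ?_, ?_, ?_, ?_⟩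
  · exact (hχs.comp_homeomorph (Homeomorph.mulLeft₀ (ε m) (hε0 m).ne')).mul_right
  · have h1 : ExpGrowth fun x => |herm n x| := (expGrowth_herm n).norm
    have h2 : ExpGrowth fun x => |deriv (herm n) x| := by
      rw [deriv_herm]; exact ((ExpGrowth.const _).mul (expGrowth_herm (n - 1))).norm
    have h3 : ExpGrowth fun x : ℝ => |x| := ExpGrowth.id.norm
    exact h1.add ((((ExpGrowth.const _).mul h1).add ((ExpGrowth.const _).mul h2)).add
      (((ExpGrowth.const _).add ((ExpGrowth.const _).mul h3)).mul h1))
  · have := hH.continuous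
    have := hH'.continuous
    fun_prop
  · intro m x
    rw [abs_mul]
    have h1 := mul_le_mul_of_nonneg_right (hχb (ε m * x)) (abs_nonneg (herm n x))
    have : 0 ≤ (n * |herm n x| + 2 * C1 * |deriv (herm n) x| + (C2 + C1 * |x|) * |herm n x|) := by
      positivity
    linarith
  · intro m x
    rw [hop]
    have hb1 : |ε m * deriv χ (ε m * x)| ≤ C1 := by
      rw [abs_mul, abs_of_pos (hε0 m)]
      calc _ ≤ 1 * C1 := mul_le_mul (hε1 m) (hC1 _) (abs_nonneg _) zero_le_one
        _ = C1 := one_mul _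
    have hb2 : |ε m * (ε m * deriv (deriv χ) (ε m * x))| ≤ C2 := by
      rw [abs_mul, abs_mul, abs_of_pos (hε0 m)]
      calc _ ≤ 1 * (1 * C2) := mul_le_mul (hε1 m) (mul_le_mul (hε1 m) (hC2 _) (abs_nonneg _)
            zero_le_one) (by have := hε0 m; positivity) zero_le_one
        _ = C2 := by ring
    have t1 : |χ (ε m * x) * (-(n : ℝ) * herm n x)| ≤ n * |herm n x| := by
      rw [abs_mul, abs_mul, abs_neg, Nat.abs_cast]
      calc _ ≤ 1 * (n * |herm n x|) := mul_le_mul_of_nonneg_right (hχb _) (by positivity)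
        _ = _ := one_mul _
    have t2 : |2 * (ε m * deriv χ (ε m * x)) * deriv (herm n) x|
        ≤ 2 * C1 * |deriv (herm n) x| := by
      rw [abs_mul, abs_mul, abs_two]; gcongr
    have t3 : |(ε m * (ε m * deriv (deriv χ) (ε m * x)) - x * (ε m * deriv χ (ε m * x))) *
        herm n x| ≤ (C2 + C1 * |x|) * |herm n x| := by
      rw [abs_mul]
      refine mul_le_mul_of_nonneg_right ?_ (abs_nonneg _)
      refine (abs_sub _ _).trans (add_le_add hb2 ?_)
      rw [abs_mul, mul_comm]; gcongr
    have := abs_nonneg (herm n x)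
    exact (abs_add_le _ _).trans ((add_le_add (abs_add_le _ _) le_rfl).trans (by linarith))
  · intro x
    filter_upwards [Filter.eventually_gt_atTop ⌈|x|⌉₊] with m hm
    have hx : |x| < m := (Nat.le_ceil _).trans_lt (by exact_mod_cast hm)
    -- Equality on a neighbourhood, not just at `x`, so that first and second derivatives agree as
    -- well.
    have hev : (fun x => χ (ε m * x) * herm n x) =ᶠ[nhds x] herm n := by
      have : ∀ᶠ y in nhds x, |y| < (m : ℝ) := ((continuous_abs (G := ℝ)).tendsto x).eventually_lt_const hx
      filter_upwards [this] with y hy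
      rw [hχ1, one_mul]
      rw [norm_mul, Real.norm_of_nonneg (hε0 m).le, Real.norm_eq_abs]
      simp only [ε]
      rw [one_div, inv_mul_le_iff₀ (by positivity)]
      linarith
    refine ⟨hev.eq_of_nhds, ?_⟩
    rw [hermiteOp, hermiteOp, hev.deriv.deriv.eq_of_nhds, hev.deriv.eq_of_nhds]

lemma abs_tensor_le {u B : Fin d → ℝ → ℝ} (h : ∀ j x, |u j x| ≤ B j x) (v : E d) :
    |tensor u v| ≤ tensor B v := by
  unfold tensor
  rw [Finset.abs_prod]
  exact Finset.prod_le_prod (fun j _ => abs_nonneg _) fun j _ => h j _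

/-- Approximation of a Hermite function by test functions, with the images by the adjoint of the
collision operator. -/
lemma exists_cutoff_hermiteFun (L : Collision) (k : Fin d → ℕ) :
    ∃ (g : ℕ → E d → ℝ) (B : E d → ℝ), (∀ m, ContDiff ℝ ∞ (g m)) ∧
    (∀ m, HasCompactSupport (g m)) ∧ ExpGrowth B ∧ Continuous B ∧ (∀ m v, |g m v| ≤ B v) ∧
    (∀ m v, |collisionAdjoint L (g m) v| ≤ B v) ∧
    (∀ v, Filter.Tendsto (fun m => g m v) Filter.atTop (nhds (hermiteFun k v))) ∧
    (∀ v, Filter.Tendsto (fun m => collisionAdjoint L (g m) v) Filter.atTop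
      (nhds (collisionAdjoint L (hermiteFun k) v))) := by
  choose u B hu hus hB hBc hub hop hlim using fun j => exists_cutoff_herm (k j)
  have hB0 : ∀ j x, 0 ≤ B j x := fun j x => (abs_nonneg _).trans (hub j 0 x)
  let g : ℕ → E d → ℝ := fun m => tensor fun j => u j m
  have hg : ∀ m, ContDiff ℝ ∞ (g m) := fun m => contDiff_tensor fun j => hu j m
  have hT : ∀ v : E d, 0 ≤ tensor B v := fun v => Finset.prod_nonneg fun j _ => hB0 j _
  have hTc : Continuous (tensor B) := continuous_tensor hBc
  have hTe : ExpGrowth (tensor B) := expGrowth_tensor hB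
  have hgb : ∀ m v, |g m v| ≤ tensor B v := fun m v => abs_tensor_le (fun j x => hub j m x) v
  have hev : ∀ v : E d, ∀ᶠ m in Filter.atTop, ∀ j, u j m (v j) = herm (k j) (v j) ∧
      hermiteOp (u j m) (v j) = hermiteOp (herm (k j)) (v j) := fun v =>
    Filter.eventually_all.2 fun j => hlim j (v j)
  have hglim : ∀ v, Filter.Tendsto (fun m => g m v) Filter.atTop (nhds (hermiteFun k v)) :=
    fun v => tendsto_nhds_of_eventually_eq <| (hev v).mono fun m hm =>
      Finset.prod_congr rfl fun j _ => (hm j).1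
  have hgs : ∀ m, HasCompactSupport (g m) := fun m => by
    have hc : IsCompact ((WithLp.toLp 2) '' (univ.pi fun j => tsupport (u j m)) : Set (E d)) :=
      (isCompact_univ_pi fun j => (hus j m).isCompact).image (PiLp.continuous_toLp 2 _)
    refine HasCompactSupport.intro hc fun v hv => ?_
    have : ∃ j, v j ∉ tsupport (u j m) := by
      by_contra! hall
      exact hv ⟨v.ofLp, fun j _ => hall j, rfl⟩
    obtain ⟨j, hj⟩ := this
    exact Finset.prod_eq_zero (Finset.mem_univ j) (image_eq_zero_of_notMem_tsupport hj)
  have hI : Integrable fun v : E d => maxwellian v * tensor B v :=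
    hTe.integrable_mul_maxwellian hTc.aestronglyMeasurable
  cases L with
  | fokkerPlanck =>
    refine ⟨g, fun v => tensor B v + d * tensor B v, hg, hgs,
      hTe.add ((ExpGrowth.const _).mul hTe), hTc.add (continuous_const.mul hTc), fun m v => ?_,
      fun m v => ?_, hglim, fun v => ?_⟩
    · have := hgb m v; have := hT v; nlinarith [(Nat.cast_nonneg d : (0 : ℝ) ≤ d)]
    · simp only [collisionAdjoint, g]
      rw [fokkerPlanckAdjoint_tensor fun j => hu j m]
      refine (Finset.abs_sum_le_sum_abs _ _).trans ?_
      have : ∀ j ∈ Finset.univ, |tensor (Function.update (fun j => u j m) j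
          fun x => deriv (deriv (u j m)) x - x * deriv (u j m) x) v| ≤ tensor B v := fun j _ => by
        refine abs_tensor_le (fun i x => ?_) v
        by_cases hi : i = j
        · subst hi; rw [Function.update_self]; exact hop i m x
        · rw [Function.update_of_ne hi]; exact hub i m x
      refine (Finset.sum_le_sum this).trans ?_
      have := hT v
      simp; linarith
    · simp only [collisionAdjoint, g]
      refine tendsto_nhds_of_eventually_eq <| (hev v).mono fun m hm => ?_
      rw [fokkerPlanckAdjoint_tensor fun j => hu j m, hermiteFun,
        fokkerPlanckAdjoint_tensor fun j => contDiff_herm _]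
      refine Finset.sum_congr rfl fun j _ => ?_
      rw [tensor_update, tensor_update]
      congr 1
      · exact (hm j).2
      · exact Finset.prod_congr rfl fun i _ => (hm i).1
  | bgk =>
    refine ⟨g, fun v => (∫ w : E d, maxwellian w * tensor B w) + tensor B v, hg, hgs,
      (ExpGrowth.const _).add hTe, continuous_const.add hTc, fun m v => ?_,
      fun m v => ?_, hglim, fun v => ?_⟩
    · have : 0 ≤ ∫ w : E d, maxwellian w * tensor B w :=
        integral_nonneg fun w => mul_nonneg (maxwellian_pos w).le (hT w)
      linarith [hgb m v]
    · simp only [collisionAdjoint]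
      refine (abs_sub _ _).trans (add_le_add ?_ (hgb m v))
      rw [← Real.norm_eq_abs]
      refine norm_integral_le_of_norm_le hI (Filter.Eventually.of_forall fun w => ?_)
      rw [norm_mul, Real.norm_of_nonneg (maxwellian_pos w).le]
      exact mul_le_mul_of_nonneg_left (hgb m w) (maxwellian_pos w).le
    · simp only [collisionAdjoint]
      refine Filter.Tendsto.sub ?_ (hglim v)
      refine tendsto_integral_of_dominated_convergence _ (fun m => ?_) hI (fun m => ?_) ?_
      · exact Continuous.aestronglyMeasurable (continuous_maxwellian.mul (hg m).continuous)
      · refine Filter.Eventually.of_forall fun w => ?_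
        rw [norm_mul, Real.norm_of_nonneg (maxwellian_pos w).le]
        exact mul_le_mul_of_nonneg_left (hgb m w) (maxwellian_pos w).le
      · exact Filter.Eventually.of_forall fun w => (hglim w).const_mul _

lemma tendsto_integral_mul {F : E d × E d → ℝ} (hF : MemLp F 2 (phaseMeasure d)) {ψ : E d → ℝ}
    (hψ : MemLp ψ 2) {q : ℕ → E d → ℝ} {q' B : E d → ℝ} (hB : ExpGrowth B) (hBc : Continuous B)
    (hq : ∀ m, Continuous (q m)) (hb : ∀ m v, |q m v| ≤ B v)
    (hl : ∀ v, Filter.Tendsto (fun m => q m v) Filter.atTop (nhds (q' v))) :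
    Filter.Tendsto (fun m => ∫ z : E d × E d, F z * (ψ z.1 * q m z.2)) Filter.atTop
      (nhds (∫ z : E d × E d, F z * (ψ z.1 * q' z.2))) := by
  have hq' : ∀ m, ExpGrowth (q m) := fun m => hB.mono fun v => (hb m v).trans (le_abs_self _)
  refine tendsto_integral_of_dominated_convergence (fun z => ‖F z * (ψ z.1 * B z.2)‖)
    (fun m => (integrable_mul_of_growth hF hψ (hq' m) (hq m)).aestronglyMeasurable)
    (integrable_mul_of_growth hF hψ hB hBc).norm
    (fun m => Filter.Eventually.of_forall fun z => ?_) (Filter.Eventually.of_forall fun z => ?_)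
  · rw [norm_mul, norm_mul, norm_mul, norm_mul]
    gcongr
    exact (hb m _).trans (le_abs_self _)
  · exact ((hl _).const_mul _).const_mul _

/-- Hermite functions are not compactly supported, hence not test functions. They are reached by
dominated convergence along cut-offs in the velocity. -/
lemma IsWeakDerivative.integral_hermiteFun {L : Collision} {P F : E d × E d → ℝ}
    (h : IsWeakDerivative L P F) (hP : MemLp P 2 (phaseMeasure d)) (hF : MemLp F 2 (phaseMeasure d))
    {ψ : E d → ℝ} (hψ : ContDiff ℝ ∞ ψ) (hψs : HasCompactSupport ψ) (k : Fin d → ℕ) :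
    ∫ z : E d × E d, P z * (ψ z.1 * hermiteFun k z.2)
      = ∑ j, (∫ z : E d × E d, F z * (partialDeriv j ψ z.1 * (z.2 j * hermiteFun k z.2)))
        + ∫ z : E d × E d, F z * (ψ z.1 * collisionAdjoint L (hermiteFun k) z.2) := by
  obtain ⟨g, B, hg, hgs, hB, hBc, hgb, hLb, hgl, hLl⟩ := exists_cutoff_hermiteFun L k
  have hψ2 := memLp_of_contDiff hψ hψs
  have hψj := fun j =>
    memLp_of_contDiff (contDiff_partialDeriv hψ j) (hasCompactSupport_partialDeriv hψs j)
  have hcj : ∀ j, Continuous fun v : E d => v j := fun j => by fun_prop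
  have h1 := tendsto_integral_mul hP hψ2 hB hBc (fun m => (hg m).continuous) hgb hgl
  have h2 := tendsto_integral_mul hF hψ2 hB hBc (fun m => continuous_collisionAdjoint L (hg m))
    hLb hLl
  have h3 := fun j => tendsto_integral_mul hF (hψj j) (q := fun m v => v j * g m v)
    ((expGrowth_coord j).norm.mul hB) ((hcj j).norm.mul hBc) (fun m => (hcj j).mul (hg m).continuous)
    (fun m v => by
      rw [abs_mul]; exact mul_le_mul_of_nonneg_left (hgb m v) (abs_nonneg _))
    (fun v => (hgl v).const_mul _)
  have h4 := (tendsto_finsetSum Finset.univ fun j _ => h3 j).add h2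
  refine tendsto_nhds_unique h1 (h4.congr fun m => ?_)
  exact (h.integral_tensor hF hψ hψs (hg m) (hgs m)).symm

/-- The equation satisfied by the Hermite coefficients, tested against a test function. -/
lemma IsWeakDerivative.integral_coeff {L : Collision} {P F : Lp ℝ 2 (phaseMeasure d)}
    (h : IsWeakDerivative L P F) {ψ : E d → ℝ} (hψ : ContDiff ℝ ∞ ψ) (hψs : HasCompactSupport ψ)
    (k : Fin d → ℕ) :
    ∫ x, coeff k P x * ψ x = ∑ j, (√((k j : ℝ) + 1) * ∫ x, coeff (up k j) F x * partialDeriv j ψ x)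
      + ∑ j, (√(k j : ℝ) * ∫ x, coeff (down k j) F x * partialDeriv j ψ x)
      - rate L k * ∫ x, coeff k F x * ψ x := by
  have hψ2 := memLp_of_contDiff hψ hψs
  have hψj := fun j =>
    memLp_of_contDiff (contDiff_partialDeriv hψ j) (hasCompactSupport_partialDeriv hψs j)
  rw [integral_coeff_mul k P hψ2, integral_coeff_mul k F hψ2,
    h.integral_hermiteFun (Lp.memLp P) (Lp.memLp F) hψ hψs, ← Finset.sum_add_distrib, sub_eq_add_neg]
  have hi := fun (k : Fin d → ℕ) j => integrable_mul_of_growth (Lp.memLp F) (hψj j)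
    (expGrowth_hermiteFun k) (continuous_hermiteFun k)
  congr 1
  · refine Finset.sum_congr rfl fun j _ => ?_
    rw [integral_coeff_mul _ F (hψj j), integral_coeff_mul _ F (hψj j), ← integral_const_mul,
      ← integral_const_mul, ← integral_add ((hi _ j).const_mul _) ((hi _ j).const_mul _)]
    congr 1; ext z
    rw [coord_mul_hermiteFun]; ring
  · rw [← neg_mul, ← integral_const_mul]
    congr 1; ext z
    rw [collisionAdjoint_hermiteFun]; ring

end weak

/-! ### The equation in Fourier variables -/

section fourier
variable {d : ℕ}

/-- `p = -∑ ∂ⱼ qⱼ + r` in the sense of distributions. -/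
def IsWeakDivergence (p : E d → ℝ) (q : Fin d → E d → ℝ) (r : E d → ℝ) : Prop :=
  ∀ ψ : E d → ℝ, ContDiff ℝ ∞ ψ → HasCompactSupport ψ →
    ∫ x, p x * ψ x = ∑ j, (∫ x, q j x * partialDeriv j ψ x) + ∫ x, r x * ψ x

/-- A cut-off in `x` extends the identity to smooth `ψ` that are square integrable with their first
derivatives. This is needed because inverse transforms of compactly supported functions are Schwartz
but not compactly supported. -/
lemma IsWeakDivergence.of_memLp {p : E d → ℝ} {q : Fin d → E d → ℝ} {r : E d → ℝ}
    (h : IsWeakDivergence p q r) (hp : MemLp p 2) (hq : ∀ j, MemLp (q j) 2) (hr : MemLp r 2)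
    {ψ : E d → ℝ} (hψ : ContDiff ℝ ∞ ψ) (hψ2 : MemLp ψ 2) (hψj : ∀ j, MemLp (partialDeriv j ψ) 2) :
    ∫ x, p x * ψ x = ∑ j, (∫ x, q j x * partialDeriv j ψ x) + ∫ x, r x * ψ x := by
  obtain ⟨χ, hχ, hχs, hχ1, hχb⟩ := exists_cutoff (E d)
  let ε : ℕ → ℝ := fun m => 1 / ((m : ℝ) + 1)
  have hε0 : ∀ m, 0 < ε m := fun m => by positivity
  have hε1 : ∀ m, ε m ≤ 1 := fun m => by
    simp only [ε]; rw [div_le_one (by positivity)]; linarith [(Nat.cast_nonneg m : (0 : ℝ) ≤ m)]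
  let φ : ℕ → E d → ℝ := fun m x => χ (ε m • x) * ψ x
  have hχm : ∀ m, ContDiff ℝ ∞ fun x => χ (ε m • x) := fun m =>
    hχ.comp (contDiff_const_smul (ε m))
  have hφ : ∀ m, ContDiff ℝ ∞ (φ m) := fun m => (hχm m).mul hψ
  have hφs : ∀ m, HasCompactSupport (φ m) := fun m =>
    (hχs.comp_homeomorph (Homeomorph.smulOfNeZero (ε m) (hε0 m).ne')).mul_right
  have hφb : ∀ m x, |φ m x| ≤ |ψ x| := fun m x => by
    simp only [φ]
    rw [abs_mul]
    exact mul_le_of_le_one_left (abs_nonneg _) (hχb _)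
  choose C hC using fun j => (hasCompactSupport_partialDeriv hχs j).exists_bound_of_continuous
    (contDiff_partialDeriv hχ j).continuous
  have hdχ : ∀ m j x, partialDeriv j (fun x => χ (ε m • x)) x = ε m * partialDeriv j χ (ε m • x) :=
    fun m j x => by
      have h1 : HasFDerivAt χ (fderiv ℝ χ (ε m • x)) (ε m • x) :=
        (hχ.differentiable (by simp)).differentiableAt.hasFDerivAt
      have h2 := h1.comp x ((hasFDerivAt_id x).const_smul (ε m))
      have h3 : HasFDerivAt (fun x => χ (ε m • x)) _ x := h2
      simp [partialDeriv, h3.fderiv]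
  have hdb : ∀ m j x, |partialDeriv j (φ m) x| ≤ C j * |ψ x| + |partialDeriv j ψ x| :=
    fun m j x => by
      simp only [φ]
      rw [partialDeriv_mul ((hχm m).differentiable (by simp)) (hψ.differentiable (by simp)), hdχ]
      refine (abs_add_le _ _).trans (add_le_add ?_ ?_)
      · rw [abs_mul, abs_mul, abs_of_pos (hε0 m)]
        refine mul_le_mul_of_nonneg_right ?_ (abs_nonneg _)
        calc _ ≤ 1 * C j := mul_le_mul (hε1 m) (hC j _) (abs_nonneg _) zero_le_one
          _ = C j := one_mul _
      · rw [abs_mul]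
        exact mul_le_of_le_one_left (abs_nonneg _) (hχb _)
  have hev : ∀ x, ∀ᶠ m in Filter.atTop, φ m =ᶠ[nhds x] ψ := fun x => by
    filter_upwards [Filter.eventually_gt_atTop ⌈‖x‖⌉₊] with m hm
    have hx : ‖x‖ < m := (Nat.le_ceil _).trans_lt (by exact_mod_cast hm)
    have : ∀ᶠ y in nhds x, ‖y‖ < (m : ℝ) := (continuous_norm.tendsto x).eventually_lt_const hx
    filter_upwards [this] with y hy
    simp only [φ]
    rw [hχ1, one_mul]
    rw [norm_smul, Real.norm_of_nonneg (hε0 m).le]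
    simp only [ε]
    rw [one_div, inv_mul_le_iff₀ (by positivity)]
    linarith
  have lim1 : ∀ u : E d → ℝ, MemLp u 2 → Filter.Tendsto (fun m => ∫ x, u x * φ m x) Filter.atTop
      (nhds (∫ x, u x * ψ x)) := fun u hu => by
    refine tendsto_integral_of_dominated_convergence (fun x => ‖u x * ψ x‖)
      (fun m => hu.1.mul (hφ m).continuous.aestronglyMeasurable) (hu.integrable_mul hψ2).norm
      (fun m => Filter.Eventually.of_forall fun x => ?_) (Filter.Eventually.of_forall fun x => ?_)
    · rw [norm_mul (u x) (φ m x), norm_mul (u x) (ψ x)]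
      exact mul_le_mul_of_nonneg_left (hφb m x) (norm_nonneg (u x))
    · exact tendsto_nhds_of_eventually_eq ((hev x).mono fun m hm => by rw [hm.eq_of_nhds])
  have lim2 : ∀ j, Filter.Tendsto (fun m => ∫ x, q j x * partialDeriv j (φ m) x) Filter.atTop
      (nhds (∫ x, q j x * partialDeriv j ψ x)) := fun j => by
    refine tendsto_integral_of_dominated_convergence
      (fun x => ‖q j x * (C j * |ψ x| + |partialDeriv j ψ x|)‖)
      (fun m => (hq j).1.mul (contDiff_partialDeriv (hφ m) j).continuous.aestronglyMeasurable)
      ((hq j).integrable_mul ((hψ2.norm.const_mul (C j)).add (hψj j).norm)).norm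
      (fun m => Filter.Eventually.of_forall fun x => ?_) (Filter.Eventually.of_forall fun x => ?_)
    · rw [norm_mul, norm_mul]
      exact mul_le_mul_of_nonneg_left ((hdb m j x).trans (le_abs_self _)) (norm_nonneg _)
    · exact tendsto_nhds_of_eventually_eq ((hev x).mono fun m hm => by
        unfold partialDeriv; rw [hm.fderiv_eq])
  refine tendsto_nhds_unique (lim1 p hp)
    (((tendsto_finsetSum Finset.univ fun j _ => lim2 j).add (lim1 r hr)).congr fun m => ?_)
  exact (h (φ m) (hφ m) (hφs m)).symm

open LineDeriv in
lemma IsWeakDivergence.schwartz {p : E d → ℝ} {q : Fin d → E d → ℝ} {r : E d → ℝ}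
    (h : IsWeakDivergence p q r) (hp : MemLp p 2) (hq : ∀ j, MemLp (q j) 2) (hr : MemLp r 2)
    (Φ : SchwartzMap (E d) ℂ) :
    ∫ x, (p x : ℂ) * Φ x
      = ∑ j, (∫ x, (q j x : ℂ) * (∂_{(EuclideanSpace.single j (1 : ℝ) : E d)} Φ) x)
        + ∫ x, (r x : ℂ) * Φ x := by
  have hd : ∀ j x, (∂_{(EuclideanSpace.single j (1 : ℝ) : E d)} Φ) x = partialDeriv j Φ x :=
    fun j x => SchwartzMap.lineDerivOp_apply_eq_fderiv _ _ _
  have split : ∀ (u : E d → ℝ) (G : SchwartzMap (E d) ℂ), MemLp u 2 →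
      ∫ x, (u x : ℂ) * G x = ((∫ x, u x * (G x).re : ℝ) : ℂ) +
        ((∫ x, u x * (G x).im : ℝ) : ℂ) * Complex.I := fun u G hu => by
    have hi : Integrable fun x => (u x : ℂ) * G x :=
      hu.ofReal.integrable_mul (G.memLp 2)
    rw [← integral_re_add_im hi]
    simp
  have hre : ∀ j x, partialDeriv j (fun x => (Φ x).re) x
      = ((∂_{(EuclideanSpace.single j (1 : ℝ) : E d)} Φ) x).re := fun j x => by
    have := Complex.reCLM.hasFDerivAt.comp x (Φ.hasFDerivAt x)
    have h2 : HasFDerivAt (fun x => (Φ x).re) _ x := this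
    rw [hd, partialDeriv, h2.fderiv]; rfl
  have him : ∀ j x, partialDeriv j (fun x => (Φ x).im) x
      = ((∂_{(EuclideanSpace.single j (1 : ℝ) : E d)} Φ) x).im := fun j x => by
    have := Complex.imCLM.hasFDerivAt.comp x (Φ.hasFDerivAt x)
    have h2 : HasFDerivAt (fun x => (Φ x).im) _ x := this
    rw [hd, partialDeriv, h2.fderiv]; rfl
  have h1 := h.of_memLp hp hq hr (ψ := fun x => (Φ x).re)
    (Complex.reCLM.contDiff.comp (Φ.smooth ⊤)) (Φ.memLp 2).re
    fun j => by rw [funext (hre j)]; exact (SchwartzMap.memLp (∂_{(EuclideanSpace.single j (1 : ℝ) : E d)} Φ) 2 volume).re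
  have h2 := h.of_memLp hp hq hr (ψ := fun x => (Φ x).im)
    (Complex.imCLM.contDiff.comp (Φ.smooth ⊤)) (Φ.memLp 2).im
    fun j => by rw [funext (him j)]; exact (SchwartzMap.memLp (∂_{(EuclideanSpace.single j (1 : ℝ) : E d)} Φ) 2 volume).im
  simp_rw [hre] at h1
  simp_rw [him] at h2
  rw [split p Φ hp, split r Φ hr, h1, h2, Finset.sum_congr rfl fun j _ => split (q j) _ (hq j),
    Finset.sum_add_distrib, ← Finset.sum_mul]
  push_cast
  ring

/-- The Fourier transform of a real function of `L²`. -/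
def fourierReal : Lp ℝ 2 (volume : Measure (E d)) →L[ℝ] Lp ℂ 2 (volume : Measure (E d)) :=
  ((Lp.fourierTransformₗᵢ (E d) ℂ).toContinuousLinearEquiv.toContinuousLinearMap.restrictScalars ℝ).comp
    (Complex.ofRealCLM.compLpL 2 volume)

lemma norm_fourierReal (c : Lp ℝ 2 (volume : Measure (E d))) : ‖fourierReal c‖ = ‖c‖ := by
  have h1 : ‖fourierReal c‖ = ‖Complex.ofRealCLM.compLpL 2 volume c‖ :=
    (Lp.fourierTransformₗᵢ (E d) ℂ).norm_map _
  rw [h1, Lp.norm_def, Lp.norm_def]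
  congr 1
  refine eLpNorm_congr_norm_ae ?_
  filter_upwards [Complex.ofRealCLM.coeFn_compLpL c] with x hx
  rw [hx]; simp

open FourierTransform in
lemma integral_conj_fourier_mul_fourierReal (Φ : SchwartzMap (E d) ℂ)
    (c : Lp ℝ 2 (volume : Measure (E d))) :
    ∫ ζ, (starRingEnd ℂ) (𝓕 Φ ζ) * fourierReal c ζ
      = (starRingEnd ℂ) (∫ x, (c x : ℂ) * Φ x) := by
  have h := Lp.inner_fourier_eq (Φ.toLp 2) (Complex.ofRealCLM.compLpL 2 volume c)
  rw [SchwartzMap.toLp_fourier_eq, L2.inner_def, L2.inner_def] at h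
  rw [← integral_conj]
  calc _ = ∫ ζ, inner ℂ ((𝓕 Φ).toLp 2 volume ζ) (fourierReal c ζ) := by
        refine integral_congr_ae ?_
        filter_upwards [(𝓕 Φ).coeFn_toLp 2 volume] with ζ hζ
        rw [hζ]; simp [mul_comm]
    _ = _ := h
    _ = _ := by
        refine integral_congr_ae ?_
        filter_upwards [Φ.coeFn_toLp 2 volume, Complex.ofRealCLM.coeFn_compLpL c] with x h1 h2
        rw [h1, h2]; simp

open FourierTransform LineDeriv in
-- Testing with `Φ` whose transform is an arbitrary test function `g` in frequency turns derivatives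
-- into multiplication and identifies both sides almost everywhere. The symbol is unbounded, so the
-- comparison is made between locally integrable functions.
lemma IsWeakDivergence.fourier {p r : Lp ℝ 2 (volume : Measure (E d))}
    {q : Fin d → Lp ℝ 2 (volume : Measure (E d))}
    (h : IsWeakDivergence p (fun j => q j) r) :
    ∀ᵐ ζ, fourierReal p ζ
      = -Complex.I * ∑ j, ((2 * Real.pi * ζ j : ℝ) : ℂ) * fourierReal (q j) ζ + fourierReal r ζ := by
  have hloc : ∀ c : Lp ℝ 2 (volume : Measure (E d)), LocallyIntegrable (fourierReal c) :=
    fun c => (Lp.memLp _).locallyIntegrable (by norm_num)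
  have hlocj : ∀ j, LocallyIntegrable fun ζ : E d =>
      ((2 * Real.pi * ζ j : ℝ) : ℂ) * fourierReal (q j) ζ := fun j => by
    have := (locallyIntegrableOn_univ.2 (hloc (q j))).continuousOn_mul (R := ℂ)
      (g := fun ζ : E d => ((2 * Real.pi * ζ j : ℝ) : ℂ)) (by fun_prop) isOpen_univ.isLocallyClosed
    exact locallyIntegrableOn_univ.1 this
  have hsum : LocallyIntegrable fun ζ : E d => -Complex.I *
      ∑ j, ((2 * Real.pi * ζ j : ℝ) : ℂ) * fourierReal (q j) ζ := by
    have h1 := locallyIntegrable_finsetSum Finset.univ fun j _ => hlocj j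
    exact h1.smul (-Complex.I)
  refine ae_eq_of_integral_contDiff_smul_eq (hloc p) (hsum.add (hloc r)) fun g hg hs => ?_
  have hgc : ContDiff ℝ ∞ (fun x => (g x : ℂ)) := Complex.ofRealCLM.contDiff.comp hg
  have hsc : HasCompactSupport (fun x => (g x : ℂ)) := hs.comp_left (g := Complex.ofReal) (by simp)
  set Φ : SchwartzMap (E d) ℂ := 𝓕⁻ (hsc.toSchwartzMap hgc) with hΦ
  have hFΦ : ∀ ζ, 𝓕 Φ ζ = (g ζ : ℂ) := fun ζ => by
    rw [hΦ, FourierTransform.fourier_fourierInv_eq]; rfl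
  have hFd : ∀ j ζ, 𝓕 (∂_{(EuclideanSpace.single j (1 : ℝ) : E d)} Φ) ζ
      = 2 * Real.pi * Complex.I * ((ζ j : ℝ) : ℂ) * (g ζ : ℂ) := fun j ζ => by
    have ht : (fun x : E d => (inner ℝ x (EuclideanSpace.single j (1 : ℝ)) : ℝ)).HasTemperateGrowth :=
      ((innerSL ℝ).flip (EuclideanSpace.single j (1 : ℝ))).hasTemperateGrowth
    rw [SchwartzMap.fourier_lineDerivOp_eq, smul_apply,
      SchwartzMap.smulLeftCLM_apply_apply ht, hFΦ]
    simp [EuclideanSpace.inner_single_right]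
    ring
  have key := h.schwartz (Lp.memLp p) (fun j => Lp.memLp (q j)) (Lp.memLp r) Φ
  apply_fun (starRingEnd ℂ) at key
  rw [map_add, map_sum, ← integral_conj_fourier_mul_fourierReal,
    ← integral_conj_fourier_mul_fourierReal] at key
  simp_rw [← integral_conj_fourier_mul_fourierReal, hFΦ, hFd, Complex.conj_ofReal] at key
  have hgi : ∀ {u : E d → ℂ}, LocallyIntegrable u → Integrable fun ζ => g ζ • u ζ := fun hu =>
    hu.integrable_smul_left_of_hasCompactSupport hg.continuous hs
  have e1 : ∀ ζ, g ζ • fourierReal p ζ = (g ζ : ℂ) * fourierReal p ζ := fun ζ => by simp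
  simp_rw [smul_add]
  rw [integral_add (hgi hsum) (hgi (hloc r))]
  simp only [Complex.real_smul]
  rw [key]
  congr 1
  rw [← integral_finsetSum]
  · congr 1; ext ζ
    rw [Finset.mul_sum, Finset.mul_sum]
    refine Finset.sum_congr rfl fun j _ => ?_
    simp only [map_mul, Complex.conj_ofReal, Complex.conj_I, map_ofNat]
    push_cast; ring
  · intro j _
    refine ((hgi (hlocj j)).const_mul (-Complex.I)).congr (Filter.Eventually.of_forall fun ζ => ?_)
    simp only [map_mul, Complex.conj_ofReal, Complex.conj_I, map_ofNat, Complex.real_smul]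
    push_cast; ring

/-- The Fourier transform in `x` of the Hermite coefficient of index `k`. -/
def mode (k : Fin d → ℕ) : Lp ℝ 2 (phaseMeasure d) →L[ℝ] Lp ℂ 2 (volume : Measure (E d)) :=
  fourierReal.comp (coeff k)

lemma hasSum_norm_mode_sq (F : Lp ℝ 2 (phaseMeasure d)) :
    HasSum (fun k : Fin d → ℕ => ‖mode k F‖ ^ 2) (‖F‖ ^ 2) := by
  simpa only [mode, ContinuousLinearMap.comp_apply, norm_fourierReal] using hasSum_norm_coeff_sq F

/-- The equation satisfied by the modes: a tridiagonal system for almost every frequency. -/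
lemma IsWeakDerivative.mode {L : Collision} {P F : Lp ℝ 2 (phaseMeasure d)}
    (h : IsWeakDerivative L P F) (k : Fin d → ℕ) :
    ∀ᵐ ζ, mode k P ζ = -Complex.I * ladder ((2 * Real.pi) • ζ) (fun l => mode l F ζ) k
      - rate L k * mode k F ζ := by
  let q : Fin d → Lp ℝ 2 (volume : Measure (E d)) := fun j =>
    √((k j : ℝ) + 1) • coeff (up k j) F + √(k j : ℝ) • coeff (down k j) F
  let r : Lp ℝ 2 (volume : Measure (E d)) := (-rate L k) • coeff k F
  have hdiv : IsWeakDivergence (coeff k P) (fun j => q j) r := fun ψ hψ hs => by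
    have hψ2 := memLp_of_contDiff hψ hs
    have hψj := fun j =>
      memLp_of_contDiff (contDiff_partialDeriv hψ j) (hasCompactSupport_partialDeriv hs j)
    rw [h.integral_coeff hψ hs, sub_eq_add_neg, ← neg_mul, ← Finset.sum_add_distrib,
      ← integral_const_mul]
    congr 1
    · refine Finset.sum_congr rfl fun j _ => ?_
      rw [← integral_const_mul, ← integral_const_mul, ← integral_add]
      · refine integral_congr_ae ?_
        filter_upwards [Lp.coeFn_add (√((k j : ℝ) + 1) • coeff (up k j) F)
          (√(k j : ℝ) • coeff (down k j) F), Lp.coeFn_smul (√((k j : ℝ) + 1)) (coeff (up k j) F),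
          Lp.coeFn_smul (√(k j : ℝ)) (coeff (down k j) F)] with x h1 h2 h3
        simp only [q]
        rw [h1, Pi.add_apply, h2, h3]; simp only [Pi.smul_apply, smul_eq_mul]; ring
      · exact ((Lp.memLp _).integrable_mul (hψj j)).const_mul _
      · exact ((Lp.memLp _).integrable_mul (hψj j)).const_mul _
    · refine integral_congr_ae ?_
      filter_upwards [Lp.coeFn_smul (-rate L k) (coeff k F)] with x h1
      simp only [r]
      rw [h1]; simp only [Pi.smul_apply, smul_eq_mul]; ring
  have hq : ∀ j, ∀ᵐ ζ, fourierReal (q j) ζ = (√((k j : ℝ) + 1) : ℂ) * Kinetic.mode (up k j) F ζ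
      + (√(k j : ℝ) : ℂ) * Kinetic.mode (down k j) F ζ := fun j => by
    simp only [q, map_add, map_smul]
    filter_upwards [Lp.coeFn_add (√((k j : ℝ) + 1) • fourierReal (coeff (up k j) F))
          (√(k j : ℝ) • fourierReal (coeff (down k j) F)),
          Lp.coeFn_smul (√((k j : ℝ) + 1)) (fourierReal (coeff (up k j) F)),
          Lp.coeFn_smul (√(k j : ℝ)) (fourierReal (coeff (down k j) F))] with x h1 h2 h3
    rw [h1, Pi.add_apply, h2, h3]; simp [Kinetic.mode]
  have hr : ∀ᵐ ζ, fourierReal r ζ = -(rate L k : ℂ) * Kinetic.mode k F ζ := by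
    simp only [r, map_smul]
    filter_upwards [Lp.coeFn_smul (-rate L k) (fourierReal (coeff k F))] with x h1
    rw [h1]; simp [Kinetic.mode]
  filter_upwards [hdiv.fourier, ae_all_iff.2 hq, hr] with ζ h1 h2 h3
  rw [show Kinetic.mode k P = fourierReal (coeff k P) from rfl, h1, h3, ladder]
  simp_rw [h2]
  simp only [PiLp.smul_apply, smul_eq_mul]
  ring

end fourier

/-! ### The truncated system of modes at a given frequency -/

section truncated
variable {d : ℕ}

/-- The multi-indices with all entries at most `N`. -/
def box (d N : ℕ) : Finset (Fin d → ℕ) := Fintype.piFinset fun _ => Finset.range (N + 1)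

lemma mem_box {N : ℕ} {k : Fin d → ℕ} : k ∈ box d N ↔ ∀ j, k j ≤ N := by
  simp [box]

lemma box_mono {N N' : ℕ} (h : N ≤ N') : box d N ⊆ box d N' := fun _ hk =>
  mem_box.2 fun j => (mem_box.1 hk j).trans h

/-- The face `kⱼ = N` of the box. -/
def face (N : ℕ) (j : Fin d) : Finset (Fin d → ℕ) := (box d N).filter fun k => k j = N

lemma down_up (k : Fin d → ℕ) (j : Fin d) : down (up k j) j = k := by
  simp [down, up]

lemma up_down {k : Fin d → ℕ} {j : Fin d} (h : k j ≠ 0) : up (down k j) j = k := by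
  simp [down, up, Nat.sub_add_cancel (Nat.one_le_iff_ne_zero.2 h)]

lemma up_injective (j : Fin d) : Function.Injective fun k : Fin d → ℕ => up k j :=
  Function.LeftInverse.injective (g := fun k => down k j) fun k => down_up k j

lemma up_mem_box {N : ℕ} {k : Fin d → ℕ} {j : Fin d} :
    up k j ∈ box d N ↔ k ∈ box d N ∧ k j < N := by
  simp only [mem_box, up]
  constructor
  · intro h
    have hj : k j < N := by have := h j; simp at this; omega
    refine ⟨fun i => ?_, hj⟩
    by_cases hi : i = j
    · subst hi; exact hj.le
    · simpa [hi] using h i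
  · rintro ⟨h, hj⟩ i
    by_cases hi : i = j
    · subst hi; simp; omega
    · simpa [hi] using h i

/-- The change of index `k = l + e_j`. Terms with `k j = 0` vanish through `√0`, and the upper limit
`k j ≤ N` becomes `l j < N`. -/
lemma sum_box_down (N : ℕ) (j : Fin d) (g : (Fin d → ℕ) → (Fin d → ℕ) → ℂ) :
    ∑ k ∈ box d N, (√(k j : ℝ) : ℂ) * g k (down k j)
      = ∑ k ∈ (box d N).filter (fun k => k j < N), (√((k j : ℝ) + 1) : ℂ) * g (up k j) k := by
  have h0 : ∑ k ∈ box d N, (√(k j : ℝ) : ℂ) * g k (down k j)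
      = ∑ k ∈ (box d N).filter (fun k => k j ≠ 0), (√(k j : ℝ) : ℂ) * g k (down k j) := by
    rw [Finset.sum_filter_of_ne]
    intro k _ hk h
    exact hk (by simp [h])
  rw [h0]
  symm
  refine Finset.sum_nbij' (fun k => up k j) (fun k => down k j) ?_ ?_ ?_ ?_ ?_
  · intro k hk
    rw [Finset.mem_filter] at hk ⊢
    exact ⟨up_mem_box.2 hk, by simp [up]⟩
  · intro k hk
    rw [Finset.mem_filter] at hk ⊢
    have := hk.1
    rw [← up_down hk.2, up_mem_box] at this
    exact this
  · intro k _; exact down_up k j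
  · intro k hk; exact up_down (Finset.mem_filter.1 hk).2
  · intro k _
    rw [down_up]; simp [up]

/-- The transport operator is skew-symmetric, up to the contribution of the faces of the box. -/
lemma re_sum_ladder_le (N : ℕ) (ξ : E d) (z : (Fin d → ℕ) → ℂ) :
    (∑ k ∈ box d N, (starRingEnd ℂ) (z k) * (-Complex.I * ladder ξ z k)).re
      ≤ ‖ξ‖ * (√((N : ℝ) + 1) * ∑ j, ∑ k ∈ face N j, ‖z k‖ * ‖z (up k j)‖) := by
  have e1 : ∑ k ∈ box d N, (starRingEnd ℂ) (z k) * (-Complex.I * ladder ξ z k)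
      = ∑ j, (ξ j : ℂ) * (-Complex.I *
        (∑ k ∈ box d N, (√((k j : ℝ) + 1) : ℂ) * ((starRingEnd ℂ) (z k) * z (up k j)) +
        ∑ k ∈ box d N, (√(k j : ℝ) : ℂ) * ((starRingEnd ℂ) (z k) * z (down k j)))) := by
    simp only [ladder, Finset.mul_sum, ← Finset.sum_add_distrib]
    rw [Finset.sum_comm]
    refine Finset.sum_congr rfl fun j _ => Finset.sum_congr rfl fun k _ => ?_
    ring
  rw [e1, Complex.re_sum, Finset.mul_sum, Finset.mul_sum]
  refine Finset.sum_le_sum fun j _ => ?_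
  have e2 : ∑ k ∈ box d N, (√((k j : ℝ) + 1) : ℂ) * ((starRingEnd ℂ) (z k) * z (up k j)) =
      ∑ k ∈ (box d N).filter (fun k => k j < N),
        (√((k j : ℝ) + 1) : ℂ) * ((starRingEnd ℂ) (z k) * z (up k j)) +
      (√((N : ℝ) + 1) : ℂ) * ∑ k ∈ face N j, (starRingEnd ℂ) (z k) * z (up k j) := by
    rw [← Finset.sum_filter_add_sum_filter_not (box d N) (fun k => k j < N), Finset.mul_sum]
    congr 1
    have : (box d N).filter (fun k => ¬ k j < N) = face N j := by
      ext k
      simp only [face, Finset.mem_filter, and_congr_right_iff, not_lt]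
      intro hk
      have := mem_box.1 hk j
      omega
    rw [this]
    refine Finset.sum_congr rfl fun k hk => ?_
    rw [(Finset.mem_filter.1 hk).2]
  rw [e2, sum_box_down N j fun k l => (starRingEnd ℂ) (z k) * z l]
  set A := ∑ k ∈ (box d N).filter (fun k => k j < N),
        (√((k j : ℝ) + 1) : ℂ) * ((starRingEnd ℂ) (z k) * z (up k j)) with hA
  set B := ∑ k ∈ (box d N).filter (fun k => k j < N),
        (√((k j : ℝ) + 1) : ℂ) * ((starRingEnd ℂ) (z (up k j)) * z k) with hB
  set G := ∑ k ∈ face N j, (starRingEnd ℂ) (z k) * z (up k j) with hG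
  -- `A` and `B` are conjugate term by term, so multiplication by `-i` leaves no real part. Only the
  -- uncompensated terms with `k j = N` remain, with weight `√(N+1)`.
  have hAB : (A + B).im = 0 := by
    rw [hA, hB, ← Finset.sum_add_distrib, Complex.im_sum]
    refine Finset.sum_eq_zero fun k _ => ?_
    simp [Complex.mul_im]; ring
  have hre : ((ξ j : ℂ) * (-Complex.I * (A + (√((N : ℝ) + 1) : ℂ) * G + B))).re
      = ξ j * (√((N : ℝ) + 1) * G.im) := by
    have : A + (√((N : ℝ) + 1) : ℂ) * G + B = (A + B) + (√((N : ℝ) + 1) : ℂ) * G := by ring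
    rw [this, Complex.re_ofReal_mul]
    congr 1
    rw [neg_mul, Complex.neg_re, Complex.I_mul_re, neg_neg, Complex.add_im, hAB, zero_add,
      Complex.im_ofReal_mul]
  rw [hre]
  have hGn : |G.im| ≤ ∑ k ∈ face N j, ‖z k‖ * ‖z (up k j)‖ := by
    refine (Complex.abs_im_le_norm G).trans ((norm_sum_le _ _).trans ?_)
    simp
  calc ξ j * (√((N : ℝ) + 1) * G.im) ≤ |ξ j * (√((N : ℝ) + 1) * G.im)| := le_abs_self _
    _ = |ξ j| * (√((N : ℝ) + 1) * |G.im|) := by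
        rw [abs_mul, abs_mul, abs_of_nonneg (Real.sqrt_nonneg _)]
    _ ≤ _ := by
        gcongr
        exact PiLp.norm_apply_le ξ j

/-- The entropy in terms of the modes. -/
def modeEntropy (ξ : E d) (δ : ℝ) (N : ℕ) (z : (Fin d → ℕ) → ℂ) : ℝ :=
  1 / 2 * ∑ k ∈ box d N, ‖z k‖ ^ 2 +
    δ / (1 + ‖ξ‖ ^ 2) * (-Complex.I * flux ξ z * (starRingEnd ℂ) (z 0)).re

/-- The time derivative of the mode of index `k`. -/
def modeRhs (L : Collision) (ξ : E d) (z : (Fin d → ℕ) → ℂ) (k : Fin d → ℕ) : ℂ :=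
  -Complex.I * ladder ξ z k - rate L k * z k

/-- The time derivative of the entropy. -/
def modeEntropyDeriv (L : Collision) (ξ : E d) (δ : ℝ) (N : ℕ) (z : (Fin d → ℕ) → ℂ) : ℝ :=
  ∑ k ∈ box d N, ((starRingEnd ℂ) (z k) * modeRhs L ξ z k).re +
    δ / (1 + ‖ξ‖ ^ 2) * ((-Complex.I * flux ξ z * (starRingEnd ℂ) (modeRhs L ξ z 0)).re +
      (-Complex.I * flux ξ (modeRhs L ξ z) * (starRingEnd ℂ) (z 0)).re)

lemma rate_zero (L : Collision) : rate L (0 : Fin d → ℕ) = 0 := by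
  cases L <;> simp [rate]

lemma rate_up_zero (L : Collision) (j : Fin d) : rate L (up (0 : Fin d → ℕ) j) = 1 := by
  cases L with
  | fokkerPlanck => simp [rate, up, Finset.sum_update_of_mem]
  | bgk =>
    have : up (0 : Fin d → ℕ) j ≠ 0 := fun h => by simpa [up] using congrFun h j
    simp [rate, this]

lemma ladder_zero (ξ : E d) (z : (Fin d → ℕ) → ℂ) : ladder ξ z 0 = flux ξ z := by
  simp [ladder, flux]

lemma zero_mem_box (N : ℕ) : (0 : Fin d → ℕ) ∈ box d N := mem_box.2 fun j => by simp

lemma up_zero_mem_box {N : ℕ} (hN : 1 ≤ N) (j : Fin d) : up (0 : Fin d → ℕ) j ∈ box d N :=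
  up_mem_box.2 ⟨zero_mem_box N, hN⟩

lemma trunc_of_mem {K : Finset (Fin d → ℕ)} {k : Fin d → ℕ} (h : k ∈ K) (z : (Fin d → ℕ) → ℂ) :
    trunc K z k = z k := if_pos h

lemma flux_trunc {N : ℕ} (hN : 1 ≤ N) (ξ : E d) (z : (Fin d → ℕ) → ℂ) :
    flux ξ (trunc (box d N) z) = flux ξ z := by
  unfold flux
  exact Finset.sum_congr rfl fun j _ => by rw [trunc_of_mem (up_zero_mem_box hN j)]

/-- Only modes of total degree at most two are involved, which is where `2 ≤ N` comes from. -/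
lemma flux_ladder_trunc {N : ℕ} (hN : 2 ≤ N) (ξ : E d) (z : (Fin d → ℕ) → ℂ) :
    flux ξ (ladder ξ (trunc (box d N) z)) = flux ξ (ladder ξ z) := by
  unfold flux ladder
  refine Finset.sum_congr rfl fun j _ => ?_
  congr 1
  refine Finset.sum_congr rfl fun i _ => ?_
  have h1 : up (0 : Fin d → ℕ) j ∈ box d 1 := up_zero_mem_box le_rfl j
  have h2 : up (up (0 : Fin d → ℕ) j) i ∈ box d N :=
    up_mem_box.2 ⟨box_mono (by omega) h1, by have := mem_box.1 h1 i; omega⟩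
  have h3 : down (up (0 : Fin d → ℕ) j) i ∈ box d N := mem_box.2 fun l => by
    have := mem_box.1 h1 l
    have := mem_box.1 h1 i
    by_cases hl : l = i
    · subst hl; simp [down]; omega
    · simp [down, hl]; omega
  rw [trunc_of_mem h2, trunc_of_mem h3]

lemma modeEntropy_eq {N : ℕ} (hN : 1 ≤ N) (ξ : E d) (δ : ℝ) (z : (Fin d → ℕ) → ℂ) :
    entropy ξ δ (hermState (box d N) z) = modeEntropy ξ δ N z := by
  rw [entropy_hermState, flux_trunc hN, trunc_of_mem (zero_mem_box N), modeEntropy]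

/-- The assumed inequality is applied to the truncated Hermite sum, which lies in all domains. The
derivative along the full system differs from minus its entropy production only by the transport
through the faces of the box. -/
lemma modeEntropyDeriv_le {L : Collision} {ξ : E d} {δ lam : ℝ}
    (h : EntropyProductionInequality L ξ δ lam) {N : ℕ} (hN : 2 ≤ N) (z : (Fin d → ℕ) → ℂ) :
    modeEntropyDeriv L ξ δ N z ≤ -lam * modeEntropy ξ δ N z +
      ‖ξ‖ * (√((N : ℝ) + 1) * ∑ j, ∑ k ∈ face N j, ‖z k‖ * ‖z (up k j)‖) := by
  have h1 := h (hermState (box d N) z) (hermState (box d N) fun k => -(rate L k : ℂ) * z k)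
    (memLp_hermState _ _) (memLp_transport_hermState _ _ _) (memLp_hermState _ _)
    (isCollision_hermState _ _ _)
  rw [modeEntropy_eq (by omega), entropyProduction_hermState, flux_ladder_trunc hN,
    flux_trunc (by omega), trunc_of_mem (zero_mem_box N)] at h1
  have h2 := re_sum_ladder_le N ξ z
  have h0 : modeRhs L ξ z 0 = -Complex.I * flux ξ z := by
    simp [modeRhs, rate_zero, ladder_zero]
  have hf : flux ξ (modeRhs L ξ z) = -Complex.I * flux ξ (ladder ξ z) - flux ξ z := by
    unfold flux
    rw [Finset.mul_sum, ← Finset.sum_sub_distrib]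
    refine Finset.sum_congr rfl fun j _ => ?_
    rw [modeRhs, rate_up_zero]; push_cast; ring
  have hsum : ∑ k ∈ box d N, ((starRingEnd ℂ) (z k) * modeRhs L ξ z k).re
      = (∑ k ∈ box d N, (starRingEnd ℂ) (z k) * (-Complex.I * ladder ξ z k)).re
        - ∑ k ∈ box d N, rate L k * ‖z k‖ ^ 2 := by
    rw [Complex.re_sum, ← Finset.sum_sub_distrib]
    refine Finset.sum_congr rfl fun k _ => ?_
    have : (starRingEnd ℂ) (z k) * modeRhs L ξ z k
        = (starRingEnd ℂ) (z k) * (-Complex.I * ladder ξ z k)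
          - ((rate L k * ‖z k‖ ^ 2 : ℝ) : ℂ) := by
      push_cast
      rw [modeRhs, ← Complex.mul_conj']; ring
    rw [this, Complex.sub_re, Complex.ofReal_re]
  have hlow : (-Complex.I * flux ξ z * (starRingEnd ℂ) (modeRhs L ξ z 0)).re +
      (-Complex.I * flux ξ (modeRhs L ξ z) * (starRingEnd ℂ) (z 0)).re
      = -((flux ξ (ladder ξ z) * (starRingEnd ℂ) (z 0)).re - ‖flux ξ z‖ ^ 2
          - (Complex.I * flux ξ z * (starRingEnd ℂ) (z 0)).re) := by
    rw [h0, hf]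
    have e1 : -Complex.I * flux ξ z * (starRingEnd ℂ) (-Complex.I * flux ξ z)
        = ((‖flux ξ z‖ ^ 2 : ℝ) : ℂ) := by
      push_cast
      rw [← Complex.mul_conj', map_mul, map_neg, Complex.conj_I]
      linear_combination (-flux ξ z * (starRingEnd ℂ) (flux ξ z)) * Complex.I_mul_I
    have e2 : -Complex.I * (-Complex.I * flux ξ (ladder ξ z) - flux ξ z) * (starRingEnd ℂ) (z 0)
        = -(flux ξ (ladder ξ z) * (starRingEnd ℂ) (z 0))
          + Complex.I * flux ξ z * (starRingEnd ℂ) (z 0) := by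
      linear_combination (flux ξ (ladder ξ z) * (starRingEnd ℂ) (z 0)) * Complex.I_mul_I
    rw [e1, e2, Complex.ofReal_re, Complex.add_re, Complex.neg_re]
    ring
  rw [modeEntropyDeriv, hsum, hlow]
  linarith

lemma modeEntropy_bounds {ξ : E d} {δ : ℝ} (h : EntropyNormEquivalence ξ δ) (hδ : 0 ≤ δ) {N : ℕ}
    (hN : 1 ≤ N) (z : (Fin d → ℕ) → ℂ) :
    (2 - δ) / 4 * ∑ k ∈ box d N, ‖z k‖ ^ 2 ≤ modeEntropy ξ δ N z ∧
      modeEntropy ξ δ N z ≤ (2 + δ) / 4 * ∑ k ∈ box d N, ‖z k‖ ^ 2 := by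
  have h1 := h (hermState (box d N) z) (memLp_hermState _ _)
  rw [modeEntropy_eq hN, normSq_hermState] at h1
  have hs : 0 ≤ ∑ k ∈ box d N, ‖z k‖ ^ 2 := by positivity
  -- From `s/(1+s²) ≤ 1/2`. The resulting constants `(2 ± δ)/4` have the quotient `C(s)`.
  have hk : δ * ‖ξ‖ / (1 + ‖ξ‖ ^ 2) ≤ δ / 2 := by
    rw [div_le_div_iff₀ (by positivity) (by positivity)]
    nlinarith [sq_nonneg (‖ξ‖ - 1)]
  constructor
  · refine le_trans ?_ h1.1
    exact mul_le_mul_of_nonneg_right (by linarith) hs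
  · refine h1.2.trans ?_
    exact mul_le_mul_of_nonneg_right (by linarith) hs

end truncated

/-! ### The equation integrated in time -/

section timeIntegrated
variable {d : ℕ}

/-- An envelope depending on `x` only also controls averages of `g` over the velocity, as needed for
BGK. -/
lemma exists_memLp_bound {g : E d × E d → ℝ} (hg : Continuous g) (hs : HasCompactSupport g) :
    ∃ b : E d → ℝ, MemLp b 2 ∧ ∀ z, |g z| ≤ b z.1 := by
  obtain ⟨C, hC⟩ := hs.exists_bound_of_continuous hg
  have hK : IsCompact (Prod.fst '' tsupport g) := hs.isCompact.image continuous_fst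
  refine ⟨(Prod.fst '' tsupport g).indicator fun _ => C,
    memLp_indicator_const 2 hK.measurableSet C (Or.inr hK.measure_lt_top.ne), fun z => ?_⟩
  by_cases hz : z ∈ tsupport g
  · rw [indicator_of_mem (mem_image_of_mem _ hz)]
    exact hC z
  · rw [image_eq_zero_of_notMem_tsupport hz, abs_zero]
    exact indicator_nonneg (fun _ _ => (norm_nonneg _).trans (hC 0)) _

lemma aestronglyMeasurable_volume (F : Lp ℝ 2 (phaseMeasure d)) :
    AEStronglyMeasurable F (volume : Measure (E d × E d)) :=
  (Lp.aestronglyMeasurable F).mono_ac volume_ac_phaseMeasure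

lemma integrable_mul_of_bound (F : Lp ℝ 2 (phaseMeasure d)) {θ : E d × E d → ℝ} {b : E d → ℝ}
    (hθ : AEStronglyMeasurable θ volume) (hb : MemLp b 2) (h : ∀ z, |θ z| ≤ b z.1) :
    Integrable fun z => F z * θ z := by
  have h1 : Integrable fun z : E d × E d => F z * b z.1 := by
    simpa using
      integrable_mul_of_growth (Lp.memLp F) hb (ExpGrowth.const (V := E d) (1 : ℝ)) continuous_const
  refine h1.mono ((aestronglyMeasurable_volume F).mul hθ) (Filter.Eventually.of_forall fun z => ?_)
  rw [norm_mul, norm_mul]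
  exact mul_le_mul_of_nonneg_left ((h z).trans (le_abs_self _)) (norm_nonneg _)

/-- The representing vector is `𝓜 θ`. Written as scalar products, the pairings are bounded
functionals and commute with the integral in time. -/
lemma exists_inner_eq_integral {θ : E d × E d → ℝ} {b : E d → ℝ}
    (hθ : AEStronglyMeasurable θ volume) (hb : MemLp b 2) (h : ∀ z, |θ z| ≤ b z.1) :
    ∃ G : Lp ℝ 2 (phaseMeasure d), ∀ F : Lp ℝ 2 (phaseMeasure d),
      ∫ z, F z * θ z = inner ℝ G F := by
  have hm : MemLp (fun z : E d × E d => maxwellian z.2 * θ z) 2 (phaseMeasure d) := by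
    have h1 : MemLp (fun z : E d × E d => b z.1 * (maxwellian z.2 * 1)) 2 (phaseMeasure d) :=
      memLp_phase_mul hb (ExpGrowth.const (V := E d) (1 : ℝ)) continuous_const
    refine h1.mono ?_ (Filter.Eventually.of_forall fun z => ?_)
    · exact ((continuous_maxwellian.comp continuous_snd).aestronglyMeasurable.mul
        (hθ.mono_ac phaseMeasure_ac_volume))
    · rw [mul_one, norm_mul, norm_mul, mul_comm]
      exact mul_le_mul_of_nonneg_right ((h z).trans (le_abs_self _)) (norm_nonneg _)
  refine ⟨hm.toLp, fun F => ?_⟩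
  rw [L2.inner_def, ← integral_phase_maxwellian_smul]
  refine integral_congr_ae ?_
  filter_upwards [hm.coeFn_toLp] with z hz
  rw [hz]; simp only [RCLike.inner_apply, conj_trivial, smul_eq_mul]; ring

/-- The partial derivative in the velocity variable. -/
def velocityDeriv (j : Fin d) (φ : E d × E d → ℝ) (z : E d × E d) : ℝ :=
  fderiv ℝ φ z (0, EuclideanSpace.single j 1)

lemma contDiff_velocityDeriv {φ : E d × E d → ℝ} (hφ : ContDiff ℝ ∞ φ) (j : Fin d) :
    ContDiff ℝ ∞ (velocityDeriv j φ) :=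
  (hφ.fderiv_right (m := ∞) (by simp)).clm_apply contDiff_const

lemma partialDeriv_section {φ : E d × E d → ℝ} (hφ : ContDiff ℝ ∞ φ) (j : Fin d) (x : E d) :
    partialDeriv j (fun w => φ (x, w)) = fun v => velocityDeriv j φ (x, v) := by
  ext v
  have h1 := (hφ.differentiable (by simp)).differentiableAt.hasFDerivAt (x := (x, v))
  have h2 : HasFDerivAt (fun w => φ (x, w)) _ v := h1.comp v (hasFDerivAt_prodMk_right x v)
  rw [partialDeriv, h2.fderiv]
  rfl

lemma fokkerPlanckAdjoint_section {φ : E d × E d → ℝ} (hφ : ContDiff ℝ ∞ φ) (z : E d × E d) :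
    fokkerPlanckAdjoint (fun w => φ (z.1, w)) z.2
      = ∑ j, (velocityDeriv j (velocityDeriv j φ) z - z.2 j * velocityDeriv j φ z) := by
  have h : ContDiff ℝ ∞ fun w => φ (z.1, w) := hφ.comp (contDiff_const.prodMk contDiff_id)
  rw [fokkerPlanckAdjoint_eq_sum h]
  simp_rw [partialDeriv_section hφ, partialDeriv_section (contDiff_velocityDeriv hφ _)]

lemma exists_inner_eq_transportPairing {φ : E d × E d → ℝ} (hφ : ContDiff ℝ ∞ φ)
    (hs : HasCompactSupport φ) : ∃ G : Lp ℝ 2 (phaseMeasure d), ∀ F : Lp ℝ 2 (phaseMeasure d),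
      transportPairing F φ = inner ℝ G F := by
  have e : ∀ z : E d × E d, fderiv ℝ (fun y => φ (y, z.2)) z.1 z.2 = fderiv ℝ φ z (z.2, 0) :=
    fun z => by
      have h1 := (hφ.differentiable (by simp)).differentiableAt.hasFDerivAt (x := (z.1, z.2))
      have h2 : HasFDerivAt (fun y => φ (y, z.2)) _ z.1 := h1.comp z.1 (hasFDerivAt_prodMk_left z.1 z.2)
      rw [h2.fderiv]
      rfl
  have hc : Continuous fun z : E d × E d => fderiv ℝ φ z (z.2, 0) := by
    have := hφ.continuous_fderiv (by simp)
    fun_prop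
  have hcs : HasCompactSupport fun z : E d × E d => fderiv ℝ φ z (z.2, 0) := by
    refine HasCompactSupport.intro (hs.fderiv ℝ).isCompact fun z hz => ?_
    rw [image_eq_zero_of_notMem_tsupport hz]; rfl
  obtain ⟨b, hb, hle⟩ := exists_memLp_bound hc hcs
  obtain ⟨G, hG⟩ := exists_inner_eq_integral hc.aestronglyMeasurable hb hle
  exact ⟨G, fun F => by simp only [transportPairing, e, hG]⟩

lemma exists_inner_eq_collisionPairing (L : Collision) {φ : E d × E d → ℝ} (hφ : ContDiff ℝ ∞ φ)
    (hs : HasCompactSupport φ) : ∃ G : Lp ℝ 2 (phaseMeasure d), ∀ F : Lp ℝ 2 (phaseMeasure d),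
      collisionPairing L F φ = inner ℝ G F := by
  cases L with
  | fokkerPlanck =>
    have h1 := fun j => contDiff_velocityDeriv hφ j
    have h2 := fun j => contDiff_velocityDeriv (h1 j) j
    have hc : Continuous fun z : E d × E d =>
        ∑ j, (velocityDeriv j (velocityDeriv j φ) z - z.2 j * velocityDeriv j φ z) := by
      refine continuous_finsetSum _ fun j _ => (h2 j).continuous.sub ?_
      exact (by fun_prop : Continuous fun z : E d × E d => z.2 j).mul (h1 j).continuous
    have hcs : HasCompactSupport fun z : E d × E d =>
        ∑ j, (velocityDeriv j (velocityDeriv j φ) z - z.2 j * velocityDeriv j φ z) := by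
      refine HasCompactSupport.intro hs.isCompact fun z hz => Finset.sum_eq_zero fun j _ => ?_
      have hsub : ∀ ψ : E d × E d → ℝ, tsupport (velocityDeriv j ψ) ⊆ tsupport ψ := fun ψ => by
        refine (closure_mono fun w hw => ?_).trans (tsupport_fderiv_subset ℝ)
        intro h0; refine hw ?_
        simp only [velocityDeriv, h0]; rfl
      rw [image_eq_zero_of_notMem_tsupport fun h => hz (hsub _ h),
        image_eq_zero_of_notMem_tsupport fun h => hz (hsub _ (hsub _ h))]
      simp
    obtain ⟨b, hb, hle⟩ := exists_memLp_bound hc hcs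
    obtain ⟨G, hG⟩ := exists_inner_eq_integral hc.aestronglyMeasurable hb hle
    exact ⟨G, fun F => by simp only [collisionPairing, fokkerPlanckAdjoint_section hφ, hG]⟩
  | bgk =>
    obtain ⟨b, hb, hle⟩ := exists_memLp_bound hφ.continuous hs
    have hb0 : ∀ x, 0 ≤ b x := fun x => (abs_nonneg _).trans (hle (x, 0))
    have hM1 : Integrable (fun v : E d => maxwellian v) := by
      simpa using (ExpGrowth.const (V := E d) (1 : ℝ)).integrable_mul_maxwellian
        aestronglyMeasurable_const
    have hM2 : ∫ v : E d, maxwellian v = 1 := by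
      simpa using integral_hermiteFun_mul_hermiteFun (d := d) 0 0
    -- The adjoint of BGK applied to `φ` is `m - φ`; as `𝓜` has mass one, `m` obeys the same
    -- envelope as `φ`.
    let m : E d → ℝ := fun x => ∫ v, maxwellian v * φ (x, v)
    have hmm : AEStronglyMeasurable m volume := by
      have : StronglyMeasurable (Function.uncurry fun (x v : E d) => maxwellian v * φ (x, v)) := by
        refine Continuous.stronglyMeasurable ?_
        have := hφ.continuous
        have := continuous_maxwellian (d := d)
        fun_prop
      exact this.integral_prod_right.aestronglyMeasurable
    have hmb : ∀ x, |m x| ≤ b x := fun x => by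
      have h1 : ∀ v, ‖maxwellian v * φ (x, v)‖ ≤ maxwellian v * b x := fun v => by
        rw [norm_mul, Real.norm_of_nonneg (maxwellian_pos v).le]
        exact mul_le_mul_of_nonneg_left (hle (x, v)) (maxwellian_pos v).le
      calc |m x| ≤ ∫ v, maxwellian v * b x :=
            norm_integral_le_of_norm_le (hM1.mul_const _) (Filter.Eventually.of_forall h1)
        _ = b x := by rw [integral_mul_const, hM2, one_mul]
    obtain ⟨G, hG⟩ := exists_inner_eq_integral (θ := fun z => m z.1 - φ z) (b := fun x => b x + b x)
      (hmm.comp_fst.sub hφ.continuous.aestronglyMeasurable) (hb.add hb)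
      fun z => (abs_sub _ _).trans (add_le_add (hmb z.1) (hle z))
    refine ⟨G, fun F => ?_⟩
    rw [← hG]
    have hFm := integrable_mul_of_bound F hmm.comp_fst hb (fun z => hmb z.1)
    have hFφ := integrable_mul_of_bound F hφ.continuous.aestronglyMeasurable hb hle
    have hFb := integrable_mul_of_bound F (θ := fun z => b z.1) hb.1.comp_fst hb
      fun z => (abs_of_nonneg (hb0 _)).le
    have hρb : Integrable fun x => spatialDensity F x * b x := by
      have := hFb.integral_prod_left
      simpa only [spatialDensity, integral_mul_const] using this
    have hρ : AEStronglyMeasurable (spatialDensity F) volume :=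
      (aestronglyMeasurable_volume F).integral_prod_right'
    have hI : Integrable fun z : E d × E d => spatialDensity F z.1 * maxwellian z.2 * φ z := by
      refine (hρb.mul_prod hM1).mono ((hρ.comp_fst.mul
        (continuous_maxwellian.comp continuous_snd).aestronglyMeasurable).mul
          hφ.continuous.aestronglyMeasurable) (Filter.Eventually.of_forall fun z => ?_)
      rw [norm_mul, norm_mul, norm_mul, norm_mul, mul_right_comm]
      gcongr
      exact (hle z).trans (le_abs_self _)
    simp only [collisionPairing]
    simp_rw [sub_mul, mul_sub]
    rw [integral_sub hI hFφ, integral_sub hFm hFφ]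
    congr 1
    rw [Measure.volume_eq_prod] at hI hFm ⊢
    rw [integral_prod _ hI, integral_prod _ hFm]
    congr 1; ext x
    simp only [spatialDensity, mul_assoc, integral_const_mul, integral_mul_const, m]

lemma integral_mul_test_eq_inner {φ : E d × E d → ℝ} (hφ : Continuous φ)
    (hs : HasCompactSupport φ) : ∃ G : Lp ℝ 2 (phaseMeasure d), ∀ F : Lp ℝ 2 (phaseMeasure d),
      ∫ z, F z * φ z = inner ℝ G F := by
  obtain ⟨b, hb, hle⟩ := exists_memLp_bound hφ hs
  exact exists_inner_eq_integral hφ.aestronglyMeasurable hb hle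

/-- Freezing the solution at negative times makes it continuous on the whole line, so the time
integrals below need no one-sided care. -/
lemma IsSolution.continuous_max {L : Collision} {f₀ : E d × E d → ℝ}
    {f : ℝ → Lp ℝ 2 (phaseMeasure d)} (h : IsSolution L f₀ f) :
    Continuous fun s => f (max s 0) :=
  h.continuousOn.comp_continuous (continuous_id.max continuous_const) fun s => le_max_right s 0

/-- The equation in the sense of distributions, for the integral in time of the solution. -/
lemma IsSolution.isWeakDerivative {L : Collision} {f₀ : E d × E d → ℝ}
    {f : ℝ → Lp ℝ 2 (phaseMeasure d)} (h : IsSolution L f₀ f) {t : ℝ} (ht : 0 ≤ t) :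
    IsWeakDerivative L ⇑(f t - f 0) ⇑(∫ s in (0 : ℝ)..t, f (max s 0)) := by
  intro φ hφ hs
  obtain ⟨G₁, h1⟩ := exists_inner_eq_transportPairing hφ hs
  obtain ⟨G₂, h2⟩ := exists_inner_eq_collisionPairing L hφ hs
  obtain ⟨G, hG⟩ := integral_mul_test_eq_inner hφ.continuous hs
  have h0 : ∫ z, f₀ z * φ z = ∫ z, f 0 z * φ z := by
    refine integral_congr_ae ?_
    filter_upwards [volume_ac_phaseMeasure.ae_le h.initial] with z hz
    rw [hz]
  have heq := h.equation φ hφ hs t ht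
  -- The right-hand side of the equation is one fixed bounded functional of `f s`, which can be
  -- taken out of the integral in time.
  have e : ∀ s ∈ uIcc 0 t, transportPairing (f s) φ + collisionPairing L (f s) φ
      = innerSL ℝ (G₁ + G₂) (f (max s 0)) := fun s hs => by
    rw [uIcc_of_le ht] at hs
    rw [max_eq_left hs.1, h1, h2]
    simp
  rw [intervalIntegral.integral_congr e,
    ContinuousLinearMap.intervalIntegral_comp_comm _ (h.continuous_max.intervalIntegrable _ _),
    h0, hG, hG] at heq
  rw [hG, inner_sub_right, heq, h1, h2, innerSL_apply_apply, inner_add_left]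
  ring

end timeIntegrated

/-! ### Localization in frequency -/

section localization
variable {d : ℕ}

open Classical in
/-- Multiplication by a bounded function, as an operator of `L²`. -/
def mulL (m : E d → ℂ) :
    Lp ℂ 2 (volume : Measure (E d)) →L[ℝ] Lp ℂ 2 (volume : Measure (E d)) :=
  if h : MemLp m ∞ volume then (ContinuousLinearMap.mul ℝ ℂ).holderL volume ∞ 2 2 h.toLp else 0

lemma mulL_ae {m : E d → ℂ} (h : MemLp m ∞ volume) (u : Lp ℂ 2 (volume : Measure (E d))) :
    ∀ᵐ ζ, mulL m u ζ = m ζ * u ζ := by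
  rw [mulL, dif_pos h]
  filter_upwards [(ContinuousLinearMap.mul ℝ ℂ).coeFn_holder (r := 2) h.toLp u, h.coeFn_toLp]
    with ζ h1 h2
  rw [← h2]
  exact h1

/-- The modes, localized in a set of frequencies. -/
def cut (S : Set (E d)) (k : Fin d → ℕ) :
    Lp ℝ 2 (phaseMeasure d) →L[ℝ] Lp ℂ 2 (volume : Measure (E d)) :=
  (mulL (S.indicator fun _ => 1)).comp (mode k)

/-- Multiplication by the symbol of `-∂ⱼ`, localized in a set of frequencies. -/
def cutSymbol (S : Set (E d)) (j : Fin d) :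
    Lp ℂ 2 (volume : Measure (E d)) →L[ℝ] Lp ℂ 2 (volume : Measure (E d)) :=
  mulL (S.indicator fun ζ => -Complex.I * ((2 * Real.pi * ζ j : ℝ) : ℂ))

/-- The time derivative of the localized modes. -/
def cutRhs (L : Collision) (S : Set (E d)) (k : Fin d → ℕ) :
    Lp ℝ 2 (phaseMeasure d) →L[ℝ] Lp ℂ 2 (volume : Measure (E d)) :=
  ∑ j, (cutSymbol S j).comp (√((k j : ℝ) + 1) • mode (up k j) + √(k j : ℝ) • mode (down k j))
    - rate L k • cut S k

/-- The multiplier of the corrector in the entropy. -/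
def coupling (D : E d → ℝ) (j : Fin d) :
    Lp ℂ 2 (volume : Measure (E d)) →L[ℝ] Lp ℂ 2 (volume : Measure (E d)) :=
  mulL fun ζ => -Complex.I * ((D ζ / (1 + ‖(2 * Real.pi) • ζ‖ ^ 2) * (2 * Real.pi * ζ j) : ℝ) : ℂ)

variable {S : Set (E d)} {ρ : ℝ} {D : E d → ℝ}

lemma cut_ae (hS : MeasurableSet S) (k : Fin d → ℕ) (F : Lp ℝ 2 (phaseMeasure d)) :
    ∀ᵐ ζ, cut S k F ζ = S.indicator (fun ζ => mode k F ζ) ζ := by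
  have h : MemLp (S.indicator fun _ : E d => (1 : ℂ)) ∞ volume :=
    (memLp_top_const (1 : ℂ)).indicator hS
  filter_upwards [mulL_ae h (mode k F)] with ζ hζ
  rw [cut, ContinuousLinearMap.comp_apply, hζ]
  by_cases hm : ζ ∈ S <;> simp [hm]

lemma abs_coord_le (ζ : E d) (j : Fin d) : |2 * Real.pi * ζ j| ≤ ‖(2 * Real.pi) • ζ‖ := by
  simpa using PiLp.norm_apply_le ((2 * Real.pi) • ζ) j

lemma cutSymbol_ae (hS : MeasurableSet S) (hρ : ∀ ζ ∈ S, ‖(2 * Real.pi) • ζ‖ ≤ ρ) (j : Fin d)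
    (u : Lp ℂ 2 (volume : Measure (E d))) :
    ∀ᵐ ζ, cutSymbol S j u ζ
      = S.indicator (fun ζ => -Complex.I * ((2 * Real.pi * ζ j : ℝ) : ℂ) * u ζ) ζ := by
  have h : MemLp (S.indicator fun ζ : E d => -Complex.I * ((2 * Real.pi * ζ j : ℝ) : ℂ)) ∞
      volume := by
    refine memLp_top_of_bound ?_ |ρ| (Filter.Eventually.of_forall fun ζ => ?_)
    · exact (Continuous.aestronglyMeasurable (by fun_prop)).indicator hS
    · by_cases hm : ζ ∈ S
      · rw [indicator_of_mem hm, norm_mul, norm_neg, Complex.norm_I, one_mul, Complex.norm_real]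
        exact (abs_coord_le ζ j).trans ((hρ ζ hm).trans (le_abs_self _))
      · rw [indicator_of_notMem hm, norm_zero]; exact abs_nonneg _
  filter_upwards [mulL_ae h u] with ζ hζ
  rw [cutSymbol, hζ]
  by_cases hm : ζ ∈ S <;> simp [hm]

lemma Lp.coeFn_sum {ι : Type*} (s : Finset ι) (u : ι → Lp ℂ 2 (volume : Measure (E d))) :
    ∀ᵐ ζ, (∑ i ∈ s, u i : Lp ℂ 2 (volume : Measure (E d))) ζ = ∑ i ∈ s, u i ζ := by
  classical
  induction s using Finset.induction_on with
  | empty =>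
    filter_upwards [Lp.coeFn_zero ℂ 2 (volume : Measure (E d))] with ζ hζ
    simp only [Finset.sum_empty, hζ, Pi.zero_apply]
  | insert a s ha ih =>
    rw [Finset.sum_insert ha]
    filter_upwards [ih, Lp.coeFn_add (u a) (∑ i ∈ s, u i)] with ζ h1 h2
    rw [h2, Pi.add_apply, h1, Finset.sum_insert ha]

lemma cutRhs_ae_indicator (L : Collision) (hS : MeasurableSet S)
    (hρ : ∀ ζ ∈ S, ‖(2 * Real.pi) • ζ‖ ≤ ρ) (k : Fin d → ℕ) (F : Lp ℝ 2 (phaseMeasure d)) :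
    ∀ᵐ ζ, cutRhs L S k F ζ = S.indicator (fun ζ =>
      modeRhs L ((2 * Real.pi) • ζ) (fun l => mode l F ζ) k) ζ := by
  let u : Fin d → Lp ℂ 2 (volume : Measure (E d)) := fun j =>
    √((k j : ℝ) + 1) • mode (up k j) F + √(k j : ℝ) • mode (down k j) F
  have hu : ∀ j, ∀ᵐ ζ, u j ζ = (√((k j : ℝ) + 1) : ℂ) * mode (up k j) F ζ
      + (√(k j : ℝ) : ℂ) * mode (down k j) F ζ := fun j => by
    filter_upwards [Lp.coeFn_add (√((k j : ℝ) + 1) • mode (up k j) F)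
      (√(k j : ℝ) • mode (down k j) F), Lp.coeFn_smul (√((k j : ℝ) + 1)) (mode (up k j) F),
      Lp.coeFn_smul (√(k j : ℝ)) (mode (down k j) F)] with ζ h1 h2 h3
    simp only [u]
    rw [h1, Pi.add_apply, h2, h3]; simp
  have e : cutRhs L S k F = ∑ j, cutSymbol S j (u j) - rate L k • cut S k F := by
    simp [cutRhs, u]
  rw [e]
  filter_upwards [ae_all_iff.2 hu, ae_all_iff.2 fun j => cutSymbol_ae hS hρ j (u j),
    cut_ae hS k F, Lp.coeFn_sum Finset.univ fun j => cutSymbol S j (u j),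
    Lp.coeFn_sub (∑ j, cutSymbol S j (u j)) (rate L k • cut S k F),
    Lp.coeFn_smul (rate L k) (cut S k F)] with ζ h1 h2 h3 h4 h5 h6
  rw [h5, Pi.sub_apply, h4, h6, Pi.smul_apply, h3, Finset.sum_congr rfl fun j _ => h2 j]
  by_cases hm : ζ ∈ S
  · simp only [indicator_of_mem hm, h1, modeRhs, ladder, PiLp.smul_apply, smul_eq_mul,
      Finset.mul_sum, Complex.real_smul, mul_assoc]
  · simp [indicator_of_notMem hm]

/-- The system acts pointwise in frequency, so restricting all modes to `S` preserves it. -/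
lemma cutRhs_ae (L : Collision) (hS : MeasurableSet S)
    (hρ : ∀ ζ ∈ S, ‖(2 * Real.pi) • ζ‖ ≤ ρ) (k : Fin d → ℕ) (F : Lp ℝ 2 (phaseMeasure d)) :
    ∀ᵐ ζ, cutRhs L S k F ζ = modeRhs L ((2 * Real.pi) • ζ) (fun l => cut S l F ζ) k := by
  filter_upwards [cutRhs_ae_indicator L hS hρ k F, ae_all_iff.2 fun l => cut_ae hS l F]
    with ζ h1 h2
  rw [h1]
  by_cases hm : ζ ∈ S
  · simp only [h2, indicator_of_mem hm]
  · simp [h2, indicator_of_notMem hm, modeRhs, ladder]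

/-- On a bounded set of frequencies the symbol of transport is bounded, and the weak equation
becomes an identity between bounded operators on `L²`. Strong differentiability in time rests on it.
-/
lemma IsWeakDerivative.cut {L : Collision} {P F : Lp ℝ 2 (phaseMeasure d)}
    (h : IsWeakDerivative L P F) (hS : MeasurableSet S)
    (hρ : ∀ ζ ∈ S, ‖(2 * Real.pi) • ζ‖ ≤ ρ) (k : Fin d → ℕ) :
    cut S k P = cutRhs L S k F := by
  refine Lp.ext ?_
  filter_upwards [cut_ae hS k P, cutRhs_ae_indicator L hS hρ k F, h.mode k] with ζ h1 h2 h3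
  rw [h1, h2]
  by_cases hm : ζ ∈ S
  · simp only [indicator_of_mem hm, h3, modeRhs]
  · simp only [indicator_of_notMem hm]

/-- `D` vanishes outside the bounded set `S`, which makes the multiplier bounded, by `2 |ρ|`. -/
lemma coupling_ae (hρ : ∀ ζ ∈ S, ‖(2 * Real.pi) • ζ‖ ≤ ρ) (hD : Measurable D)
    (hD0 : ∀ ζ ∉ S, D ζ = 0) (hDb : ∀ ζ, |D ζ| ≤ 2) (j : Fin d)
    (u : Lp ℂ 2 (volume : Measure (E d))) :
    ∀ᵐ ζ, coupling D j u ζ = -Complex.I *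
      ((D ζ / (1 + ‖(2 * Real.pi) • ζ‖ ^ 2) * (2 * Real.pi * ζ j) : ℝ) : ℂ) * u ζ := by
  have h : MemLp (fun ζ : E d => -Complex.I *
      ((D ζ / (1 + ‖(2 * Real.pi) • ζ‖ ^ 2) * (2 * Real.pi * ζ j) : ℝ) : ℂ)) ∞ volume := by
    refine memLp_top_of_bound ?_ (2 * |ρ|) (Filter.Eventually.of_forall fun ζ => ?_)
    · have h1 : Measurable fun ζ : E d =>
          D ζ / (1 + ‖(2 * Real.pi) • ζ‖ ^ 2) * (2 * Real.pi * ζ j) := by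
        refine (hD.div (Continuous.measurable (by fun_prop))).mul
          (Continuous.measurable (by fun_prop))
      exact ((Complex.measurable_ofReal.comp h1).const_mul _).aestronglyMeasurable
    · rw [norm_mul, norm_neg, Complex.norm_I, one_mul, Complex.norm_real, norm_mul, norm_div]
      by_cases hm : ζ ∈ S
      · refine mul_le_mul ?_ ((abs_coord_le ζ j).trans ((hρ ζ hm).trans (le_abs_self _)))
          (norm_nonneg _) zero_le_two
        refine (div_le_self (norm_nonneg _) ?_).trans (hDb ζ)
        rw [Real.norm_of_nonneg (by positivity)]
        linarith [sq_nonneg ‖(2 * Real.pi) • ζ‖]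
      · rw [hD0 ζ hm]; simp
  exact mulL_ae h u

/-- The integral in frequency of the entropy of the modes. -/
def totalEntropy (D : E d → ℝ) (N : ℕ) (a : (Fin d → ℕ) → Lp ℂ 2 (volume : Measure (E d))) : ℝ :=
  1 / 2 * ∑ k ∈ box d N, inner ℝ (a k) (a k) + ∑ j, inner ℝ (a 0) (coupling D j (a (up 0 j)))

/-- The derivative of the integral in frequency of the entropy of the modes. -/
def totalEntropyDeriv (D : E d → ℝ) (N : ℕ)
    (a b : (Fin d → ℕ) → Lp ℂ 2 (volume : Measure (E d))) : ℝ :=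
  ∑ k ∈ box d N, inner ℝ (a k) (b k) +
    ∑ j, (inner ℝ (b 0) (coupling D j (a (up 0 j))) + inner ℝ (a 0) (coupling D j (b (up 0 j))))

lemma hasDerivAt_totalEntropy (N : ℕ) {a : ℝ → (Fin d → ℕ) → Lp ℂ 2 (volume : Measure (E d))}
    {b : (Fin d → ℕ) → Lp ℂ 2 (volume : Measure (E d))} {t : ℝ}
    (h : ∀ k, HasDerivAt (fun s => a s k) (b k) t) :
    HasDerivAt (fun s => totalEntropy D N (a s)) (totalEntropyDeriv D N (a t) b) t := by
  have h1 : HasDerivAt (fun s => 1 / 2 * ∑ k ∈ box d N, inner ℝ (a s k) (a s k))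
      (∑ k ∈ box d N, inner ℝ (a t k) (b k)) t := by
    have := (HasDerivAt.fun_sum fun k (_ : k ∈ box d N) => (h k).inner ℝ (h k)).const_mul (1 / 2 : ℝ)
    refine this.congr_deriv ?_
    rw [Finset.mul_sum]
    refine Finset.sum_congr rfl fun k _ => ?_
    rw [real_inner_comm (a t k) (b k)]; ring
  have h2 : HasDerivAt (fun s => ∑ j, inner ℝ (a s 0) (coupling D j (a s (up 0 j))))
      (∑ j, (inner ℝ (b 0) (coupling D j (a t (up 0 j)))
        + inner ℝ (a t 0) (coupling D j (b (up 0 j))))) t := by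
    refine HasDerivAt.fun_sum fun j _ => ?_
    have h3 : HasDerivAt (fun s => coupling D j (a s (up 0 j))) (coupling D j (b (up 0 j))) t :=
      (coupling D j).hasFDerivAt.comp_hasDerivAt t (h (up 0 j))
    exact ((h 0).inner ℝ h3).congr_deriv (add_comm _ _)
  exact h1.add h2

lemma totalEntropy_eq (hρ : ∀ ζ ∈ S, ‖(2 * Real.pi) • ζ‖ ≤ ρ) (hD : Measurable D)
    (hD0 : ∀ ζ ∉ S, D ζ = 0) (hDb : ∀ ζ, |D ζ| ≤ 2) (N : ℕ)
    (a : (Fin d → ℕ) → Lp ℂ 2 (volume : Measure (E d))) :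
    Integrable (fun ζ => modeEntropy ((2 * Real.pi) • ζ) (D ζ) N fun k => a k ζ) ∧
    totalEntropy D N a = ∫ ζ, modeEntropy ((2 * Real.pi) • ζ) (D ζ) N fun k => a k ζ := by
  have i1 : ∀ k ∈ box d N, Integrable fun ζ => inner ℝ (a k ζ) (a k ζ) :=
    fun k _ => L2.integrable_inner (𝕜 := ℝ) (a k) (a k)
  have i2 : ∀ j ∈ Finset.univ, Integrable fun ζ => inner ℝ (a 0 ζ) (coupling D j (a (up 0 j)) ζ) :=
    fun j _ => L2.integrable_inner (𝕜 := ℝ) _ _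
  have i3 := ((integrable_finsetSum _ i1).const_mul (1 / 2)).add (integrable_finsetSum _ i2)
  have e : (fun ζ => modeEntropy ((2 * Real.pi) • ζ) (D ζ) N fun k => a k ζ) =ᵐ[volume]
      fun ζ => 1 / 2 * ∑ k ∈ box d N, inner ℝ (a k ζ) (a k ζ)
        + ∑ j, inner ℝ (a 0 ζ) (coupling D j (a (up 0 j)) ζ) := by
    filter_upwards [ae_all_iff.2 fun j => coupling_ae hρ hD hD0 hDb j (a (up 0 j))] with ζ h
    simp only [h, modeEntropy, real_inner_self_eq_norm_sq, flux, Complex.inner]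
    congr 1
    rw [Finset.mul_sum, Finset.sum_mul, Complex.re_sum, Finset.mul_sum]
    refine Finset.sum_congr rfl fun j _ => ?_
    rw [← Complex.re_ofReal_mul]
    congr 1
    simp only [PiLp.smul_apply, smul_eq_mul]
    push_cast; ring
  refine ⟨i3.congr e.symm, ?_⟩
  rw [integral_congr_ae e, integral_add ((integrable_finsetSum _ i1).const_mul _)
    (integrable_finsetSum _ i2), integral_const_mul, integral_finsetSum _ i1,
    integral_finsetSum _ i2, totalEntropy]
  simp only [L2.inner_def]

lemma totalEntropyDeriv_eq (L : Collision) (hρ : ∀ ζ ∈ S, ‖(2 * Real.pi) • ζ‖ ≤ ρ)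
    (hD : Measurable D) (hD0 : ∀ ζ ∉ S, D ζ = 0) (hDb : ∀ ζ, |D ζ| ≤ 2) (N : ℕ)
    {a b : (Fin d → ℕ) → Lp ℂ 2 (volume : Measure (E d))}
    (hb : ∀ k, ∀ᵐ ζ, b k ζ = modeRhs L ((2 * Real.pi) • ζ) (fun l => a l ζ) k) :
    Integrable (fun ζ => modeEntropyDeriv L ((2 * Real.pi) • ζ) (D ζ) N fun k => a k ζ) ∧
    totalEntropyDeriv D N a b
      = ∫ ζ, modeEntropyDeriv L ((2 * Real.pi) • ζ) (D ζ) N fun k => a k ζ := by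
  have i1 : ∀ k ∈ box d N, Integrable fun ζ => inner ℝ (a k ζ) (b k ζ) :=
    fun k _ => L2.integrable_inner (𝕜 := ℝ) (a k) (b k)
  have i2 : ∀ j ∈ Finset.univ, Integrable fun ζ => inner ℝ (b 0 ζ) (coupling D j (a (up 0 j)) ζ)
      + inner ℝ (a 0 ζ) (coupling D j (b (up 0 j)) ζ) :=
    fun j _ => (L2.integrable_inner (𝕜 := ℝ) _ _).add (L2.integrable_inner (𝕜 := ℝ) _ _)
  have i3 := (integrable_finsetSum _ i1).add (integrable_finsetSum _ i2)
  have e : (fun ζ => modeEntropyDeriv L ((2 * Real.pi) • ζ) (D ζ) N fun k => a k ζ) =ᵐ[volume]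
      fun ζ => ∑ k ∈ box d N, inner ℝ (a k ζ) (b k ζ)
        + ∑ j, (inner ℝ (b 0 ζ) (coupling D j (a (up 0 j)) ζ)
          + inner ℝ (a 0 ζ) (coupling D j (b (up 0 j)) ζ)) := by
    filter_upwards [ae_all_iff.2 fun j => coupling_ae hρ hD hD0 hDb j (a (up 0 j)),
      ae_all_iff.2 fun j => coupling_ae hρ hD hD0 hDb j (b (up 0 j)), ae_all_iff.2 hb]
      with ζ h1 h2 h3
    simp only [h1, h2, h3, modeEntropyDeriv, flux, Complex.inner]
    congr 1
    · refine Finset.sum_congr rfl fun k _ => ?_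
      rw [mul_comm]
    rw [Finset.sum_add_distrib, mul_add]
    congr 1
    all_goals
      rw [Finset.mul_sum, Finset.sum_mul, Complex.re_sum, Finset.mul_sum]
      refine Finset.sum_congr rfl fun j _ => ?_
      rw [← Complex.re_ofReal_mul]
      congr 1
      simp only [PiLp.smul_apply, smul_eq_mul]
      push_cast; ring
  refine ⟨i3.congr e.symm, ?_⟩
  rw [integral_congr_ae e, integral_add (integrable_finsetSum _ i1)
    (integrable_finsetSum _ i2), integral_finsetSum _ i1, integral_finsetSum _ i2,
    totalEntropyDeriv]
  simp only [L2.inner_def]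
  congr 1
  exact Finset.sum_congr rfl fun j _ =>
    (integral_add (L2.integrable_inner (𝕜 := ℝ) _ _) (L2.integrable_inner (𝕜 := ℝ) _ _)).symm

end localization

/-! ### Decay of the modes -/

section decay
variable {d : ℕ}

/-- Grönwall's inequality, with the weight `exp(-r (T - s)) ≤ 1` of the source dropped. -/
lemma le_of_hasDerivAt_le {y y' g : ℝ → ℝ} {T r : ℝ} (hT : 0 ≤ T) (hr : 0 ≤ r)
    (hy : ∀ s ∈ Icc 0 T, HasDerivAt y (y' s) s) (hg : Continuous g) (hg0 : ∀ s, 0 ≤ g s)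
    (hle : ∀ s ∈ Icc 0 T, y' s ≤ -r * y s + g s) :
    y T ≤ Real.exp (-(r * T)) * y 0 + ∫ s in (0 : ℝ)..T, g s := by
  -- The factor of the source is frozen at the final time, which makes `h` non-increasing on `[0,
  -- T]` because `g ≥ 0`.
  let h : ℝ → ℝ := fun s => Real.exp (r * s) * y s - Real.exp (r * T) * ∫ σ in (0 : ℝ)..s, g σ
  have hd : ∀ s ∈ Icc 0 T, HasDerivAt h
      (Real.exp (r * s) * (r * y s + y' s) - Real.exp (r * T) * g s) s := fun s hs => by
    have h1 : HasDerivAt (fun s => Real.exp (r * s)) (Real.exp (r * s) * r) s := by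
      simpa using ((hasDerivAt_id s).const_mul r).exp
    have h2 : HasDerivAt (fun s => ∫ σ in (0 : ℝ)..s, g σ) (g s) s :=
      intervalIntegral.integral_hasDerivAt_right (hg.intervalIntegrable _ _)
        (hg.stronglyMeasurableAtFilter _ _) hg.continuousAt
    refine ((h1.mul (hy s hs)).sub (h2.const_mul (Real.exp (r * T)))).congr_deriv ?_
    ring
  have hanti : AntitoneOn h (Icc 0 T) := by
    refine antitoneOn_of_deriv_nonpos (convex_Icc 0 T)
      (fun s hs => (hd s hs).continuousAt.continuousWithinAt) (fun s hs => ?_) fun s hs => ?_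
    · exact (hd s (interior_subset hs)).differentiableAt.differentiableWithinAt
    · have hs' := interior_subset hs
      rw [(hd s hs').deriv]
      have h1 : r * y s + y' s ≤ g s := by linarith [hle s hs']
      have h2 : Real.exp (r * s) * (r * y s + y' s) ≤ Real.exp (r * s) * g s :=
        mul_le_mul_of_nonneg_left h1 (Real.exp_pos _).le
      have h3 : Real.exp (r * s) * g s ≤ Real.exp (r * T) * g s :=
        mul_le_mul_of_nonneg_right
          (Real.exp_le_exp.2 (mul_le_mul_of_nonneg_left hs'.2 hr)) (hg0 s)
      linarith
  have key := hanti (left_mem_Icc.2 hT) (right_mem_Icc.2 hT) hT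
  simp only [h, mul_zero, Real.exp_zero, one_mul, intervalIntegral.integral_same, sub_zero] at key
  have he : Real.exp (-(r * T)) * Real.exp (r * T) = 1 := by
    rw [← Real.exp_add]; simp
  have := mul_le_mul_of_nonneg_left key (Real.exp_pos (-(r * T))).le
  rw [mul_sub, ← mul_assoc, ← mul_assoc, he, one_mul, one_mul] at this
  linarith

/-- The energy of the modes which couple the box with its complement. -/
def faceEnergy (N : ℕ) (F : Lp ℝ 2 (phaseMeasure d)) : ℝ :=
  ∑ j, ∑ k ∈ face N j, (‖mode k F‖ ^ 2 + ‖mode (up k j) F‖ ^ 2) / 2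

lemma faceEnergy_nonneg (N : ℕ) (F : Lp ℝ 2 (phaseMeasure d)) : 0 ≤ faceEnergy N F := by
  unfold faceEnergy; positivity

lemma continuous_faceEnergy (N : ℕ) : Continuous (faceEnergy (d := d) N) := by
  unfold faceEnergy; fun_prop

/-- In a fixed direction `j` the faces for different `N` are disjoint, and so are their shifts by
`e_j`. Parseval bounds each direction by `‖F‖²`, and there are `d` directions. -/
lemma sum_faceEnergy_le (n : ℕ) (F : Lp ℝ 2 (phaseMeasure d)) :
    ∑ N ∈ Finset.range n, faceEnergy N F ≤ d * ‖F‖ ^ 2 := by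
  classical
  have hsum := hasSum_norm_mode_sq F
  have hle : ∀ K : Finset (Fin d → ℕ), ∑ k ∈ K, ‖mode k F‖ ^ 2 ≤ ‖F‖ ^ 2 := fun K =>
    sum_le_hasSum K (fun k _ => sq_nonneg _) hsum
  unfold faceEnergy
  rw [Finset.sum_comm]
  have hj : ∀ j : Fin d, ∑ N ∈ Finset.range n, ∑ k ∈ face N j,
      (‖mode k F‖ ^ 2 + ‖mode (up k j) F‖ ^ 2) / 2 ≤ ‖F‖ ^ 2 := fun j => by
    have hdisj : Set.PairwiseDisjoint (↑(Finset.range n)) fun N => face N j := by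
      intro N _ N' _ hne
      refine Finset.disjoint_left.2 fun k hk hk' => hne ?_
      rw [← (Finset.mem_filter.1 hk).2, ← (Finset.mem_filter.1 hk').2]
    rw [← Finset.sum_biUnion hdisj, ← Finset.sum_div, Finset.sum_add_distrib]
    have h1 := hle ((Finset.range n).biUnion fun N => face N j)
    have h2 := hle (((Finset.range n).biUnion fun N => face N j).image fun k => up k j)
    rw [Finset.sum_image (fun _ _ _ _ h => up_injective j h)] at h2
    linarith
  refine (Finset.sum_le_sum fun j _ => hj j).trans ?_
  simp

/-- Otherwise `η / √(N+1)` would eventually be dominated by a summable sequence, while `∑ 1/√N`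
diverges. -/
lemma exists_sqrt_mul_le {ε : ℕ → ℝ} {B : ℝ} (h0 : ∀ N, 0 ≤ ε N)
    (hB : ∀ n, ∑ N ∈ Finset.range n, ε N ≤ B) {η : ℝ} (hη : 0 < η) (N₀ : ℕ) :
    ∃ N ≥ N₀, √((N : ℝ) + 1) * ε N ≤ η := by
  by_contra! hcon
  have hs : Summable ε := summable_of_sum_range_le h0 hB
  have h1 : Summable fun N : ℕ => η / √((N : ℝ) + 1) := by
    refine (summable_nat_add_iff N₀).1 ?_
    refine Summable.of_nonneg_of_le (fun N => by positivity) (fun N => ?_)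
      ((summable_nat_add_iff N₀).2 hs)
    rw [div_le_iff₀ (by positivity), mul_comm]
    exact (hcon (N + N₀) (Nat.le_add_left _ _)).le
  have h2 : Summable fun N : ℕ => 1 / √(N : ℝ) := by
    refine (summable_nat_add_iff 1).1 ?_
    have := h1.mul_left (1 / η)
    refine this.congr fun N => ?_
    push_cast
    field_simp
  have h3 : Summable fun N : ℕ => 1 / (N : ℝ) ^ (1 / 2 : ℝ) := by
    refine h2.congr fun N => ?_
    rw [Real.sqrt_eq_rpow]
  exact absurd (Real.summable_one_div_nat_rpow.1 h3) (by norm_num)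

lemma norm_sq_eq_integral (u : Lp ℂ 2 (volume : Measure (E d))) : ‖u‖ ^ 2 = ∫ ζ, ‖u ζ‖ ^ 2 := by
  rw [← real_inner_self_eq_norm_sq, L2.inner_def]
  simp only [real_inner_self_eq_norm_sq]

lemma integrable_norm_sq (u : Lp ℂ 2 (volume : Measure (E d))) : Integrable fun ζ => ‖u ζ‖ ^ 2 :=
  (Lp.memLp u).integrable_norm_pow (by norm_num)

/-- The density in frequency of the squared norm. -/
def modeDensity (F : Lp ℝ 2 (phaseMeasure d)) (ζ : E d) : ℝ≥0∞ := ∑' k, ‖mode k F ζ‖ₑ ^ 2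

/-- A set of frequencies and a parameter for which the entropy estimates hold, with a uniform
rate. -/
structure IsAdmissible (L : Collision) (S : Set (E d)) (ρ : ℝ) (D : E d → ℝ) (r : ℝ) : Prop where
  measurableSet : MeasurableSet S
  bound : ∀ ζ ∈ S, ‖(2 * Real.pi) • ζ‖ ≤ ρ
  measurable : Measurable D
  eq_zero : ∀ ζ ∉ S, D ζ = 0
  nonneg : ∀ ζ, 0 ≤ D ζ
  le_two : ∀ ζ, D ζ ≤ 2
  rate_nonneg : 0 ≤ r
  equivalence : ∀ ζ ∈ S, EntropyNormEquivalence ((2 * Real.pi) • ζ) (D ζ)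
  production : ∀ ζ ∈ S, ∃ l ≥ r, EntropyProductionInequality L ((2 * Real.pi) • ζ) (D ζ) l

variable {L : Collision} {S : Set (E d)} {ρ : ℝ} {D : E d → ℝ} {r : ℝ}

lemma IsAdmissible.abs_le (h : IsAdmissible L S ρ D r) (ζ : E d) : |D ζ| ≤ 2 := by
  rw [abs_of_nonneg (h.nonneg ζ)]; exact h.le_two ζ

lemma norm_cut_le (hS : MeasurableSet S) (k : Fin d → ℕ) (F : Lp ℝ 2 (phaseMeasure d)) :
    ‖cut S k F‖ ≤ ‖mode k F‖ := by
  refine Lp.norm_le_norm_of_ae_le ?_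
  filter_upwards [cut_ae hS k F] with ζ h
  rw [h]
  exact norm_indicator_le_norm_self _ _

lemma cut_eq_zero_ae (hS : MeasurableSet S) (F : Lp ℝ 2 (phaseMeasure d)) :
    ∀ᵐ ζ, ζ ∉ S → (fun k => cut S k F ζ) = 0 := by
  filter_upwards [ae_all_iff.2 fun l => cut_ae hS l F] with ζ h hm
  ext k
  rw [h, indicator_of_notMem hm]; rfl

lemma modeEntropy_zero (ξ : E d) (δ : ℝ) (N : ℕ) : modeEntropy ξ δ N 0 = 0 := by
  simp [modeEntropy]

lemma modeEntropyDeriv_zero (ξ : E d) (δ : ℝ) (N : ℕ) : modeEntropyDeriv L ξ δ N 0 = 0 := by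
  simp [modeEntropyDeriv, flux]

lemma IsAdmissible.modeEntropy_nonneg (h : IsAdmissible L S ρ D r) {N : ℕ} (hN : 1 ≤ N) {ζ : E d}
    (hζ : ζ ∈ S) (z : (Fin d → ℕ) → ℂ) : 0 ≤ modeEntropy ((2 * Real.pi) • ζ) (D ζ) N z := by
  refine le_trans ?_ (modeEntropy_bounds (h.equivalence ζ hζ) (h.nonneg ζ) hN z).1
  have := h.le_two ζ
  exact mul_nonneg (by linarith) (by positivity)

/-- The pointwise inequality is integrated over `S`. The rate `l ≥ r` may be lowered to `r` because
the entropy is nonnegative, and the face products are bounded by half the sum of the squares. -/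
lemma IsAdmissible.totalEntropyDeriv_le (h : IsAdmissible L S ρ D r) {N : ℕ} (hN : 2 ≤ N)
    (hρ0 : 0 ≤ ρ) (F : Lp ℝ 2 (phaseMeasure d)) :
    totalEntropyDeriv D N (fun k => cut S k F) (fun k => cutRhs L S k F)
      ≤ -r * totalEntropy D N (fun k => cut S k F) + ρ * (√((N : ℝ) + 1) * faceEnergy N F) := by
  obtain ⟨i1, e1⟩ := totalEntropy_eq h.bound h.measurable h.eq_zero h.abs_le N
    fun k => cut S k F
  obtain ⟨i2, e2⟩ := totalEntropyDeriv_eq L h.bound h.measurable h.eq_zero h.abs_le N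
    (a := fun k => cut S k F) (b := fun k => cutRhs L S k F)
    fun k => cutRhs_ae L h.measurableSet h.bound k F
  have i4 : ∀ j ∈ Finset.univ, ∀ k ∈ face (d := d) N j,
      Integrable fun ζ => (‖cut S k F ζ‖ ^ 2 + ‖cut S (up k j) F ζ‖ ^ 2) / 2 := fun j _ k _ =>
    ((integrable_norm_sq _).add (integrable_norm_sq _)).div_const 2
  have i5 : ∀ j ∈ Finset.univ, Integrable fun ζ => ∑ k ∈ face (d := d) N j,
      (‖cut S k F ζ‖ ^ 2 + ‖cut S (up k j) F ζ‖ ^ 2) / 2 := fun j hj =>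
    integrable_finsetSum _ (i4 j hj)
  have i3 : Integrable fun ζ => ρ * (√((N : ℝ) + 1) * ∑ j, ∑ k ∈ face N j,
      (‖cut S k F ζ‖ ^ 2 + ‖cut S (up k j) F ζ‖ ^ 2) / 2) :=
    ((integrable_finsetSum _ i5).const_mul _).const_mul _
  have hface : ∫ ζ, ρ * (√((N : ℝ) + 1) * ∑ j, ∑ k ∈ face N j,
      (‖cut S k F ζ‖ ^ 2 + ‖cut S (up k j) F ζ‖ ^ 2) / 2)
      ≤ ρ * (√((N : ℝ) + 1) * faceEnergy N F) := by
    rw [integral_const_mul, integral_const_mul, integral_finsetSum _ i5]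
    refine mul_le_mul_of_nonneg_left (mul_le_mul_of_nonneg_left ?_ (Real.sqrt_nonneg _)) hρ0
    refine Finset.sum_le_sum fun j hj => ?_
    rw [integral_finsetSum _ (i4 j hj)]
    refine Finset.sum_le_sum fun k _ => ?_
    rw [integral_div, integral_add (integrable_norm_sq _) (integrable_norm_sq _),
      ← norm_sq_eq_integral, ← norm_sq_eq_integral]
    have h1 := norm_cut_le h.measurableSet k F
    have h2 := norm_cut_le h.measurableSet (up k j) F
    gcongr
  refine le_trans ?_ (add_le_add le_rfl hface)
  rw [e1, e2, ← integral_const_mul, ← integral_add (i1.const_mul _) i3]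
  refine integral_mono_ae i2 ((i1.const_mul _).add i3) ?_
  filter_upwards [cut_eq_zero_ae h.measurableSet F] with ζ hζ
  by_cases hm : ζ ∈ S
  · obtain ⟨l, hl, hp⟩ := h.production ζ hm
    refine (modeEntropyDeriv_le hp hN _).trans (add_le_add ?_ ?_)
    · exact mul_le_mul_of_nonneg_right (neg_le_neg hl) (h.modeEntropy_nonneg (by omega) hm _)
    · refine mul_le_mul (h.bound ζ hm) (mul_le_mul_of_nonneg_left ?_ (Real.sqrt_nonneg _))
        (by positivity) hρ0
      refine Finset.sum_le_sum fun j _ => Finset.sum_le_sum fun k _ => ?_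
      nlinarith [sq_nonneg (‖cut S k F ζ‖ - ‖cut S (up k j) F ζ‖)]
  · simp only [hζ hm, modeEntropyDeriv_zero, modeEntropy_zero, mul_zero, zero_add]
    positivity

lemma IsAdmissible.totalEntropy_decay (h : IsAdmissible L S ρ D r) (hρ0 : 0 ≤ ρ)
    {f₀ : E d × E d → ℝ} {f : ℝ → Lp ℝ 2 (phaseMeasure d)} (hf : IsSolution L f₀ f) {T : ℝ}
    (hT : 0 ≤ T) {N : ℕ} (hN : 2 ≤ N) :
    totalEntropy D N (fun k => cut S k (f T))
      ≤ Real.exp (-(r * T)) * totalEntropy D N (fun k => cut S k (f 0))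
        + ρ * (√((N : ℝ) + 1) * ∫ s in (0 : ℝ)..T, faceEnergy N (f (max s 0))) := by
  have hc := hf.continuous_max
  -- A primitive that agrees with the localized modes of `f s` for `s ≥ 0`, and is differentiable at
  -- every real time, the endpoint `0` included.
  let a : ℝ → (Fin d → ℕ) → Lp ℂ 2 (volume : Measure (E d)) := fun s k =>
    cut S k (f 0) + ∫ σ in (0 : ℝ)..s, cutRhs L S k (f (max σ 0))
  have ha : ∀ s, 0 ≤ s → a s = fun k => cut S k (f s) := fun s hs => by
    ext1 k
    simp only [a]
    rw [ContinuousLinearMap.intervalIntegral_comp_comm _ (hc.intervalIntegrable _ _),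
      ← (hf.isWeakDerivative hs).cut h.measurableSet h.bound k, map_sub]
    abel
  have hda : ∀ s k, HasDerivAt (fun s => a s k) (cutRhs L S k (f (max s 0))) s := fun s k => by
    have hc' : Continuous fun s => cutRhs L S k (f (max s 0)) := (cutRhs L S k).continuous.comp hc
    exact (intervalIntegral.integral_hasDerivAt_right (hc'.intervalIntegrable _ _)
      (hc'.stronglyMeasurableAtFilter _ _) hc'.continuousAt).const_add _
  have hy : ∀ s ∈ Icc 0 T, HasDerivAt (fun s => totalEntropy D N (a s))
      (totalEntropyDeriv D N (a s) fun k => cutRhs L S k (f (max s 0))) s := fun s _ =>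
    hasDerivAt_totalEntropy N (hda s)
  have key := le_of_hasDerivAt_le (g := fun s => ρ * (√((N : ℝ) + 1) * faceEnergy N (f (max s 0))))
    hT h.rate_nonneg hy (((continuous_faceEnergy N).comp hc).const_mul _ |>.const_mul _)
    (fun s => mul_nonneg hρ0 (mul_nonneg (Real.sqrt_nonneg _) (faceEnergy_nonneg _ _)))
    fun s hs => by
      rw [ha s hs.1, max_eq_left hs.1]
      exact h.totalEntropyDeriv_le hN hρ0 (f s)
  simp only [ha T hT, ha 0 le_rfl] at key
  rwa [intervalIntegral.integral_const_mul, intervalIntegral.integral_const_mul] at key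

lemma IsAdmissible.ofReal_totalEntropy (h : IsAdmissible L S ρ D r) {N : ℕ} (hN : 1 ≤ N)
    (F : Lp ℝ 2 (phaseMeasure d)) :
    ENNReal.ofReal (totalEntropy D N fun k => cut S k F)
      = ∫⁻ ζ in S, ENNReal.ofReal (modeEntropy ((2 * Real.pi) • ζ) (D ζ) N fun k => cut S k F ζ) := by
  obtain ⟨i1, e1⟩ := totalEntropy_eq h.bound h.measurable h.eq_zero h.abs_le N
    fun k => cut S k F
  rw [e1, ofReal_integral_eq_lintegral_ofReal i1, ← lintegral_indicator h.measurableSet]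
  · refine lintegral_congr_ae ?_
    filter_upwards [cut_eq_zero_ae h.measurableSet F] with ζ hζ
    by_cases hm : ζ ∈ S
    · rw [indicator_of_mem hm]
    · rw [indicator_of_notMem hm, hζ hm, modeEntropy_zero, ENNReal.ofReal_zero]
  · filter_upwards [cut_eq_zero_ae h.measurableSet F] with ζ hζ
    by_cases hm : ζ ∈ S
    · exact h.modeEntropy_nonneg hN hm _
    · simp only [hζ hm, modeEntropy_zero]; exact le_rfl

lemma sum_cut_eq (hS : MeasurableSet S) (N : ℕ) (F : Lp ℝ 2 (phaseMeasure d)) :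
    ∀ᵐ ζ, ζ ∈ S → ENNReal.ofReal (∑ k ∈ box d N, ‖cut S k F ζ‖ ^ 2)
      = ∑ k ∈ box d N, ‖mode k F ζ‖ₑ ^ 2 := by
  filter_upwards [ae_all_iff.2 fun l => cut_ae hS l F] with ζ h hm
  rw [ENNReal.ofReal_sum_of_nonneg fun _ _ => sq_nonneg _]
  refine Finset.sum_congr rfl fun k _ => ?_
  rw [h, indicator_of_mem hm, ENNReal.ofReal_pow (norm_nonneg _), ofReal_norm]

lemma IsAdmissible.lintegral_le_totalEntropy (h : IsAdmissible L S ρ D r) {N : ℕ} (hN : 1 ≤ N)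
    (F : Lp ℝ 2 (phaseMeasure d)) :
    ∫⁻ ζ in S, ENNReal.ofReal ((2 - D ζ) / 4) * ∑ k ∈ box d N, ‖mode k F ζ‖ₑ ^ 2
      ≤ ENNReal.ofReal (totalEntropy D N fun k => cut S k F) := by
  rw [h.ofReal_totalEntropy hN]
  refine setLIntegral_mono_ae' h.measurableSet ?_
  filter_upwards [sum_cut_eq h.measurableSet N F] with ζ hζ hm
  rw [← hζ hm, ← ENNReal.ofReal_mul (by linarith [h.le_two ζ])]
  exact ENNReal.ofReal_le_ofReal (modeEntropy_bounds (h.equivalence ζ hm) (h.nonneg ζ) hN _).1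

lemma IsAdmissible.totalEntropy_le_lintegral (h : IsAdmissible L S ρ D r) {N : ℕ} (hN : 1 ≤ N)
    (F : Lp ℝ 2 (phaseMeasure d)) :
    ENNReal.ofReal (totalEntropy D N fun k => cut S k F)
      ≤ ∫⁻ ζ in S, ENNReal.ofReal ((2 + D ζ) / 4) * modeDensity F ζ := by
  rw [h.ofReal_totalEntropy hN]
  refine setLIntegral_mono_ae' h.measurableSet ?_
  filter_upwards [sum_cut_eq h.measurableSet N F] with ζ hζ hm
  refine le_trans ?_ (mul_le_mul_right (ENNReal.sum_le_tsum (box d N)) _)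
  rw [← hζ hm, ← ENNReal.ofReal_mul (by linarith [h.nonneg ζ])]
  exact ENNReal.ofReal_le_ofReal (modeEntropy_bounds (h.equivalence ζ hm) (h.nonneg ζ) hN _).2

lemma measurable_mode_enorm (k : Fin d → ℕ) (F : Lp ℝ 2 (phaseMeasure d)) :
    Measurable fun ζ => ‖mode k F ζ‖ₑ ^ 2 :=
  (Lp.stronglyMeasurable _).enorm.pow_const 2

lemma measurable_modeDensity (F : Lp ℝ 2 (phaseMeasure d)) : Measurable (modeDensity F) :=
  Measurable.tsum fun k => measurable_mode_enorm k F

lemma modeDensity_eq_iSup (F : Lp ℝ 2 (phaseMeasure d)) (ζ : E d) :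
    modeDensity F ζ = ⨆ N, ∑ k ∈ box d N, ‖mode k F ζ‖ₑ ^ 2 := by
  refine ENNReal.tsum_eq_iSup_sum' _ fun K => ⟨∑ k ∈ K, ∑ j, k j, fun k hk => mem_box.2 fun j => ?_⟩
  exact (Finset.single_le_sum (f := fun j => k j) (fun _ _ => Nat.zero_le _)
    (Finset.mem_univ j)).trans
    (Finset.single_le_sum (f := fun k : Fin d → ℕ => ∑ j, k j) (fun _ _ => Nat.zero_le _) hk)

/-- Decay in time of the energy of the frequencies in `S`. -/
lemma IsAdmissible.lintegral_decay (h : IsAdmissible L S ρ D r)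
    {f₀ : E d × E d → ℝ} {f : ℝ → Lp ℝ 2 (phaseMeasure d)} (hf : IsSolution L f₀ f) {T : ℝ}
    (hT : 0 ≤ T) :
    ∫⁻ ζ in S, ENNReal.ofReal ((2 - D ζ) / 4) * modeDensity (f T) ζ
      ≤ ENNReal.ofReal (Real.exp (-(r * T))) *
        ∫⁻ ζ in S, ENNReal.ofReal ((2 + D ζ) / 4) * modeDensity (f 0) ζ := by
  -- A negative bound forces `S` to be empty, and `0` then serves as well.
  wlog hρ0 : 0 ≤ ρ generalizing ρ
  · exact this (ρ := 0) { h with bound := fun ζ hζ => (h.bound ζ hζ).trans (le_of_not_ge hρ0) } le_rfl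
  have hc := hf.continuous_max
  set V := ∫⁻ ζ in S, ENNReal.ofReal ((2 + D ζ) / 4) * modeDensity (f 0) ζ with hV
  let ε : ℕ → ℝ := fun N => ∫ s in (0 : ℝ)..T, faceEnergy N (f (max s 0))
  have hcN : ∀ N, Continuous fun s => faceEnergy N (f (max s 0)) := fun N =>
    (continuous_faceEnergy N).comp hc
  have hε0 : ∀ N, 0 ≤ ε N := fun N =>
    intervalIntegral.integral_nonneg hT fun s _ => faceEnergy_nonneg _ _
  have hεB : ∀ n, ∑ N ∈ Finset.range n, ε N ≤ ∫ s in (0 : ℝ)..T, d * ‖f (max s 0)‖ ^ 2 := fun n => by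
    simp only [ε]
    rw [← intervalIntegral.integral_finsetSum fun N _ => (hcN N).intervalIntegrable _ _]
    refine intervalIntegral.integral_mono_on hT ?_ ?_ fun s _ => sum_faceEnergy_le n _
    · exact (continuous_finsetSum _ fun N _ => hcN N).intervalIntegrable _ _
    · exact ((hc.norm.pow 2).const_mul _).intervalIntegrable _ _
  -- The box on the left is kept fixed while a larger `N` with small face error is selected; after
  -- `η → 0`, monotone convergence in `N₀` recovers the full density.
  have hN₀ : ∀ N₀, ∫⁻ ζ in S, ENNReal.ofReal ((2 - D ζ) / 4) *
      ∑ k ∈ box d N₀, ‖mode k (f T) ζ‖ₑ ^ 2 ≤ ENNReal.ofReal (Real.exp (-(r * T))) * V :=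
    fun N₀ => by
      refine ENNReal.le_of_forall_pos_le_add fun η hη _ => ?_
      have hη' : (0 : ℝ) < η := hη
      -- The error is multiplied by `ρ` later, and `ρ η / (ρ + 1) ≤ η` even if `ρ = 0`.
      obtain ⟨N, hN, hle⟩ := exists_sqrt_mul_le hε0 hεB (η := η / (ρ + 1)) (by positivity)
        (max N₀ 2)
      have hN2 : 2 ≤ N := (le_max_right _ _).trans hN
      calc _ ≤ ∫⁻ ζ in S, ENNReal.ofReal ((2 - D ζ) / 4) *
            ∑ k ∈ box d N, ‖mode k (f T) ζ‖ₑ ^ 2 := by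
            refine lintegral_mono fun ζ => mul_le_mul_right ?_ _
            exact Finset.sum_le_sum_of_subset (box_mono ((le_max_left _ _).trans hN))
        _ ≤ ENNReal.ofReal (totalEntropy D N fun k => cut S k (f T)) :=
            h.lintegral_le_totalEntropy (by omega) _
        _ ≤ ENNReal.ofReal (Real.exp (-(r * T)) * totalEntropy D N (fun k => cut S k (f 0)) + η) := by
            refine ENNReal.ofReal_le_ofReal ((h.totalEntropy_decay hρ0 hf hT hN2).trans
              (add_le_add le_rfl ?_))
            refine (mul_le_mul_of_nonneg_left hle hρ0).trans ?_
            rw [mul_div_assoc', div_le_iff₀ (by positivity)]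
            nlinarith
        _ ≤ ENNReal.ofReal (Real.exp (-(r * T)) * totalEntropy D N (fun k => cut S k (f 0)))
            + ENNReal.ofReal η := ENNReal.ofReal_add_le
        _ ≤ _ := by
            rw [ENNReal.ofReal_mul (Real.exp_pos _).le, ENNReal.ofReal_coe_nnreal]
            gcongr
            exact h.totalEntropy_le_lintegral (by omega) _
  simp_rw [modeDensity_eq_iSup (f T), ENNReal.mul_iSup]
  rw [lintegral_iSup]
  · exact iSup_le hN₀
  · intro N
    refine Measurable.mul ?_ (Finset.measurable_sum _ fun k _ => measurable_mode_enorm k _)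
    exact ENNReal.measurable_ofReal.comp ((measurable_const.sub h.measurable).div_const 4)
  · intro N N' hNN' ζ
    exact mul_le_mul_right (Finset.sum_le_sum_of_subset (box_mono hNN')) _

end decay

/-! ### Pointwise decay in frequency -/

section pointwise
variable {d : ℕ}

/-- Restricting to rational rates keeps the family of frequency sets countable; continuity of the
exponential restores the exact rate. The maximum with `0` keeps the rates nonnegative. -/
lemma le_of_forall_rat {X K : ℝ≥0∞} {l t : ℝ} (hl : 0 ≤ l)
    (h : ∀ q : ℚ, max (q : ℝ) 0 ≤ l → X ≤ ENNReal.ofReal (Real.exp (-(max (q : ℝ) 0 * t))) * K) :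
    X ≤ ENNReal.ofReal (Real.exp (-(l * t))) * K := by
  obtain ⟨u, -, hu, hlim⟩ := Real.exists_seq_rat_strictMono_tendsto l
  have h1 : Filter.Tendsto (fun n => max (u n : ℝ) 0) Filter.atTop (nhds l) := by
    simpa [max_eq_left hl] using hlim.max (tendsto_const_nhds (x := (0 : ℝ)))
  have h2 : Filter.Tendsto (fun n => ENNReal.ofReal (Real.exp (-(max (u n : ℝ) 0 * t))))
      Filter.atTop (nhds (ENNReal.ofReal (Real.exp (-(l * t))))) :=
    ENNReal.tendsto_ofReal (Real.continuous_exp.continuousAt.tendsto.comp (h1.mul_const t).neg)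
  refine ge_of_tendsto (ENNReal.Tendsto.mul_const h2 (Or.inl ?_))
    (Filter.Eventually.of_forall fun n => h (u n) (max_le (hu n).le hl))
  simp [Real.exp_pos]

/-- Decay in time at almost every frequency. -/
lemma modeDensity_decay {L : Collision} {f₀ : E d × E d → ℝ} {f : ℝ → Lp ℝ 2 (phaseMeasure d)}
    (hd : 1 ≤ d) (hf : IsSolution L f₀ f) {δ lam : ℝ → ℝ}
    (hδ : ContinuousOn δ (Ioi 0)) (hlam : ContinuousOn lam (Ioi 0))
    (hδ2 : ∀ s : ℝ, 0 < s → 0 < δ s ∧ δ s < 2) (hlam0 : ∀ s : ℝ, 0 < s → 0 < lam s)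
    (hprod : ∀ ξ : E d, ξ ≠ 0 → EntropyProductionInequality L ξ (δ ‖ξ‖) (lam ‖ξ‖))
    (hequiv : ∀ ξ : E d, ξ ≠ 0 → EntropyNormEquivalence ξ (δ ‖ξ‖)) {t : ℝ} (ht : 0 ≤ t) :
    ∀ᵐ ζ : E d, modeDensity (f t) ζ ≤ ENNReal.ofReal
      ((2 + δ ‖(2 * Real.pi) • ζ‖) / (2 - δ ‖(2 * Real.pi) • ζ‖) *
        Real.exp (-(lam ‖(2 * Real.pi) • ζ‖ * t))) * modeDensity (f 0) ζ := by
  have : Nonempty (Fin d) := ⟨⟨0, hd⟩⟩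
  let s : E d → ℝ := fun ζ => ‖(2 * Real.pi) • ζ‖
  have hne : ∀ {ζ : E d}, ζ ≠ 0 → (2 * Real.pi) • ζ ≠ 0 := fun h =>
    smul_ne_zero (by positivity) h
  have hs0 : ∀ {ζ : E d}, ζ ≠ 0 → 0 < s ζ := fun h => norm_pos_iff.2 (hne h)
  have hsc : Continuous s := by fun_prop
  have hDm : Measurable fun ζ => δ (s ζ) :=
    measurable_of_continuousOn_compl_singleton 0 (hδ.comp hsc.continuousOn fun ζ h => hs0 h)
  have hΛm : Measurable fun ζ => lam (s ζ) :=
    measurable_of_continuousOn_compl_singleton 0 (hlam.comp hsc.continuousOn fun ζ h => hs0 h)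
  -- Bounded frequencies at which the rate is at least `max q 0`: the sets on which a uniform
  -- estimate holds. Countably many of them suffice.
  let A : ℚ → ℕ → Set (E d) := fun q n => {ζ | ζ ≠ 0 ∧ s ζ ≤ n ∧ max (q : ℝ) 0 ≤ lam (s ζ)}
  have hA : ∀ q n, MeasurableSet (A q n) := fun q n =>
    (measurableSet_singleton (0 : E d)).compl.inter
      ((measurableSet_le hsc.measurable measurable_const).inter
        (measurableSet_le measurable_const hΛm))
  let u : E d → ℝ≥0∞ := fun ζ => ENNReal.ofReal ((2 - δ (s ζ)) / 4) * modeDensity (f t) ζ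
  let w : E d → ℝ≥0∞ := fun ζ => ENNReal.ofReal ((2 + δ (s ζ)) / 4) * modeDensity (f 0) ζ
  have hu : Measurable u := (ENNReal.measurable_ofReal.comp
    ((measurable_const.sub hDm).div_const 4)).mul (measurable_modeDensity _)
  have key : ∀ q n, ∀ᵐ ζ : E d, (A q n).indicator u ζ
      ≤ (A q n).indicator (fun ζ => ENNReal.ofReal (Real.exp (-(max (q : ℝ) 0 * t))) * w ζ) ζ :=
    fun q n => by
      -- The integrated decay holds on every measurable part of `A q n`, hence pointwise almost
      -- everywhere.
      refine ae_le_of_forall_setLIntegral_le_of_sigmaFinite (hu.indicator (hA q n))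
        fun B hB _ => ?_
      rw [lintegral_indicator (hA q n), lintegral_indicator (hA q n),
        Measure.restrict_restrict (hA q n), lintegral_const_mul' _ _ ENNReal.ofReal_ne_top]
      have hS : MeasurableSet (A q n ∩ B) := (hA q n).inter hB
      have hadm : IsAdmissible L (A q n ∩ B) n ((A q n ∩ B).indicator fun ζ => δ (s ζ))
          (max (q : ℝ) 0) :=
        { measurableSet := hS
          bound := fun ζ hζ => hζ.1.2.1
          measurable := hDm.indicator hS
          eq_zero := fun ζ hζ => indicator_of_notMem hζ _
          nonneg := fun ζ => indicator_nonneg (fun ζ hζ => (hδ2 _ (hs0 hζ.1.1)).1.le) ζ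
          le_two := fun ζ => by
            by_cases hζ : ζ ∈ A q n ∩ B
            · rw [indicator_of_mem hζ]; exact (hδ2 _ (hs0 hζ.1.1)).2.le
            · rw [indicator_of_notMem hζ]; exact zero_le_two
          rate_nonneg := le_max_right _ _
          equivalence := fun ζ hζ => by
            rw [indicator_of_mem hζ]; exact hequiv _ (hne hζ.1.1)
          production := fun ζ hζ => by
            rw [indicator_of_mem hζ]
            exact ⟨_, hζ.1.2.2, hprod _ (hne hζ.1.1)⟩ }
      convert! hadm.lintegral_decay hf ht using 1
      · refine setLIntegral_congr_fun hS fun ζ hζ => ?_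
        simp only [indicator_of_mem hζ, u]
      · congr 1
        refine setLIntegral_congr_fun hS fun ζ hζ => ?_
        simp only [indicator_of_mem hζ, w]
  have h0 : ∀ᵐ ζ : E d, ζ ≠ 0 := by simp [ae_iff]
  filter_upwards [ae_all_iff.2 fun q => ae_all_iff.2 (key q), h0] with ζ hζ hζ0
  obtain ⟨n, hn⟩ := exists_nat_ge (s ζ)
  have hw : u ζ ≤ ENNReal.ofReal (Real.exp (-(lam (s ζ) * t))) * w ζ := by
    refine le_of_forall_rat (hlam0 _ (hs0 hζ0)).le fun q hq => ?_
    have hm : ζ ∈ A q n := ⟨hζ0, hn, hq⟩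
    simpa only [indicator_of_mem hm] using hζ q n
  obtain ⟨hδp, hδl⟩ := hδ2 _ (hs0 hζ0)
  have hp : 0 < 2 - δ (s ζ) := by linarith
  calc modeDensity (f t) ζ = ENNReal.ofReal (4 / (2 - δ (s ζ))) * u ζ := by
        simp only [u]
        rw [← mul_assoc, ← ENNReal.ofReal_mul (by positivity),
          div_mul_div_cancel₀' (by norm_num) _ _, div_self hp.ne', ENNReal.ofReal_one, one_mul]
    _ ≤ ENNReal.ofReal (4 / (2 - δ (s ζ))) *
        (ENNReal.ofReal (Real.exp (-(lam (s ζ) * t))) * w ζ) := mul_le_mul_right hw _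
    _ = _ := by
        simp only [w]
        rw [← mul_assoc, ← mul_assoc, ← ENNReal.ofReal_mul (by positivity),
          ← ENNReal.ofReal_mul (by positivity)]
        congr 2
        simp only [s]
        field_simp

end pointwise

/-! ### Low frequencies -/

section low
variable {d : ℕ}

lemma eLpNorm_two_sq {α ε : Type*} [MeasurableSpace α] [ENorm ε] (g : α → ε) (μ : Measure α) :
    eLpNorm g 2 μ ^ 2 = ∫⁻ a, ‖g a‖ₑ ^ 2 ∂μ := by
  rw [eLpNorm_eq_lintegral_rpow_enorm_toReal (by simp) (by simp), ← ENNReal.rpow_natCast,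
    ← ENNReal.rpow_mul]
  simp

lemma mixedNorm_congr {F G : E d × E d → ℝ} (h : F =ᵐ[phaseMeasure d] G) :
    mixedNorm F = mixedNorm G := by
  refine eLpNorm_congr_ae ?_
  have h1 : ∀ᵐ z ∂((gammaMeasure d).prod (volume : Measure (E d))), F z.swap = G z.swap :=
    (Measure.measurePreserving_swap (μ := gammaMeasure d)
      (ν := (volume : Measure (E d)))).quasiMeasurePreserving.ae h
  filter_upwards [Measure.ae_ae_of_ae_prod h1] with v hv
  exact eLpNorm_congr_ae hv

open FourierTransform in
/-- The Fourier transform in `L²` of an integrable function is given by the Fourier integral. -/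
lemma fourierReal_eq_fourier (c : Lp ℝ 2 (volume : Measure (E d))) (hc : Integrable c) :
    ∀ᵐ ζ, fourierReal c ζ = 𝓕 (fun x => (c x : ℂ)) ζ := by
  have hcont : Continuous (𝓕 (fun x => (c x : ℂ))) :=
    VectorFourier.fourierIntegral_continuous (μ := (volume : Measure (E d))) (L := innerₗ (E d))
      Real.continuous_fourierChar (by exact continuous_inner) hc.ofReal
  refine ae_eq_of_integral_contDiff_smul_eq ((Lp.memLp _).locallyIntegrable (by norm_num))
    hcont.locallyIntegrable fun g hg hs => ?_
  have hgc : ContDiff ℝ ∞ (fun x => (g x : ℂ)) := Complex.ofRealCLM.contDiff.comp hg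
  have hsc : HasCompactSupport (fun x => (g x : ℂ)) := hs.comp_left (g := Complex.ofReal) (by simp)
  set Φ : SchwartzMap (E d) ℂ := 𝓕⁻ (hsc.toSchwartzMap hgc) with hΦ
  have hFΦ : ∀ ζ, 𝓕 Φ ζ = (g ζ : ℂ) := fun ζ => by
    rw [hΦ, FourierTransform.fourier_fourierInv_eq]; rfl
  -- As `g` is real, conjugating its inverse transform gives its direct transform.
  have hΦc : ∀ x, (starRingEnd ℂ) (Φ x) = 𝓕 (fun x => (g x : ℂ)) x := fun x => by
    have e : Φ x = 𝓕⁻ (fun x => (g x : ℂ)) x := by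
      rw [hΦ, SchwartzMap.fourierInv_coe]; rfl
    rw [e, Real.fourierInv_eq', Real.fourier_eq', ← integral_conj]
    congr 1; ext v
    simp only [smul_eq_mul, map_mul, Complex.conj_ofReal, ← Complex.exp_conj, Complex.conj_I]
    congr 2; push_cast; ring
  have h1 := integral_conj_fourier_mul_fourierReal Φ c
  simp_rw [hFΦ, Complex.conj_ofReal] at h1
  simp only [Complex.real_smul]
  rw [h1, ← integral_conj]
  simp_rw [map_mul, Complex.conj_ofReal, hΦc]
  have hgi : Integrable fun x => (g x : ℂ) := hgc.continuous.integrable_of_hasCompactSupport hsc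
  have key := VectorFourier.integral_fourierIntegral_smul_eq_flip (μ := (volume : Measure (E d)))
    (ν := (volume : Measure (E d))) (L := innerₗ (E d)) (f := fun x => (g x : ℂ))
    (g := fun x => (c x : ℂ))
    Real.continuous_fourierChar (by exact continuous_inner) hgi hc.ofReal
  rw [flip_innerₗ] at key
  simp only [smul_eq_mul] at key
  refine Eq.trans ?_ key
  congr 1; ext x
  exact mul_comm _ _

lemma hermiteFun_memLp (k : Fin d → ℕ) :
    MemLp (fun v => maxwellian v • (hermiteFun k v : ℂ)) 2 (gammaMeasure d) := by
  have h : ExpGrowth fun v : E d => (hermiteFun k v : ℂ) :=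
    (expGrowth_hermiteFun k).mono fun v => by simp
  exact h.memLp_maxwellian_smul
    (Complex.continuous_ofReal.comp (continuous_hermiteFun k)).aestronglyMeasurable

/-- The Hermite functions, as elements of `L²(dγ)`. -/
def hermiteVec (k : Fin d → ℕ) : Lp ℂ 2 (gammaMeasure d) := (hermiteFun_memLp k).toLp

lemma inner_hermiteVec (k : Fin d → ℕ) {G : E d → ℂ} (hG : MemLp G 2 (gammaMeasure d)) :
    inner ℂ (hermiteVec k) hG.toLp = ∫ v, (hermiteFun k v : ℂ) * G v := by
  rw [L2.inner_def, ← integral_gamma_maxwellian_smul]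
  refine integral_congr_ae ?_
  filter_upwards [(hermiteFun_memLp k).coeFn_toLp, hG.coeFn_toLp] with v h1 h2
  rw [hermiteVec, h1, h2]
  simp; ring

lemma orthonormal_hermiteVec : Orthonormal ℂ (hermiteVec (d := d)) := by
  classical
  rw [orthonormal_iff_ite]
  intro k l
  rw [show hermiteVec l = (hermiteFun_memLp l).toLp from rfl, inner_hermiteVec]
  have e : ∀ v : E d, (hermiteFun k v : ℂ) * (maxwellian v • (hermiteFun l v : ℂ))
      = ((hermiteFun k v * hermiteFun l v * maxwellian v : ℝ) : ℂ) := fun v => by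
    simp; ring
  simp_rw [e]
  rw [integral_complex_ofReal, integral_hermiteFun_mul_hermiteFun]
  split_ifs <;> simp

variable {F : Lp ℝ 2 (phaseMeasure d)}

lemma memLp_integral_norm (hF : mixedNorm F < ⊤) :
    MemLp (fun v => ∫ x, ‖F (x, v)‖) 2 (gammaMeasure d) ∧
      eLpNorm (fun v => ∫ x, ‖F (x, v)‖) 2 (gammaMeasure d) ≤ mixedNorm F := by
  have hsm := (Lp.stronglyMeasurable F).norm
  have hm : AEStronglyMeasurable (fun v => ∫ x, ‖F (x, v)‖) (gammaMeasure d) :=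
    (hsm.integral_prod_left' (μ := (volume : Measure (E d)))).aestronglyMeasurable
  have hle : eLpNorm (fun v => ∫ x, ‖F (x, v)‖) 2 (gammaMeasure d) ≤ mixedNorm F := by
    refine eLpNorm_mono_enorm fun v => ?_
    refine (enorm_integral_le_lintegral_enorm _).trans ?_
    simp [eLpNorm_one_eq_lintegral_enorm]
  exact ⟨⟨hm, hle.trans_lt hF⟩, hle⟩

lemma ae_integrable_section (hF : mixedNorm F < ⊤) :
    ∀ᵐ v ∂(gammaMeasure d), Integrable fun x => F (x, v) := by
  have hsm := Lp.stronglyMeasurable F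
  have h1 : ∫⁻ v, eLpNorm (fun x => F (x, v)) 1 volume ^ 2 ∂(gammaMeasure d) < ⊤ := by
    have := eLpNorm_two_sq (fun v : E d => eLpNorm (fun x => F (x, v)) 1 volume) (gammaMeasure d)
    simp only [enorm_eq_self] at this
    rw [← this]
    exact ENNReal.pow_lt_top hF
  have hmeas : Measurable fun v : E d => eLpNorm (fun x => F (x, v)) 1 volume := by
    simp_rw [eLpNorm_one_eq_lintegral_enorm]
    exact (hsm.enorm).lintegral_prod_left'
  filter_upwards [ae_lt_top (hmeas.pow_const 2) h1.ne] with v hv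
  have hx : StronglyMeasurable fun x => F (x, v) := hsm.comp_measurable measurable_prodMk_right
  refine memLp_one_iff_integrable.1 ⟨hx.aestronglyMeasurable, ?_⟩
  by_contra hcon
  rw [not_lt, top_le_iff] at hcon
  simp [hcon] at hv

/-- Cauchy-Schwarz in `L²(dγ)` between the `L¹(dx)` norm of the sections and `h_k 𝓜`. Integrability
in `x` is what allows pointwise Fourier integrals. -/
lemma integrable_mul_hermiteFun (hF : mixedNorm F < ⊤) (k : Fin d → ℕ) :
    Integrable fun z : E d × E d => F z * hermiteFun k z.2 := by
  have hm : AEStronglyMeasurable (fun z : E d × E d => F z * hermiteFun k z.2) volume :=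
    (aestronglyMeasurable_volume F).mul
      ((continuous_hermiteFun k).comp continuous_snd).aestronglyMeasurable
  rw [Measure.volume_eq_prod] at hm ⊢
  rw [integrable_prod_iff' hm]
  constructor
  · filter_upwards [volume_ac_gammaMeasure.ae_le (ae_integrable_section hF)] with v hv
    exact hv.mul_const _
  · rw [← integrable_gamma_maxwellian_smul_iff]
    have h1 := (expGrowth_hermiteFun k).memLp_maxwellian_smul
      (continuous_hermiteFun k).aestronglyMeasurable
    refine ((memLp_integral_norm hF).1.integrable_mul h1.norm).congr
      (Filter.Eventually.of_forall fun v => ?_)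
    simp only [norm_mul, Pi.mul_apply, integral_mul_const, smul_eq_mul,
      Real.norm_of_nonneg (maxwellian_pos v).le]
    ring

/-- Identifies the coefficient, defined as an adjoint, with the actual velocity integral by testing
in `x`. -/
lemma coeff_ae_eq (hF : mixedNorm F < ⊤) (k : Fin d → ℕ) :
    ∀ᵐ x, coeff k F x = ∫ v, F (x, v) * hermiteFun k v := by
  have hi := integrable_mul_hermiteFun hF k
  rw [Measure.volume_eq_prod] at hi
  refine ae_eq_of_integral_contDiff_smul_eq ((Lp.memLp _).locallyIntegrable (by norm_num))
    hi.integral_prod_left.locallyIntegrable fun g hg hs => ?_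
  have h1 := integral_coeff_mul k F (memLp_of_contDiff hg hs)
  have h2 : Integrable fun z : E d × E d => F z * (g z.1 * hermiteFun k z.2) :=
    integrable_mul_of_growth (Lp.memLp F) (memLp_of_contDiff hg hs) (expGrowth_hermiteFun k)
      (continuous_hermiteFun k)
  rw [Measure.volume_eq_prod] at h1 h2
  rw [integral_prod _ h2] at h1
  simp only [smul_eq_mul]
  simp_rw [mul_comm (g _)]
  rw [h1]
  congr 1; ext x
  rw [← integral_mul_const]
  congr 1; ext v
  simp only; ring

open FourierTransform in
-- Fubini: Fourier transform in `x` and Hermite coefficient in `v` commute. At a fixed frequency the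
-- modes are thus the Hermite coefficients of one function of `v`.
lemma mode_ae_eq (hF : mixedNorm F < ⊤) (k : Fin d → ℕ) :
    ∀ᵐ ζ, mode k F ζ = ∫ v, (hermiteFun k v : ℂ) * 𝓕 (fun x => (F (x, v) : ℂ)) ζ := by
  have hi := integrable_mul_hermiteFun hF k
  rw [Measure.volume_eq_prod] at hi
  have hc : Integrable (coeff k F) :=
    hi.integral_prod_left.congr ((coeff_ae_eq hF k).mono fun x hx => hx.symm)
  filter_upwards [fourierReal_eq_fourier (coeff k F) hc] with ζ hζ
  rw [mode, ContinuousLinearMap.comp_apply, hζ, Real.fourier_eq']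
  have e1 : ∫ x, Complex.exp (↑(-2 * Real.pi * inner ℝ x ζ) * Complex.I) • (coeff k F x : ℂ)
      = ∫ x, ∫ v, Complex.exp (↑(-2 * Real.pi * inner ℝ x ζ) * Complex.I) *
        ((F (x, v) * hermiteFun k v : ℝ) : ℂ) := by
    refine integral_congr_ae ?_
    filter_upwards [coeff_ae_eq hF k] with x hx
    rw [hx, integral_const_mul, integral_complex_ofReal, smul_eq_mul]
  rw [e1, integral_integral_swap]
  · congr 1; ext v
    rw [Real.fourier_eq', ← integral_const_mul]
    congr 1; ext x
    simp only [smul_eq_mul]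
    push_cast; ring
  · have hexp : Continuous fun z : E d × E d =>
        Complex.exp (((-2 * Real.pi * inner ℝ z.1 ζ : ℝ) : ℂ) * Complex.I) := by fun_prop
    have hone : ∀ z : E d × E d,
        ‖Complex.exp (((-2 * Real.pi * inner ℝ z.1 ζ : ℝ) : ℂ) * Complex.I)‖ ≤ 1 := fun z => by
      rw [Complex.norm_exp_ofReal_mul_I]
    exact (hi.ofReal (𝕜 := ℂ)).bdd_mul hexp.aestronglyMeasurable
      (Filter.Eventually.of_forall hone)

open FourierTransform in
/-- Bound on the density at almost every frequency. -/
lemma modeDensity_le_mixedNorm (hF : mixedNorm F < ⊤) :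
    ∀ᵐ ζ, modeDensity F ζ ≤ mixedNorm F ^ 2 := by
  filter_upwards [ae_all_iff.2 fun k => mode_ae_eq hF k] with ζ hζ
  -- `|G v|` is at most the `L¹(dx)` norm of the section at `v`, so the norm of `G` in `L²(dγ)` is
  -- at most the mixed norm. Bessel's inequality then bounds the sum over `k`.
  let G : E d → ℂ := fun v => 𝓕 (fun x => (F (x, v) : ℂ)) ζ
  have hGm : AEStronglyMeasurable G (gammaMeasure d) := by
    have hexp : Continuous fun z : E d × E d =>
        Complex.exp (((-2 * Real.pi * inner ℝ z.1 ζ : ℝ) : ℂ) * Complex.I) := by fun_prop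
    have h1 : StronglyMeasurable fun z : E d × E d =>
        Complex.exp (((-2 * Real.pi * inner ℝ z.1 ζ : ℝ) : ℂ) * Complex.I) • (F z : ℂ) := by
      refine hexp.stronglyMeasurable.smul ?_
      exact Complex.continuous_ofReal.comp_stronglyMeasurable (Lp.stronglyMeasurable F)
    have h2 := (h1.integral_prod_left' (μ := (volume : Measure (E d)))).aestronglyMeasurable
      (μ := gammaMeasure d)
    refine h2.congr (Filter.Eventually.of_forall fun v => ?_)
    simp only [G, Real.fourier_eq']
  have hGb : ∀ v, ‖G v‖ ≤ ‖∫ x, ‖F (x, v)‖‖ := fun v => by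
    simp only [G, Real.fourier_eq']
    refine (norm_integral_le_integral_norm _).trans ((le_of_eq ?_).trans (le_abs_self _))
    congr 1; ext x
    rw [norm_smul, Complex.norm_exp_ofReal_mul_I, one_mul, Complex.norm_real]
  have hG : MemLp G 2 (gammaMeasure d) :=
    (memLp_integral_norm hF).1.mono hGm (Filter.Eventually.of_forall hGb)
  have hGn : ‖hG.toLp‖ₑ ≤ mixedNorm F := by
    rw [Lp.enorm_toLp]
    exact (eLpNorm_mono hGb).trans (memLp_integral_norm hF).2
  rw [modeDensity, ENNReal.tsum_eq_iSup_sum]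
  refine iSup_le fun K => ?_
  have hB := orthonormal_hermiteVec.sum_inner_products_le (s := K) hG.toLp
  simp_rw [inner_hermiteVec] at hB
  calc ∑ k ∈ K, ‖mode k F ζ‖ₑ ^ 2
      = ENNReal.ofReal (∑ k ∈ K, ‖∫ v, (hermiteFun k v : ℂ) * G v‖ ^ 2) := by
        rw [ENNReal.ofReal_sum_of_nonneg fun _ _ => sq_nonneg _]
        refine Finset.sum_congr rfl fun k _ => ?_
        rw [hζ, ENNReal.ofReal_pow (norm_nonneg _), ofReal_norm]
    _ ≤ ENNReal.ofReal (‖hG.toLp‖ ^ 2) := ENNReal.ofReal_le_ofReal hB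
    _ = ‖hG.toLp‖ₑ ^ 2 := by rw [ENNReal.ofReal_pow (norm_nonneg _), ofReal_norm]
    _ ≤ _ := by gcongr

end low

/-! ### Splitting of the frequencies -/

section splitting
variable {d : ℕ}

/-- Parseval in the velocity and Plancherel in `x`. With the character `exp(-2π i x · ζ)` no
constant appears. -/
lemma lintegral_modeDensity (F : Lp ℝ 2 (phaseMeasure d)) :
    ∫⁻ ζ, modeDensity F ζ = eLpNorm F 2 (phaseMeasure d) ^ 2 := by
  have h := hasSum_norm_mode_sq F
  have e1 : ∀ k : Fin d → ℕ, ∫⁻ ζ, ‖mode k F ζ‖ₑ ^ 2 = ENNReal.ofReal (‖mode k F‖ ^ 2) := fun k => by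
    rw [ENNReal.ofReal_pow (norm_nonneg _), ofReal_norm, Lp.enorm_def, eLpNorm_two_sq]
  simp only [modeDensity]
  rw [lintegral_tsum fun k => (measurable_mode_enorm k F).aemeasurable]
  simp_rw [e1]
  rw [← ENNReal.ofReal_tsum_of_nonneg (fun k => sq_nonneg _) h.summable, h.tsum_eq,
    ENNReal.ofReal_pow (norm_nonneg _), ofReal_norm, Lp.enorm_def]

/-- Integration of a radial function in polar coordinates. -/
lemma lintegral_norm_eq (hd : 1 ≤ d) {g : ℝ → ℝ≥0∞} (hg : Measurable g) :
    ∫⁻ x : E d, g ‖x‖ = (volume : Measure (E d)).toSphere univ *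
      ∫⁻ r in Ioi (0 : ℝ), ENNReal.ofReal (r ^ (d - 1)) * g r := by
  have : Nonempty (Fin d) := ⟨⟨0, hd⟩⟩
  have hmp := Measure.measurePreserving_homeomorphUnitSphereProd (volume : Measure (E d))
  rw [finrank_euclideanSpace_fin] at hmp
  have h1 : ∫⁻ x : E d, g ‖x‖ = ∫⁻ x in ({0}ᶜ : Set (E d)), g ‖x‖ := by
    rw [Measure.restrict_eq_self_of_ae_mem]
    simp [ae_iff]
  have hgm : Measurable fun p : Metric.sphere (0 : E d) 1 × Ioi (0 : ℝ) => g p.2 :=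
    hg.comp (measurable_subtype_coe.comp measurable_snd)
  have h2 := hmp.lintegral_comp hgm
  simp only [homeomorphUnitSphereProd_apply_snd_coe] at h2
  have hgI : AEMeasurable (fun r : Ioi (0 : ℝ) => g r) (Measure.volumeIoiPow (d - 1)) :=
    (hg.comp measurable_subtype_coe).aemeasurable
  have h3 := lintegral_prod_mul (μ := (volume : Measure (E d)).toSphere)
    (ν := Measure.volumeIoiPow (d - 1)) (f := fun _ => 1) aemeasurable_const hgI
  simp only [one_mul, lintegral_const] at h3
  have h4 := lintegral_withDensity_eq_lintegral_mul
    (Measure.comap Subtype.val (volume : Measure ℝ))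
    (f := fun r : Ioi (0 : ℝ) => ENNReal.ofReal ((r : ℝ) ^ (d - 1))) (by fun_prop)
    (g := fun r : Ioi (0 : ℝ) => g r) (hg.comp measurable_subtype_coe)
  rw [h1, ← lintegral_subtype_comap (measurableSet_singleton (0 : E d)).compl fun x => g ‖x‖, h2,
    h3, Measure.volumeIoiPow, h4, ← lintegral_subtype_comap measurableSet_Ioi fun r => ENNReal.ofReal (r ^ (d - 1)) * g r]
  rfl

lemma lintegral_comp_two_pi_smul {g : E d → ℝ≥0∞} (hg : Measurable g) :
    ∫⁻ x : E d, g ((2 * Real.pi) • x) = ENNReal.ofReal ((2 * Real.pi) ^ (-(d : ℝ))) * ∫⁻ x, g x := by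
  have hpi : 0 < 2 * Real.pi := by positivity
  rw [← lintegral_map hg (measurable_const_smul _), Measure.map_addHaar_smul _ hpi.ne',
    lintegral_smul_measure, finrank_euclideanSpace_fin, abs_of_pos (by positivity),
    Real.rpow_neg hpi.le, Real.rpow_natCast]
  rfl

lemma omega_mul (hd : 1 ≤ d) : omega d * d = (volume : Measure (E d)).toSphere univ :=
  ENNReal.div_mul_cancel (by simpa using (by omega : d ≠ 0)) (by simp)

lemma measurable_indicator_ofReal {c : ℝ → ℝ} {R : ℝ} (hc : ContinuousOn c (Ioc 0 R)) :
    Measurable ((Ioc 0 R).indicator fun s => ENNReal.ofReal (c s)) := by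
  classical
  have h1 : Measurable ((Ioc 0 R).piecewise c fun _ => 0) :=
    hc.measurable_piecewise continuousOn_const measurableSet_Ioc
  convert! ENNReal.measurable_ofReal.comp h1 using 1
  ext s
  by_cases hs : s ∈ Ioc 0 R
  · simp only [Function.comp_apply, piecewise_eq_of_mem _ _ _ hs, indicator_of_mem hs]
  · simp only [Function.comp_apply, piecewise_eq_of_notMem _ _ _ hs, indicator_of_notMem hs,
      ENNReal.ofReal_zero]

/-- The change of variables `ξ = 2π ζ` produces the factor `(2π)^{-d}`, and polar coordinates the
area `d ω_d` of the sphere. -/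
lemma lintegral_radial (hd : 1 ≤ d) {c : ℝ → ℝ} {R : ℝ} (hc : ContinuousOn c (Ioc 0 R)) :
    ∫⁻ ζ : E d, (Ioc 0 R).indicator (fun s => ENNReal.ofReal (c s)) ‖(2 * Real.pi) • ζ‖
      = ENNReal.ofReal ((2 * Real.pi) ^ (-(d : ℝ))) *
        ((∫⁻ s in Ioc 0 R, ENNReal.ofReal (c s * s ^ (d - 1))) * omega d * d) := by
  have hm := measurable_indicator_ofReal hc
  rw [lintegral_comp_two_pi_smul (g := fun x => (Ioc 0 R).indicator
      (fun s => ENNReal.ofReal (c s)) ‖x‖) (hm.comp measurable_norm), lintegral_norm_eq hd hm,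
    mul_assoc (lintegral _ _), omega_mul hd, mul_comm (lintegral _ _)]
  congr 2
  have e : ∀ r, ENNReal.ofReal (r ^ (d - 1)) * (Ioc 0 R).indicator (fun s => ENNReal.ofReal (c s)) r
      = (Ioc 0 R).indicator (fun s => ENNReal.ofReal (s ^ (d - 1)) * ENNReal.ofReal (c s)) r :=
    fun r => by
      by_cases hr : r ∈ Ioc 0 R
      · rw [indicator_of_mem hr, indicator_of_mem hr]
      · rw [indicator_of_notMem hr, indicator_of_notMem hr, mul_zero]
  simp_rw [e]
  rw [lintegral_indicator measurableSet_Ioc, Measure.restrict_restrict measurableSet_Ioc,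
    inter_eq_left.2 Ioc_subset_Ioi_self]
  refine setLIntegral_congr_fun measurableSet_Ioc fun s hs => ?_
  rw [← ENNReal.ofReal_mul (pow_nonneg hs.1.le _), mul_comm]

/-- The bound obtained by splitting the frequencies at `R`. -/
lemma lintegral_le_of_splitting (hd : 1 ≤ d) {C lam : ℝ → ℝ} {t R : ℝ} (ht : 0 ≤ t) (hR : 0 < R)
    (hC : ContinuousOn C (Ioi 0)) (hC0 : ∀ s, 0 < s → 0 ≤ C s)
    (hlam : ContinuousOn lam (Ioi 0)) (hmono : MonotoneOn lam (Ioi 0))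
    {u v : E d → ℝ≥0∞} (hv : Measurable v) {M : ℝ≥0∞}
    (huv : ∀ᵐ ζ : E d, u ζ ≤ ENNReal.ofReal (C ‖(2 * Real.pi) • ζ‖ *
      Real.exp (-(lam ‖(2 * Real.pi) • ζ‖ * t))) * v ζ) (hvM : ∀ᵐ ζ, v ζ ≤ M) :
    ∫⁻ ζ, u ζ ≤ ENNReal.ofReal ((2 * Real.pi) ^ (-(d : ℝ))) *
        ((∫⁻ s in Ioc 0 R, ENNReal.ofReal (C s * Real.exp (-(lam s * t)) * s ^ (d - 1)))
          * omega d * d) * M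
      + (⨆ (s : ℝ) (_ : R ≤ s), ENNReal.ofReal (C s)) *
        ENNReal.ofReal (Real.exp (-(lam R * t))) * ∫⁻ ζ, v ζ := by
  have : Nonempty (Fin d) := ⟨⟨0, hd⟩⟩
  have hcont : ContinuousOn (fun s => C s * Real.exp (-(lam s * t))) (Ioc 0 R) :=
    (hC.mul (hlam.mul continuousOn_const).neg.rexp).mono Ioc_subset_Ioi_self
  have h0 : ∀ᵐ ζ : E d, ζ ≠ 0 := by simp [ae_iff]
  have hm : Measurable fun ζ : E d => (Ioc 0 R).indicator
      (fun s => ENNReal.ofReal (C s * Real.exp (-(lam s * t)))) ‖(2 * Real.pi) • ζ‖ :=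
    (measurable_indicator_ofReal hcont).comp (by fun_prop)
  rw [← lintegral_radial hd hcont, ← lintegral_const_mul _ hv, ← lintegral_mul_const _ hm, ← lintegral_add_right _ (hv.const_mul _)]
  refine lintegral_mono_ae ?_
  filter_upwards [huv, hvM, h0] with ζ h1 h2 h3
  set s := ‖(2 * Real.pi) • ζ‖ with hs
  have hs0 : 0 < s := norm_pos_iff.2 (smul_ne_zero (by positivity) h3)
  refine h1.trans ?_
  by_cases hsR : s ≤ R
  · rw [indicator_of_mem (show s ∈ Ioc 0 R from ⟨hs0, hsR⟩)]
    exact le_add_of_le_of_nonneg (mul_le_mul_right h2 _) zero_le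
  · have hRs : R ≤ s := le_of_not_ge hsR
    refine le_add_of_nonneg_of_le zero_le (mul_le_mul_left ?_ _)
    rw [ENNReal.ofReal_mul (hC0 s hs0)]
    -- At high frequency `C(s)` is at most its supremum over `s ≥ R`, and `lam(s) ≥ lam(R)` by
    -- monotonicity.
    refine mul_le_mul' (le_iSup₂_of_le s hRs le_rfl) (ENNReal.ofReal_le_ofReal ?_)
    refine Real.exp_le_exp.2 (neg_le_neg (mul_le_mul_of_nonneg_right ?_ ht))
    exact hmono hR hs0 hRs

/-- The factor `(2π)^{d/2}` inside `Q` is cancelled by the prefactor `(2π)^{-d}`, leaving constant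
`1` at high frequency. -/
lemma two_pi_rpow_mul (d : ℕ) : ENNReal.ofReal ((2 * Real.pi) ^ (-(d : ℝ))) *
    ENNReal.ofReal ((2 * Real.pi) ^ ((d : ℝ) / 2)) ^ 2 = 1 := by
  have hpi : 0 < 2 * Real.pi := by positivity
  rw [← ENNReal.ofReal_pow (by positivity), ← ENNReal.ofReal_mul (by positivity),
    ← Real.rpow_natCast, ← Real.rpow_mul hpi.le, ← Real.rpow_add hpi]
  have : -(d : ℝ) + (d : ℝ) / 2 * (2 : ℕ) = 0 := by push_cast; ring
  rw [this, Real.rpow_zero, ENNReal.ofReal_one]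

end splitting

end Kinetic

end

/-! ### The decay estimate -/

theorem theorem3 (d : ℕ) (hd : 1 ≤ d) (L : Kinetic.Collision)
    (f₀ : Kinetic.E d × Kinetic.E d → ℝ)
    (hf₀_nonneg : 0 ≤ᵐ[Kinetic.phaseMeasure d] f₀)
    (hf₀_L2 : MemLp f₀ 2 (Kinetic.phaseMeasure d))
    (hf₀_mixed : Kinetic.mixedNorm f₀ < ⊤)
    (f : ℝ → Lp ℝ 2 (Kinetic.phaseMeasure d))
    (hf : Kinetic.IsSolution L f₀ f)
    (δ lam : ℝ → ℝ)
    (hδ_cont : ContinuousOn δ (Ioi 0)) (hlam_cont : ContinuousOn lam (Ioi 0))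
    (hδ_range : ∀ s : ℝ, 0 < s → 0 < δ s ∧ δ s < 2)
    (hlam_pos : ∀ s : ℝ, 0 < s → 0 < lam s)
    (hlam_mono : MonotoneOn lam (Ioi 0))
    (h_entropy : ∀ ξ : Kinetic.E d, ξ ≠ 0 →
      Kinetic.EntropyProductionInequality L ξ (δ ‖ξ‖) (lam ‖ξ‖))
    (h_equiv : ∀ ξ : Kinetic.E d, ξ ≠ 0 → Kinetic.EntropyNormEquivalence ξ (δ ‖ξ‖))
    (t : ℝ) (ht : 0 ≤ t) :
    eLpNorm (f t) 2 (Kinetic.phaseMeasure d) ^ 2 ≤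
      ENNReal.ofReal ((2 * Real.pi) ^ (-(d : ℝ))) *
        Kinetic.Psi d (fun s => (2 + δ s) / (2 - δ s)) lam
          (Kinetic.mixedNorm f₀)
          (ENNReal.ofReal ((2 * Real.pi) ^ ((d : ℝ) / 2)) *
            eLpNorm f₀ 2 (Kinetic.phaseMeasure d)) t := by
  have hpi : (0 : ℝ) < (2 * Real.pi) ^ (-(d : ℝ)) := by positivity
  have hmix : Kinetic.mixedNorm (f 0) = Kinetic.mixedNorm f₀ := Kinetic.mixedNorm_congr hf.initial
  have hnorm : eLpNorm (f 0) 2 (Kinetic.phaseMeasure d) = eLpNorm f₀ 2 (Kinetic.phaseMeasure d) :=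
    eLpNorm_congr_ae hf.initial
  have hlow := Kinetic.modeDensity_le_mixedNorm (F := f 0) (hmix ▸ hf₀_mixed)
  have hdecay := Kinetic.modeDensity_decay hd hf hδ_cont hlam_cont hδ_range hlam_pos h_entropy
    h_equiv ht
  have hC : ContinuousOn (fun s => (2 + δ s) / (2 - δ s)) (Ioi 0) :=
    (continuousOn_const.add hδ_cont).div (continuousOn_const.sub hδ_cont)
      fun s hs => (sub_pos.2 (hδ_range s hs).2).ne'
  -- The prefactor is neither zero nor infinite, so it passes inside the infimum and the bound can
  -- be checked for each `R`.
  rw [Kinetic.Psi, ENNReal.mul_iInf_of_ne (by simpa using hpi) ENNReal.ofReal_ne_top]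
  refine le_iInf fun R => ?_
  rw [ENNReal.mul_iInf_of_ne (by simpa using hpi) ENNReal.ofReal_ne_top]
  refine le_iInf fun hR => ?_
  have key := Kinetic.lintegral_le_of_splitting hd ht hR hC
    (fun s hs => div_nonneg (by linarith [(hδ_range s hs).1]) (by linarith [(hδ_range s hs).2]))
    hlam_cont hlam_mono (Kinetic.measurable_modeDensity (f 0)) hdecay hlow
  rw [Kinetic.lintegral_modeDensity, Kinetic.lintegral_modeDensity, hmix, hnorm] at key
  refine key.trans (le_of_eq ?_)
  have hone := Kinetic.two_pi_rpow_mul d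
  set a := ENNReal.ofReal ((2 * Real.pi) ^ (-(d : ℝ)))
  set b := ENNReal.ofReal ((2 * Real.pi) ^ ((d : ℝ) / 2))
  rw [mul_add, mul_pow]
  congr 1
  · ring
  · rw [mul_left_comm, ← mul_assoc a, hone, one_mul]
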